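/- All objects are finite. A hypergraph consists of vertices, edges and incidences, each incidence containing one vertex and one edge; parallel incidences are allowed. The degree of a vertex (size of an edge) is its number of incidences; a $k$-edge is an edge of size $k$. An oriented hypergraph carries in addition a sign $\sigma(i)\in\{+1,-1\}$ on each incidence $i$. Its incidence matrix has as $(v,e)$-entry the sum of $\sigma(i)$ over the incidences $i$ containing $v$ and $e$. It is minimally dependent if the family of columns of this matrix is linearly dependent over $\mathbb{R}$ and every proper subfamily is independent. A circle of length $k\ge 1$ is a closed alternating sequence of $k$ vertices and $k$ edges, joined by $2k$ incidences, without repetitions; its sign is $(-1)^k$ times the product of the signs of its incidences. An oriented hypergraph is balanced if all its circles are positive; a balanced minimal dependency is a balanced, minimally dependent oriented hypergraph. A path is an alternating sequence of vertices and edges, consecutive ones joined by incidences, without repetitions; a hypergraph is connected if any two of its vertices and edges are joined by a path. A subhypergraph is given by sets of vertices, edges and incidences containing the ends of each chosen incidence; two are disjoint if they have nothing in common, and nearly-disjoint if they are disjoint or have exactly a single vertex in common. Weak deletion removes vertices or edges together with the incidences containing them. The subhypergraph induced by a set of edges consists of these edges, all incidences containing them, and the vertices of those incidences. A hypergraph is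 circle-covered if any two of its incidences lie in a common circle and it either contains a circle or is a single $0$-edge (with no vertices). A flower is a circle-covered hypergraph none of whose proper edge-induced subhypergraphs is circle-covered. A thorn is a vertex of degree $1$ whose edge lies in a circle or is a $1$-edge. A pseudo-flower is a hypergraph with at least one thorn such that weak deletion of all its thorns leaves a flower (so a single $1$-edge with its vertex is a pseudo-flower). An artery is a connected hypergraph without circles and $1$-edges all of whose vertices have degree $1$ or $2$, or a single vertex; its external vertices are those of degree $\neq 2$ in it. A floral thorn-connection is a connected hypergraph without vertices of degree $1$ that is the union of a non-empty collection $\mathcal P$ of pairwise nearly-disjoint pseudo-flowers and a collection $\mathcal A$ of pairwise disjoint arteries such that: if $P\in\mathcal P$ meets $A\in\mathcal A$, then $P\cap A$ is a single vertex, which is a thorn of $P$ and an external vertex of $A$; if distinct $P,Q\in\mathcal P$ meet, then $P\cap Q$ is a single vertex $w$, the one-vertex artery $w$ belongs to $\mathcal A$, and no further member of $\mathcal P$ contains $w$; and weak deletion of any one edge or vertex of an artery in $\mathcal A$ disconnects the hypergraph. Contraction of a vertex of degree $2$ removes it and combines its two edges into one. A hypercircle is a single $0$-edge, a flower, or the result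 of contracting all vertices that lie in arteries of a floral thorn-connection. A subdivision of an oriented hypergraph splits one edge $e$ into two edges $e_1,e_2$ along a bipartition of the incidences of $e$ (a part may be empty), keeping their signs, and adds one new vertex $u$ with one new incidence to each of $e_1,e_2$, with arbitrary signs. It is balanced if the two new signs are opposite, or if they are equal and $u$ lies in no circle of the subdivided hypergraph. A balanced subdivision of $H$ is, up to isomorphism, the result of finitely many (possibly no) successive such balanced steps starting from $H$. Theorem. Let $G$ be an oriented hypergraph without isolated vertices (vertices of degree $0$). Then $G$ is a balanced minimal dependency if and only if $G$ is a balanced subdivision of a balanced hypercircle (an oriented hypergraph that is balanced and whose underlying hypergraph is a hypercircle). If parallel incidences of $G$ have equal signs, the same equivalence holds with hypercircles restricted to those whose parallel incidences have equal signs. -/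

import Mathlib

universe u

/-- A finite hypergraph, presented by its set `I` of incidences: `i : I` is an incidence containing
the vertex `vert i` and the edge `edge i`. The multiplicity of `(v, e)` is the number of
`i` with `vert i = v` and `edge i = e`; it may be any natural number. Edges of size `0` or `1`
and vertices of degree `0` are allowed. -/
structure IncHypergraph where
  V : Type u
  E : Type u
  I : Type u
  vert : I → V
  edge : I → E
  finite_V : Finite V
  finite_E : Finite E
  finite_I : Finite I

attribute [instance] IncHypergraph.finite_V IncHypergraph.finite_E IncHypergraph.finite_I

namespace IncHypergraph

/-- The number of incidences containing `v`. -/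
noncomputable def degree (G : IncHypergraph.{u}) (v : G.V) : ℕ := Nat.card {i : G.I // G.vert i = v}

/-- The number of incidences containing `e`. -/
noncomputable def size (G : IncHypergraph.{u}) (e : G.E) : ℕ := Nat.card {i : G.I // G.edge i = e}

/-- The incidence graph (with parallel edges merged), used for connectivity only. -/
def incidenceGraph (G : IncHypergraph.{u}) : SimpleGraph (G.V ⊕ G.E) :=
  SimpleGraph.fromRel fun x y => ∃ i : G.I, x = Sum.inl (G.vert i) ∧ y = Sum.inr (G.edge i)

/-- Any two elements of `V ∪ E` are joined by a path. The empty hypergraph is connected. -/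
def IsConnected (G : IncHypergraph.{u}) : Prop := G.incidenceGraph.Preconnected

/-- A circle of length `n + 1`, written as a closed sequence
`v 0, out 0, e 0, ret 0, v 1, out 1, e 1, ret 1, …, v n, out n, e n, ret n, v 0`
without repetition of a vertex, an edge or an incidence.
Addition in `Fin (n + 1)` is cyclic. -/
structure Circle (G : IncHypergraph.{u}) where
  n : ℕ
  v : Fin (n + 1) → G.V
  e : Fin (n + 1) → G.E
  out : Fin (n + 1) → G.I
  ret : Fin (n + 1) → G.I
  vert_out : ∀ t, G.vert (out t) = v t
  edge_out : ∀ t, G.edge (out t) = e t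
  edge_ret : ∀ t, G.edge (ret t) = e t
  vert_ret : ∀ t, G.vert (ret t) = v (t + 1)
  v_injective : Function.Injective v
  e_injective : Function.Injective e
  out_injective : Function.Injective out
  ret_injective : Function.Injective ret
  out_ne_ret : ∀ s t, out s ≠ ret t

/-- The vertices of a circle. -/
def Circle.verts {G : IncHypergraph.{u}} (C : G.Circle) : Set G.V := Set.range C.v

/-- The edges of a circle. -/
def Circle.edges {G : IncHypergraph.{u}} (C : G.Circle) : Set G.E := Set.range C.e

/-- The incidences of a circle. -/
def Circle.incs {G : IncHypergraph.{u}} (C : G.Circle) : Set G.I :=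
  Set.range C.out ∪ Set.range C.ret

/-- An isomorphism of hypergraphs. -/
structure Iso (G H : IncHypergraph.{u}) where
  onV : G.V ≃ H.V
  onE : G.E ≃ H.E
  onI : G.I ≃ H.I
  vert_onI : ∀ i, H.vert (onI i) = onV (G.vert i)
  edge_onI : ∀ i, H.edge (onI i) = onE (G.edge i)

/-! ### Subhypergraphs -/

/-- A subhypergraph: sets of vertices, edges and incidences such that every chosen incidence
has both of its ends chosen. Parts of edges may be missing. -/
@[ext]
structure Sub (G : IncHypergraph.{u}) where
  verts : Set G.V
  edges : Set G.E
  incs : Set G.I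
  vert_mem : ∀ i ∈ incs, G.vert i ∈ verts
  edge_mem : ∀ i ∈ incs, G.edge i ∈ edges

namespace Sub

variable {G : IncHypergraph.{u}}

/-- A subhypergraph as a hypergraph of its own. -/
def toHypergraph (H : G.Sub) : IncHypergraph.{u} where
  V := H.verts
  E := H.edges
  I := H.incs
  vert i := ⟨G.vert i, H.vert_mem i i.2⟩
  edge i := ⟨G.edge i, H.edge_mem i i.2⟩
  finite_V := inferInstance
  finite_E := inferInstance
  finite_I := inferInstance

/-- The whole hypergraph. -/
def whole (G : IncHypergraph.{u}) : G.Sub :=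
  ⟨Set.univ, Set.univ, Set.univ, fun _ _ => trivial, fun _ _ => trivial⟩

/-- The empty subhypergraph `(∅, ∅, ∅)`. -/
def empty (G : IncHypergraph.{u}) : G.Sub := ⟨∅, ∅, ∅, fun _ h => h.elim, fun _ h => h.elim⟩

/-- The subhypergraph `(v, ∅, ∅)`. -/
def single (v : G.V) : G.Sub := ⟨{v}, ∅, ∅, fun _ h => h.elim, fun _ h => h.elim⟩

/-- The componentwise intersection. -/
def inter (H K : G.Sub) : G.Sub where
  verts := H.verts ∩ K.verts
  edges := H.edges ∩ K.edges
  incs := H.incs ∩ K.incs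
  vert_mem i h := ⟨H.vert_mem i h.1, K.vert_mem i h.2⟩
  edge_mem i h := ⟨H.edge_mem i h.1, K.edge_mem i h.2⟩

end Sub

/-- The edge-induced subhypergraph `G : F`: the edges in `F`, the vertices incident to them, and
all incidences between them. -/
def edgeInduced (G : IncHypergraph.{u}) (F : Set G.E) : G.Sub where
  verts := {v | ∃ i, G.vert i = v ∧ G.edge i ∈ F}
  edges := F
  incs := {i | G.edge i ∈ F}
  vert_mem i h := ⟨i, rfl, h⟩
  edge_mem _ h := h

/-- Weak deletion of a set of vertices, together with the incidences containing them. -/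
def deleteVerts (G : IncHypergraph.{u}) (S : Set G.V) : G.Sub where
  verts := Sᶜ
  edges := Set.univ
  incs := {i | G.vert i ∉ S}
  vert_mem _ h := h
  edge_mem _ _ := trivial

/-- Weak deletion of an edge, together with the incidences containing it. -/
def deleteEdge (G : IncHypergraph.{u}) (e : G.E) : G.Sub where
  verts := Set.univ
  edges := {e}ᶜ
  incs := {i | G.edge i ≠ e}
  vert_mem _ _ := trivial
  edge_mem _ h := h

/-! ### Flowers and pseudo-flowers -/

/-- A hypergraph that consists of one edge of size `0` and nothing else. -/
def IsZeroEdge (G : IncHypergraph.{u}) : Prop := IsEmpty G.V ∧ ∃! _e : G.E, True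

/-- Every pair of incidences is contained in a circle. -/
def IsInseparable (G : IncHypergraph.{u}) : Prop :=
  ∀ i j : G.I, i ≠ j → ∃ C : G.Circle, i ∈ C.incs ∧ j ∈ C.incs

/-- Inseparable, and either containing a circle or being a single `0`-edge. -/
def IsCircleCovered (G : IncHypergraph.{u}) : Prop :=
  G.IsInseparable ∧ (Nonempty G.Circle ∨ G.IsZeroEdge)

/-- A circle-covered hypergraph that is minimal among its edge-induced subhypergraphs. -/
def IsFlower (G : IncHypergraph.{u}) : Prop :=
  G.IsCircleCovered ∧
    ∀ F : Set G.E, (G.edgeInduced F).toHypergraph.IsCircleCovered →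
      G.edgeInduced F = Sub.whole G

/-- A thorn is a monovalent vertex whose edge lies in a circle. The vertex of a `1`-edge counts as
a thorn as well, so that a single `1`-edge is a pseudo-flower whose flower-part is a `0`-edge. -/
def IsThorn (G : IncHypergraph.{u}) (v : G.V) : Prop :=
  G.degree v = 1 ∧
    ∃ i, G.vert i = v ∧ ((∃ C : G.Circle, G.edge i ∈ C.edges) ∨ G.size (G.edge i) = 1)

/-- At least one thorn, and the weak deletion of all thorns leaves a flower. -/
def IsPseudoFlower (G : IncHypergraph.{u}) : Prop :=
  (∃ v, G.IsThorn v) ∧ (G.deleteVerts {v | G.IsThorn v}).toHypergraph.IsFlower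

/-! ### Arteries and hypercircles -/

/-- Either connected, circle-free and without `1`-edges, all vertices having degree `1` or `2`,
or a single vertex. -/
def IsArtery (G : IncHypergraph.{u}) : Prop :=
  (G.IsConnected ∧ IsEmpty G.Circle ∧ (∀ e, G.size e ≠ 1) ∧ ∀ v, G.degree v = 1 ∨ G.degree v = 2) ∨
    ((∃! _v : G.V, True) ∧ IsEmpty G.E)

/-- `G` is the union of the collection `Hs` of pairwise nearly-disjoint hypergraphs and of the
collection `As` of pairwise disjoint arteries, and it is an arterial connection of them. -/
structure IsArterialConnection (G : IncHypergraph.{u}) (Hs As : Set G.Sub) : Prop where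
  cover_V : ∀ v, ∃ K ∈ Hs ∪ As, v ∈ K.verts
  cover_E : ∀ e, ∃ K ∈ Hs ∪ As, e ∈ K.edges
  cover_I : ∀ i, ∃ K ∈ Hs ∪ As, i ∈ K.incs
  artery : ∀ A ∈ As, A.toHypergraph.IsArtery
  arteries_disjoint : ∀ A ∈ As, ∀ B ∈ As, A ≠ B → A.inter B = Sub.empty G
  nearly_disjoint : ∀ H ∈ Hs, ∀ K ∈ Hs, H ≠ K →
    H.inter K = Sub.empty G ∨ ∃ w, H.inter K = Sub.single w
  connected : G.IsConnected
  meet_artery : ∀ H ∈ Hs, ∀ A ∈ As, H.inter A ≠ Sub.empty G →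
    ∃ v : A.toHypergraph.V, H.inter A = Sub.single v.1 ∧ A.toHypergraph.degree v ≠ 2
  meet_in_artery : ∀ H ∈ Hs, ∀ K ∈ Hs, H ≠ K → H.inter K ≠ Sub.empty G →
    ∃ w, H.inter K = Sub.single w ∧ Sub.single w ∈ As
  only_two : ∀ H ∈ Hs, ∀ K ∈ Hs, H ≠ K → ∀ w, H.inter K = Sub.single w →
    ∀ L ∈ Hs, w ∈ L.verts → L = H ∨ L = K
  edge_disconnects : ∀ A ∈ As, ∀ e ∈ A.edges, ¬ (G.deleteEdge e).toHypergraph.IsConnected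
  vert_disconnects : ∀ A ∈ As, ∀ v ∈ A.verts, ¬ (G.deleteVerts {v}).toHypergraph.IsConnected

/-- A thorn-connection of a (non-empty) collection of pseudo-flowers: an arterial connection in
which arteries meet pseudo-flowers in thorns only. -/
structure IsThornConnection (G : IncHypergraph.{u}) (Ps As : Set G.Sub) : Prop where
  nonempty : Ps.Nonempty
  pseudoFlower : ∀ P ∈ Ps, P.toHypergraph.IsPseudoFlower
  arterial : G.IsArterialConnection Ps As
  meet_thorn : ∀ P ∈ Ps, ∀ A ∈ As, P.inter A ≠ Sub.empty G →
    ∃ t : P.toHypergraph.V, P.inter A = Sub.single t.1 ∧ P.toHypergraph.IsThorn t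

/-- There are no monovalent vertices. -/
def IsFloral (G : IncHypergraph.{u}) : Prop := ∀ v, G.degree v ≠ 1

/-- Contraction of all vertices of `S`, one after the other: contracting a vertex of degree `2`
removes it and combines its two edges into one. -/
def contractVerts (G : IncHypergraph.{u}) (S : Set G.V) : IncHypergraph.{u} where
  V := (Sᶜ : Set G.V)
  E := Quot fun e f : G.E =>
    ∃ i j : G.I, G.vert i ∈ S ∧ G.vert i = G.vert j ∧ G.edge i = e ∧ G.edge j = f
  I := {i : G.I // G.vert i ∉ S}
  vert i := ⟨G.vert i.1, i.2⟩
  edge i := Quot.mk _ (G.edge i.1)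
  finite_V := inferInstance
  finite_E := inferInstance
  finite_I := inferInstance

/-- A hypercircle: a `0`-edge, a flower, or the result of contracting all vertices that belong to
the arteries of a floral thorn-connection. -/
def IsHypercircle (G : IncHypergraph.{u}) : Prop :=
  G.IsZeroEdge ∨ G.IsFlower ∨
    ∃ (T : IncHypergraph.{u}) (Ps As : Set T.Sub), T.IsThornConnection Ps As ∧ T.IsFloral ∧
      Nonempty (Iso (T.contractVerts {v | ∃ A ∈ As, v ∈ A.verts}) G)

end IncHypergraph

/-- An oriented hypergraph: a hypergraph with a sign on every incidence. -/
structure OrientedHypergraph extends IncHypergraph.{u} where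
  σ : I → ℤˣ

namespace OrientedHypergraph

/-- Parallel incidences carry the same orientation. -/
def ParallelAgree (G : OrientedHypergraph.{u}) : Prop :=
  ∀ i j : G.I, G.vert i = G.vert j → G.edge i = G.edge j → G.σ i = G.σ j

/-- The sign of a circle of length `k`: `(-1) ^ k` times the product of its `2 * k` incidences. -/
def circleSign (G : OrientedHypergraph.{u}) (C : G.toIncHypergraph.Circle) : ℤˣ :=
  (-1) ^ (C.n + 1) * ∏ t, G.σ (C.out t) * G.σ (C.ret t)

/-- All circles are positive. -/
def IsBalanced (G : OrientedHypergraph.{u}) : Prop :=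
  ∀ C : G.toIncHypergraph.Circle, G.circleSign C = 1

/-- The incidence matrix; the sum is finite. -/
noncomputable def incidenceMatrix (G : OrientedHypergraph.{u}) : Matrix G.V G.E ℝ :=
  fun v e => ∑ᶠ i : {i : G.I // G.vert i = v ∧ G.edge i = e}, (((G.σ i.1 : ℤˣ) : ℤ) : ℝ)

/-- The family of columns of the incidence matrix is linearly dependent, and every
proper subfamily is linearly independent. -/
def IsMinimallyDependent (G : OrientedHypergraph.{u}) : Prop :=
  ¬ LinearIndependent ℝ G.incidenceMatrix.col ∧
    ∀ F : Set G.E, F ≠ Set.univ → LinearIndepOn ℝ G.incidenceMatrix.col F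

/-- An isomorphism that preserves the orientation. -/
structure Iso (G H : OrientedHypergraph.{u}) extends
    IncHypergraph.Iso G.toIncHypergraph H.toIncHypergraph where
  σ_onI : ∀ i, H.σ (onI i) = G.σ i

open Classical in
/-- Subdivision of the edge `e`: the incidences of `e` that lie in `B` are moved to a new edge
`none`, the others stay at `some e`, and a new vertex `none` is put between the two, with
an incidence of sign `s` at `some e` and one of sign `t` at `none`.
Either part of the bipartition may be empty. -/
noncomputable def subdivide (G : OrientedHypergraph.{u}) (e : G.E) (B : Set G.I) (s t : ℤˣ) :
    OrientedHypergraph.{u} where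
  V := Option G.V
  E := Option G.E
  I := G.I ⊕ Bool
  vert := Sum.elim (fun i => some (G.vert i)) (fun _ => none)
  edge := Sum.elim (fun i => if G.edge i = e ∧ i ∈ B then none else some (G.edge i))
    (fun b => if b then none else some e)
  σ := Sum.elim G.σ (fun b => if b then t else s)
  finite_V := inferInstance
  finite_E := inferInstance
  finite_I := inferInstance

/-- `H` arises from `G` by one balanced subdivision: the two new incidences have
opposite signs (compatible), or they have equal signs (incompatible) and the new vertex lies in
no circle of the subdivision. -/
def IsBalancedSubdivisionStep (G H : OrientedHypergraph.{u}) : Prop :=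
  ∃ (e : G.E) (B : Set G.I) (s t : ℤˣ), Nonempty (Iso (G.subdivide e B s t) H) ∧
    (s * t = -1 ∨ (s * t = 1 ∧
      ∀ C : (G.subdivide e B s t).toIncHypergraph.Circle, (none : Option G.V) ∉ C.verts))

/-- `H` arises from `G` by finitely many (possibly no) successive balanced subdivisions. -/
def IsBalancedSubdivision (G H : OrientedHypergraph.{u}) : Prop :=
  Relation.ReflTransGen IsBalancedSubdivisionStep G H

/-- A hypercircle all of whose circles are positive. -/
def IsBalancedHypercircle (G : OrientedHypergraph.{u}) : Prop :=
  G.toIncHypergraph.IsHypercircle ∧ G.IsBalanced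

end OrientedHypergraph

/-!
Call a set of incidences even if it meets every vertex and every edge an even number of times.
Circles are the minimal nonempty even sets, so `G` is balanced if and only if the signs over every
even set sum to a multiple of four. For a balanced `G` without isolated vertices, being minimally
dependent amounts to being connected with all vertices of degree two:

* a vector `x` of minimal support in the kernel of the incidence matrix has at most two incidences
  of its support at each vertex `w`. Drop the row of `w`: either `x` remains minimal, or its
  support is covered by those of two minimal vectors that the row of `w` does not annihilate. By
  balance, any two incidences at `w` in the support of a minimal vector cancel in that row, so
  there are at most two of them in the first case and at most one for each of the two vectors in
  the second;
* conversely, if all degrees are two, balance lets one choose signs on the edges that form a kernel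
  vector, and the zeros of a kernel vector spread along a connected hypergraph.

Balanced hypercircles have these properties, and balanced subdivisions keep them. Conversely,
contracting a vertex of degree two that lies in no circle inverts a balanced subdivision. Once all
vertices lie in circles, the classes of incidences lying in common circles are flowers, and
separating the edges shared by several classes by new vertices exhibits the hypergraph as a
contracted thorn-connection.
-/

namespace IncHypergraph

variable {G : IncHypergraph.{u}}

noncomputable instance : Fintype G.V := Fintype.ofFinite _
noncomputable instance : Fintype G.E := Fintype.ofFinite _
noncomputable instance : Fintype G.I := Fintype.ofFinite _
noncomputable instance : DecidableEq G.V := Classical.decEq _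
noncomputable instance : DecidableEq G.E := Classical.decEq _
noncomputable instance : DecidableEq G.I := Classical.decEq _

/-! ### Connectivity through a set of incidences -/

/-- The part of the incidence graph formed by the incidences in `T`. -/
def incidenceGraphOn (T : Set G.I) : SimpleGraph (G.V ⊕ G.E) :=
  SimpleGraph.fromRel fun x y => ∃ i ∈ T, x = Sum.inl (G.vert i) ∧ y = Sum.inr (G.edge i)

/-- Two nodes, vertices or edges, are linked if a walk using incidences in `T` only joins them. -/
def Linked (T : Set G.I) (a b : G.V ⊕ G.E) : Prop := (incidenceGraphOn T).Reachable a b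

section Linked

variable {T U : Set G.I} {a b c : G.V ⊕ G.E}

theorem incidenceGraphOn_adj :
    (incidenceGraphOn T).Adj a b ↔
      ∃ i ∈ T, (a = Sum.inl (G.vert i) ∧ b = Sum.inr (G.edge i)) ∨
        (a = Sum.inr (G.edge i) ∧ b = Sum.inl (G.vert i)) := by
  rw [incidenceGraphOn, SimpleGraph.fromRel_adj]
  constructor
  · rintro ⟨-, ⟨i, hi, ha, hb⟩ | ⟨i, hi, hb, ha⟩⟩
    exacts [⟨i, hi, Or.inl ⟨ha, hb⟩⟩, ⟨i, hi, Or.inr ⟨ha, hb⟩⟩]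
  · rintro ⟨i, hi, ⟨rfl, rfl⟩ | ⟨rfl, rfl⟩⟩
    exacts [⟨Sum.inl_ne_inr, Or.inl ⟨i, hi, rfl, rfl⟩⟩, ⟨Sum.inr_ne_inl, Or.inr ⟨i, hi, rfl, rfl⟩⟩]

theorem incidenceGraphOn_adj_inl_inr {v : G.V} {e : G.E} :
    (incidenceGraphOn T).Adj (Sum.inl v) (Sum.inr e) ↔ ∃ i ∈ T, G.vert i = v ∧ G.edge i = e := by
  simp [incidenceGraphOn_adj, eq_comm]

theorem incidenceGraphOn_univ : incidenceGraphOn (Set.univ : Set G.I) = G.incidenceGraph := by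
  simp [incidenceGraph, incidenceGraphOn]

theorem isConnected_iff_linked :
    G.IsConnected ↔ ∀ a b, Linked (Set.univ : Set G.I) a b := by
  simp only [Linked, incidenceGraphOn_univ]
  rfl

theorem Linked.refl (T : Set G.I) (a : G.V ⊕ G.E) : Linked T a a := SimpleGraph.Reachable.rfl

theorem Linked.trans (h : Linked T a b) (k : Linked T b c) : Linked T a c :=
  SimpleGraph.Reachable.trans h k

theorem Linked.symm (h : Linked T a b) : Linked T b a := SimpleGraph.Reachable.symm h

theorem Linked.mono (hTU : T ⊆ U) (h : Linked T a b) : Linked U a b := by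
  refine SimpleGraph.Reachable.mono (fun x y hxy => ?_) h
  obtain ⟨i, hi, hxy⟩ := incidenceGraphOn_adj.1 hxy
  exact incidenceGraphOn_adj.2 ⟨i, hTU hi, hxy⟩

theorem linked_vert_edge {i : G.I} (hi : i ∈ T) :
    Linked T (Sum.inl (G.vert i)) (Sum.inr (G.edge i)) :=
  (incidenceGraphOn_adj_inl_inr.2 ⟨i, hi, rfl, rfl⟩).reachable

theorem linked_vert_iff_edge {i : G.I} (hi : i ∈ T) :
    Linked T a (Sum.inl (G.vert i)) ↔ Linked T a (Sum.inr (G.edge i)) :=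
  ⟨fun h => h.trans (linked_vert_edge hi), fun h => h.trans (linked_vert_edge hi).symm⟩

theorem Linked.of_invariant (h : Linked T a b) {p : G.V ⊕ G.E → Prop}
    (hp : ∀ i ∈ T, p (Sum.inl (G.vert i)) ↔ p (Sum.inr (G.edge i))) (ha : p a) : p b := by
  obtain ⟨w⟩ := h
  induction w with
  | nil => exact ha
  | cons hadj _ ih =>
    obtain ⟨i, hi, ⟨rfl, rfl⟩ | ⟨rfl, rfl⟩⟩ := incidenceGraphOn_adj.1 hadj
    exacts [ih ((hp i hi).1 ha), ih ((hp i hi).2 ha)]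

end Linked

/-! ### Circles from paths -/

section Alternation

variable {T : Set G.I} {v : G.V} {y : G.V ⊕ G.E}

theorem isLeft_getVert (w : (incidenceGraphOn T).Walk (Sum.inl v) y) {k : ℕ}
    (hk : k ≤ w.length) : (w.getVert k).isLeft ↔ Even k := by
  let side : (incidenceGraphOn T).Coloring Bool := SimpleGraph.Coloring.mk Sum.isLeft
    fun {a b} hab => by
      obtain ⟨i, -, ⟨rfl, rfl⟩ | ⟨rfl, rfl⟩⟩ := incidenceGraphOn_adj.1 hab <;> simp
  have := side.even_length_iff_congr (w.take k)
  rw [w.take_length, min_eq_left hk] at this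
  have hside : ∀ x, side x = x.isLeft := fun _ => rfl
  simpa only [hside, Sum.isLeft_inl, true_iff] using this.symm

theorem exists_getVert_eq_inl (w : (incidenceGraphOn T).Walk (Sum.inl v) y) {k : ℕ}
    (hk : 2 * k ≤ w.length) : ∃ x, w.getVert (2 * k) = Sum.inl x :=
  Sum.isLeft_iff.1 ((isLeft_getVert w hk).2 (even_two_mul k))

theorem exists_getVert_eq_inr (w : (incidenceGraphOn T).Walk (Sum.inl v) y) {k : ℕ}
    (hk : 2 * k + 1 ≤ w.length) : ∃ e, w.getVert (2 * k + 1) = Sum.inr e := by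
  refine Sum.isRight_iff.1 (Sum.not_isLeft.1 fun h => ?_)
  exact Nat.not_even_two_mul_add_one k ((isLeft_getVert w hk).1 h)

theorem exists_length_eq_two_mul_add_one {e : G.E}
    (w : (incidenceGraphOn T).Walk (Sum.inl v) (Sum.inr e)) : ∃ n, w.length = 2 * n + 1 := by
  refine Nat.not_even_iff_odd.1 fun h => ?_
  simpa using (isLeft_getVert w le_rfl).2 h

end Alternation

theorem exists_circle_of_alternating {T : Set G.I} {i : G.I} (hi : i ∉ T) {n : ℕ}
    {v : Fin (n + 1) → G.V} {e : Fin (n + 1) → G.E}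
    (hv : Function.Injective v) (he : Function.Injective e)
    (hout : ∀ t, ∃ j ∈ T, G.vert j = v t ∧ G.edge j = e t)
    (hret : ∀ t ≠ Fin.last n, ∃ j ∈ T, G.vert j = v (t + 1) ∧ G.edge j = e t)
    (hiv : G.vert i = v 0) (hie : G.edge i = e (Fin.last n)) :
    ∃ C : G.Circle, i ∈ C.incs ∧ C.incs ⊆ insert i T := by
  have hret' : ∀ t, ∃ j, (t = Fin.last n ∧ j = i ∨ t ≠ Fin.last n ∧ j ∈ T) ∧
      G.vert j = v (t + 1) ∧ G.edge j = e t := by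
    intro t
    rcases eq_or_ne t (Fin.last n) with rfl | ht
    · exact ⟨i, Or.inl ⟨rfl, rfl⟩, by rw [hiv, Fin.last_add_one], hie⟩
    · obtain ⟨j, hj, hjv, hje⟩ := hret t ht
      exact ⟨j, Or.inr ⟨ht, hj⟩, hjv, hje⟩
  choose out houtT hout_v hout_e using hout
  choose ret hretT hret_v hret_e using hret'
  have out_ne_ret : ∀ s t, out s ≠ ret t := by
    intro s t hst
    obtain rfl : s = t := he (by rw [← hout_e, ← hret_e, hst])
    rcases hretT s with ⟨-, hs⟩ | ⟨hs, -⟩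
    · exact hi (hs ▸ hst ▸ houtT s)
    · have hsucc : s = s + 1 := hv (by rw [← hout_v, ← hret_v, hst])
      exact absurd hsucc (Fin.lt_add_one_iff.2 (Fin.lt_last_iff_ne_last.2 hs)).ne
  refine ⟨⟨n, v, e, out, ret, hout_v, hout_e, hret_e, hret_v, hv, he,
    fun s t h => hv (by rw [← hout_v, ← hout_v, h]),
    fun s t h => he (by rw [← hret_e, ← hret_e, h]), out_ne_ret⟩, ?_, ?_⟩
  · exact Or.inr ⟨Fin.last n, (hretT (Fin.last n)).elim And.right fun h => absurd rfl h.1⟩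
  · rintro j (⟨t, rfl⟩ | ⟨t, rfl⟩)
    · exact Or.inr (houtT t)
    · exact (hretT t).imp And.right And.right

theorem Linked.exists_circle {T : Set G.I} {i : G.I} (hi : i ∉ T)
    (h : Linked T (Sum.inl (G.vert i)) (Sum.inr (G.edge i))) :
    ∃ C : G.Circle, i ∈ C.incs ∧ C.incs ⊆ insert i T := by
  obtain ⟨w, hw⟩ := SimpleGraph.Reachable.exists_isPath h
  obtain ⟨n, hn⟩ := exists_length_eq_two_mul_add_one w
  choose v hv using fun t : Fin (n + 1) => exists_getVert_eq_inl w (k := t) (by lia)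
  choose e he using fun t : Fin (n + 1) => exists_getVert_eq_inr w (k := t) (by lia)
  have hinj {k l : ℕ} (hk : k ≤ w.length) (hl : l ≤ w.length)
      (hkl : w.getVert k = w.getVert l) : k = l := hw.getVert_injOn hk hl hkl
  refine exists_circle_of_alternating hi (n := n) (v := v) (e := e) ?_ ?_ ?_ ?_ ?_ ?_
  · exact fun s t hst => Fin.ext (by
      have := hinj (by lia) (by lia) ((hv s).trans ((congrArg Sum.inl hst).trans (hv t).symm))
      lia)
  · exact fun s t hst => Fin.ext (by
      have := hinj (by lia) (by lia) ((he s).trans ((congrArg Sum.inr hst).trans (he t).symm))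
      lia)
  · intro t
    have hadj := w.adj_getVert_succ (i := 2 * t) (by lia)
    rwa [hv, he, incidenceGraphOn_adj_inl_inr] at hadj
  · intro t ht
    have hadj := (w.adj_getVert_succ (i := 2 * t + 1) (by have := Fin.val_lt_last ht; lia)).symm
    have hsucc : ((t + 1 : Fin (n + 1)) : ℕ) = t + 1 :=
      Fin.val_add_one_of_lt (Fin.lt_last_iff_ne_last.2 ht)
    rwa [show 2 * (t : ℕ) + 1 + 1 = 2 * (t + 1 : Fin (n + 1)) by lia, hv, he,
      incidenceGraphOn_adj_inl_inr] at hadj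
  · exact Sum.inl_injective (w.getVert_zero.symm.trans (hv 0))
  · refine Sum.inr_injective (w.getVert_length.symm.trans ?_)
    rw [hn]
    exact he (Fin.last n)

/-! ### Even sets of incidences -/

open scoped symmDiff

theorem sum_symmDiff_of_module_zmod_two {α M : Type*} [DecidableEq α] [AddCommGroup M]
    [Module (ZMod 2) M] (S T : Finset α) (f : α → M) :
    ∑ i ∈ S ∆ T, f i = ∑ i ∈ S, f i + ∑ i ∈ T, f i := by
  rw [← Finset.sum_inter_add_sum_sdiff S T, ← Finset.sum_inter_add_sum_sdiff T S,
    Finset.inter_comm T S, symmDiff_def, Finset.sup_eq_union,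
    Finset.sum_union disjoint_sdiff_sdiff, add_add_add_comm, ZModModule.add_self, zero_add]

/-- The boundary modulo `2` of a set of incidences, regarded as edges of the incidence graph. -/
noncomputable def boundary (S : Finset G.I) : G.V ⊕ G.E →₀ ZMod 2 :=
  ∑ i ∈ S, (Finsupp.single (Sum.inl (G.vert i)) 1 + Finsupp.single (Sum.inr (G.edge i)) 1)

/-- Every vertex and every edge is contained in an even number of incidences of `S`. -/
def IsEven (S : Finset G.I) : Prop := boundary S = 0

/-- If `a ≠ b`, these are exactly the nodes contained in an odd number of incidences of `S`;
if `a = b`, then `S` is even. -/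
def IsJoin (S : Finset G.I) (a b : G.V ⊕ G.E) : Prop :=
  boundary S = Finsupp.single a 1 + Finsupp.single b 1

section Boundary

variable {S T : Finset G.I} {a b c : G.V ⊕ G.E}

theorem boundary_symmDiff (S T : Finset G.I) : boundary (S ∆ T) = boundary S + boundary T :=
  sum_symmDiff_of_module_zmod_two S T _

theorem boundary_sdiff (hTS : T ⊆ S) : boundary (S \ T) = boundary S + boundary T := by
  rw [← boundary_symmDiff, symmDiff_of_ge hTS]

theorem linearCombination_boundary (h : G.V ⊕ G.E → ZMod 2) (S : Finset G.I) :
    Finsupp.linearCombination (ZMod 2) h (boundary S) =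
      ∑ i ∈ S, (h (Sum.inl (G.vert i)) + h (Sum.inr (G.edge i))) := by
  simp [boundary]

theorem mapDomain_boundary {α : Type*} (f : G.V ⊕ G.E → α) (S : Finset G.I) :
    (boundary S).mapDomain f = ∑ i ∈ S, (Finsupp.single (f (Sum.inl (G.vert i))) 1 +
      Finsupp.single (f (Sum.inr (G.edge i))) 1) := by
  simp [boundary, Finsupp.mapDomain_finsetSum, Finsupp.mapDomain_add]

theorem boundary_inl (S : Finset G.I) (v : G.V) :
    boundary S (Sum.inl v) = (S.filter fun i => G.vert i = v).card := by
  simp [boundary, Finsupp.finsetSum_apply, Finsupp.single_apply]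

theorem boundary_inr (S : Finset G.I) (e : G.E) :
    boundary S (Sum.inr e) = (S.filter fun i => G.edge i = e).card := by
  simp [boundary, Finsupp.finsetSum_apply, Finsupp.single_apply]

theorem IsEven.symmDiff (hS : IsEven S) (hT : IsEven T) : IsEven (S ∆ T) := by
  rw [IsEven, boundary_symmDiff, hS, hT, add_zero]

theorem IsEven.sdiff (hS : IsEven S) (hT : IsEven T) (h : T ⊆ S) : IsEven (S \ T) := by
  rw [IsEven, boundary_sdiff h, hS, hT, add_zero]

theorem IsEven.sdiff_isJoin (hS : IsEven S) (hT : IsJoin T a b) (h : T ⊆ S) :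
    IsJoin (S \ T) a b := by
  rw [IsJoin, boundary_sdiff h, hS, hT, zero_add]

theorem isJoin_empty (a : G.V ⊕ G.E) : IsJoin (∅ : Finset G.I) a a :=
  (ZModModule.add_self _).symm

theorem isJoin_singleton (i : G.I) : IsJoin {i} (Sum.inl (G.vert i)) (Sum.inr (G.edge i)) :=
  Finset.sum_singleton _ _

theorem IsJoin.symm (hS : IsJoin S a b) : IsJoin S b a := hS.trans (add_comm _ _)

theorem IsJoin.symmDiff (hS : IsJoin S a b) (hT : IsJoin T b c) : IsJoin (S ∆ T) a c := by
  rw [IsJoin, boundary_symmDiff, hS, hT, add_assoc, ← add_assoc _ _ (Finsupp.single c 1),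
    ZModModule.add_self, zero_add]

theorem IsJoin.isEven (hS : IsJoin S a a) : IsEven S := hS.trans (ZModModule.add_self _)

theorem IsJoin.isEven_union (hS : IsJoin S a b) (hT : IsJoin T a b) (hST : Disjoint S T) :
    IsEven (S ∪ T) := by
  rw [← Finset.sup_eq_union, ← hST.symmDiff_eq_sup]
  exact (hS.symmDiff hT.symm).isEven

theorem IsJoin.isEven_insert_insert {i j : G.I}
    (hS : IsJoin S (Sum.inr (G.edge i)) (Sum.inr (G.edge j))) (hij : i ≠ j)
    (hv : G.vert i = G.vert j) (hi : i ∉ S) (hj : j ∉ S) : IsEven (insert i (insert j S)) := by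
  have hpair : IsJoin ({j} ∆ {i}) (Sum.inr (G.edge j)) (Sum.inr (G.edge i)) :=
    (isJoin_singleton j).symm.symmDiff (hv ▸ isJoin_singleton i)
  convert (hS.symmDiff hpair).isEven using 1
  grind [Finset.mem_symmDiff]

theorem IsJoin.even_card_vert {e f : G.E} (hS : IsJoin S (Sum.inr e) (Sum.inr f)) (v : G.V) :
    Even (S.filter fun i => G.vert i = v).card := by
  rw [← ZMod.natCast_eq_zero_iff_even, ← boundary_inl, hS]
  simp

theorem IsJoin.sum_ends_eq (hS : IsJoin S a b) (h : G.V ⊕ G.E → ZMod 2) :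
    ∑ i ∈ S, (h (Sum.inl (G.vert i)) + h (Sum.inr (G.edge i))) = h a + h b := by
  rw [← linearCombination_boundary, hS]
  simp

theorem IsJoin.odd_card {e : G.E} {v : G.V} (hS : IsJoin S (Sum.inr e) (Sum.inl v)) :
    Odd S.card := by
  rw [← ZMod.natCast_eq_one_iff_odd]
  simpa using hS.sum_ends_eq fun x => if x.isLeft then 1 else 0

theorem IsEven.even_card_vert (hS : IsEven S) (v : G.V) :
    Even (S.filter fun i => G.vert i = v).card := by
  rw [← ZMod.natCast_eq_zero_iff_even, ← boundary_inl, hS, Finsupp.zero_apply]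

theorem IsEven.even_card_edge (hS : IsEven S) (e : G.E) :
    Even (S.filter fun i => G.edge i = e).card := by
  rw [← ZMod.natCast_eq_zero_iff_even, ← boundary_inr, hS, Finsupp.zero_apply]

theorem exists_ne_of_even_card_filter {α : Type*} {S : Finset α} {p : α → Prop}
    [DecidablePred p] (h : Even (S.filter p).card) {i : α} (hi : i ∈ S) (hp : p i) :
    ∃ j ∈ S, j ≠ i ∧ p j := by
  have hpos : 0 < (S.filter p).card := Finset.card_pos.2 ⟨i, Finset.mem_filter.2 ⟨hi, hp⟩⟩
  obtain ⟨j, hj, hji⟩ := Finset.exists_mem_ne (by grind : 1 < (S.filter p).card) i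
  exact ⟨j, (Finset.mem_filter.1 hj).1, hji, (Finset.mem_filter.1 hj).2⟩

theorem IsEven.exists_ne_vert_eq (hS : IsEven S) {i : G.I} (hi : i ∈ S) :
    ∃ j ∈ S, j ≠ i ∧ G.vert j = G.vert i :=
  exists_ne_of_even_card_filter (hS.even_card_vert _) hi rfl

theorem IsEven.exists_ne_edge_eq (hS : IsEven S) {i : G.I} (hi : i ∈ S) :
    ∃ j ∈ S, j ≠ i ∧ G.edge j = G.edge i :=
  exists_ne_of_even_card_filter (hS.even_card_edge _) hi rfl

theorem IsEven.map {H : IncHypergraph.{u}} (hS : IsEven S) (fV : G.V → H.V) (fE : G.E → H.E)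
    (fI : G.I ↪ H.I) (hV : ∀ i, H.vert (fI i) = fV (G.vert i))
    (hE : ∀ i, H.edge (fI i) = fE (G.edge i)) : IsEven (S.map fI) := by
  have hmap : boundary (S.map fI) = (boundary S).mapDomain (Sum.map fV fE) := by
    rw [mapDomain_boundary]
    simp [boundary, hV, hE]
  rw [IsEven, hmap, hS, Finsupp.mapDomain_zero]

theorem IsEven.preimage {H : IncHypergraph.{u}} {S : Finset H.I} (hS : IsEven S)
    (f : H.V ⊕ H.E → G.V ⊕ G.E) (g : G.I ↪ H.I)
    (hV : ∀ i, f (Sum.inl (H.vert (g i))) = Sum.inl (G.vert i))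
    (hE : ∀ i, f (Sum.inr (H.edge (g i))) = Sum.inr (G.edge i))
    (hloop : ∀ k ∉ Set.range g, f (Sum.inl (H.vert k)) = f (Sum.inr (H.edge k))) :
    IsEven (S.preimage g g.injective.injOn) := by
  have hmap := mapDomain_boundary f S
  rw [hS, Finsupp.mapDomain_zero, ← Finset.sum_preimage g S g.injective.injOn _
    fun k _ hk => hloop k hk ▸ ZModModule.add_self _] at hmap
  rw [IsEven, hmap, boundary]
  exact Finset.sum_congr rfl fun i _ => by rw [hV, hE]

theorem boundary_filter (p : G.V ⊕ G.E → Prop) [DecidablePred p]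
    (hp : ∀ i ∈ S, p (Sum.inl (G.vert i)) ↔ p (Sum.inr (G.edge i))) :
    boundary (S.filter fun i => p (Sum.inl (G.vert i))) = (boundary S).filter p := by
  rw [boundary, Finset.sum_filter, boundary, Finsupp.filter_sum]
  refine Finset.sum_congr rfl fun i hi => ?_
  rw [Finsupp.filter_add]
  split_ifs with h
  · rw [Finsupp.filter_single_of_pos _ h, Finsupp.filter_single_of_pos _ ((hp i hi).1 h)]
  · rw [Finsupp.filter_single_of_neg _ h, Finsupp.filter_single_of_neg _ (mt (hp i hi).2 h),
      add_zero]

theorem IsEven.filter (hS : IsEven S) (p : G.V ⊕ G.E → Prop) [DecidablePred p]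
    (hp : ∀ i ∈ S, p (Sum.inl (G.vert i)) ↔ p (Sum.inr (G.edge i))) :
    IsEven (S.filter fun i => p (Sum.inl (G.vert i))) := by
  rw [IsEven, boundary_filter p hp, hS, Finsupp.filter_zero]

theorem Linked.exists_isJoin {T : Set G.I} (h : Linked T a b) :
    ∃ P : Finset G.I, ↑P ⊆ T ∧ IsJoin P a b := by
  have hsub {P : Finset G.I} {i : G.I} (hi : i ∈ T) (hP : ↑P ⊆ T) : ↑(P ∆ {i}) ⊆ T := by
    intro j hj
    grind [Finset.mem_symmDiff]
  refine h.of_invariant (p := fun x => ∃ P : Finset G.I, ↑P ⊆ T ∧ IsJoin P a x)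
    (fun i hi => ⟨?_, ?_⟩) ⟨∅, by simp, isJoin_empty a⟩
  · rintro ⟨P, hP, hPa⟩
    exact ⟨P ∆ {i}, hsub hi hP, hPa.symmDiff (isJoin_singleton i)⟩
  · rintro ⟨P, hP, hPa⟩
    exact ⟨P ∆ {i}, hsub hi hP, hPa.symmDiff (isJoin_singleton i).symm⟩

theorem IsJoin.linked {T : Set G.I} (hS : IsJoin S a b) (hST : ↑S ⊆ T) : Linked T a b := by
  classical
  by_contra hb
  have hsum := hS.sum_ends_eq fun x => if Linked T a x then 1 else 0
  rw [Finset.sum_eq_zero fun i hi => ?_] at hsum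
  · simp [Linked.refl, hb] at hsum
  · simp only [linked_vert_iff_edge (hST hi), CharTwo.add_self_eq_zero]

end Boundary

/-! ### Circles as minimal even sets -/

namespace Circle

/-- The set of incidences of a circle as a finset. -/
noncomputable def supp (C : G.Circle) : Finset G.I := C.incs.toFinite.toFinset

@[simp]
theorem mem_supp {C : G.Circle} {i : G.I} : i ∈ C.supp ↔ i ∈ C.incs := by
  simp [supp]

theorem out_mem_supp (C : G.Circle) (t : Fin (C.n + 1)) : C.out t ∈ C.supp :=
  mem_supp.2 (Or.inl ⟨t, rfl⟩)

theorem sum_supp {M : Type*} [AddCommMonoid M] (C : G.Circle) (f : G.I → M) :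
    ∑ i ∈ C.supp, f i = ∑ t, (f (C.out t) + f (C.ret t)) := by
  have hsupp : C.supp = Finset.univ.image C.out ∪ Finset.univ.image C.ret := by
    ext i
    simp [incs]
  have hdisj : Disjoint (Finset.univ.image C.out) (Finset.univ.image C.ret) := by
    simp [Finset.disjoint_left, (C.out_ne_ret _ _).symm]
  rw [hsupp, Finset.sum_union hdisj, Finset.sum_image C.out_injective.injOn,
    Finset.sum_image C.ret_injective.injOn, Finset.sum_add_distrib]

theorem isEven_supp (C : G.Circle) : IsEven C.supp := by
  have hshift : ∑ t, Finsupp.single (Sum.inl (C.v (t + 1)) : G.V ⊕ G.E) (1 : ZMod 2) =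
      ∑ t, Finsupp.single (Sum.inl (C.v t)) 1 :=
    Equiv.sum_comp (Equiv.addRight 1) fun t => Finsupp.single (Sum.inl (C.v t)) 1
  simp only [IsEven, boundary, C.sum_supp, C.vert_out, C.edge_out, C.edge_ret, C.vert_ret,
    Finset.sum_add_distrib, hshift]
  exact ZModModule.add_self _

theorem eq_out_or_eq_ret_of_vert_eq (C : G.Circle) {i : G.I} (hi : i ∈ C.supp)
    {t : Fin (C.n + 1)} (h : G.vert i = C.v t) : i = C.out t ∨ i = C.ret (t - 1) := by
  rcases mem_supp.1 hi with ⟨s, rfl⟩ | ⟨s, rfl⟩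
  · exact Or.inl (by rw [C.v_injective ((C.vert_out s).symm.trans h)])
  · exact Or.inr (by rw [← C.v_injective ((C.vert_ret s).symm.trans h), add_sub_cancel_right])

theorem eq_out_or_eq_ret_of_edge_eq (C : G.Circle) {i : G.I} (hi : i ∈ C.supp)
    {t : Fin (C.n + 1)} (h : G.edge i = C.e t) : i = C.out t ∨ i = C.ret t := by
  rcases mem_supp.1 hi with ⟨s, rfl⟩ | ⟨s, rfl⟩
  · exact Or.inl (by rw [C.e_injective ((C.edge_out s).symm.trans h)])
  · exact Or.inr (by rw [C.e_injective ((C.edge_ret s).symm.trans h)])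

theorem vert_mem_verts (C : G.Circle) {i : G.I} (hi : i ∈ C.supp) : G.vert i ∈ C.verts := by
  rcases mem_supp.1 hi with ⟨s, rfl⟩ | ⟨s, rfl⟩
  exacts [⟨s, (C.vert_out s).symm⟩, ⟨s + 1, (C.vert_ret s).symm⟩]

theorem edge_mem_edges (C : G.Circle) {i : G.I} (hi : i ∈ C.supp) : G.edge i ∈ C.edges := by
  rcases mem_supp.1 hi with ⟨s, rfl⟩ | ⟨s, rfl⟩
  exacts [⟨s, (C.edge_out s).symm⟩, ⟨s, (C.edge_ret s).symm⟩]

theorem mem_verts_iff (C : G.Circle) {v : G.V} : v ∈ C.verts ↔ ∃ i ∈ C.supp, G.vert i = v := by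
  constructor
  · rintro ⟨t, rfl⟩
    exact ⟨_, C.out_mem_supp t, C.vert_out t⟩
  · rintro ⟨i, hi, rfl⟩
    exact C.vert_mem_verts hi

theorem eq_or_eq_or_eq_of_vert_eq (C : G.Circle) {i j k : G.I} (hi : i ∈ C.supp)
    (hj : j ∈ C.supp) (hk : k ∈ C.supp) (hij : G.vert i = G.vert j)
    (hik : G.vert i = G.vert k) : i = j ∨ i = k ∨ j = k := by
  obtain ⟨t, ht⟩ := C.vert_mem_verts hi
  rcases C.eq_out_or_eq_ret_of_vert_eq hi ht.symm with h1 | h1 <;>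
  rcases C.eq_out_or_eq_ret_of_vert_eq hj (hij ▸ ht.symm) with h2 | h2 <;>
  rcases C.eq_out_or_eq_ret_of_vert_eq hk (hik ▸ ht.symm) with h3 | h3 <;> simp [h1, h2, h3]

open Fin.NatCast Fin.CommRing in
theorem eq_supp_of_isEven (C : G.Circle) {S : Finset G.I} (hS : IsEven S) (hSC : S ⊆ C.supp)
    (hne : S.Nonempty) : S = C.supp := by
  have ret_of_out (t) (ht : C.out t ∈ S) : C.ret t ∈ S := by
    obtain ⟨j, hj, hji, h⟩ := hS.exists_ne_edge_eq ht
    rcases C.eq_out_or_eq_ret_of_edge_eq (hSC hj) (h.trans (C.edge_out t)) with rfl | rfl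
    exacts [absurd rfl hji, hj]
  have out_of_ret (t) (ht : C.ret t ∈ S) : C.out (t + 1) ∈ S := by
    obtain ⟨j, hj, hji, h⟩ := hS.exists_ne_vert_eq ht
    rcases C.eq_out_or_eq_ret_of_vert_eq (hSC hj) (h.trans (C.vert_ret t)) with rfl | rfl
    exacts [hj, absurd (by rw [add_sub_cancel_right]) hji]
  obtain ⟨t₀, ht₀⟩ : ∃ t, C.out t ∈ S := by
    obtain ⟨i, hi⟩ := hne
    rcases mem_supp.1 (hSC hi) with ⟨s, rfl⟩ | ⟨s, rfl⟩
    exacts [⟨s, hi⟩, ⟨s + 1, out_of_ret s hi⟩]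
  have out_add (k : ℕ) : C.out (t₀ + (k : Fin (C.n + 1))) ∈ S := by
    induction k with
    | zero => simpa using ht₀
    | succ k ih =>
      have := out_of_ret _ (ret_of_out _ ih)
      rwa [add_assoc, ← Nat.cast_succ] at this
  have out_mem (t) : C.out t ∈ S := by
    have := out_add (t - t₀ : Fin (C.n + 1)).val
    rwa [Fin.cast_val_eq_self, add_sub_cancel] at this
  refine hSC.antisymm fun i hi => ?_
  rcases mem_supp.1 hi with ⟨s, rfl⟩ | ⟨s, rfl⟩
  exacts [out_mem s, ret_of_out s (out_mem s)]

theorem supp_nonempty (C : G.Circle) : C.supp.Nonempty := ⟨_, C.out_mem_supp 0⟩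

theorem supp_eq_of_subset (C D : G.Circle) (h : C.supp ⊆ D.supp) : C.supp = D.supp :=
  D.eq_supp_of_isEven C.isEven_supp h C.supp_nonempty

theorem linked (C : G.Circle) {T : Set G.I} (hT : ↑C.supp ⊆ T) {i j : G.I} (hi : i ∈ C.supp)
    (hj : j ∈ C.supp) : Linked T (Sum.inl (G.vert i)) (Sum.inl (G.vert j)) := by
  classical
  have hcomp : (C.supp.filter fun k => Linked T (Sum.inl (G.vert i)) (Sum.inl (G.vert k))) =
      C.supp :=
    C.eq_supp_of_isEven (C.isEven_supp.filter (Linked T (Sum.inl (G.vert i)))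
      fun k hk => linked_vert_iff_edge (hT hk)) (Finset.filter_subset _ _)
      ⟨i, Finset.mem_filter.2 ⟨hi, .refl _ _⟩⟩
  rw [← hcomp] at hj
  exact (Finset.mem_filter.1 hj).2

end Circle

theorem IsEven.exists_circle {S : Finset G.I} (hS : IsEven S) {i : G.I} (hi : i ∈ S) :
    ∃ C : G.Circle, i ∈ C.supp ∧ C.supp ⊆ S := by
  have hjoin : IsJoin (S \ {i}) (Sum.inl (G.vert i)) (Sum.inr (G.edge i)) :=
    hS.sdiff_isJoin (isJoin_singleton i) (by simpa using hi)
  obtain ⟨C, hiC, hC⟩ := (hjoin.linked le_rfl).exists_circle (by simp)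
  refine ⟨C, Circle.mem_supp.2 hiC, fun j hj => ?_⟩
  rcases hC (Circle.mem_supp.1 hj) with rfl | hjS
  exacts [hi, Finset.sdiff_subset hjS]

@[elab_as_elim]
theorem IsEven.induction_circle {motive : Finset G.I → Prop} {S : Finset G.I} (hS : IsEven S)
    (empty : motive ∅) (union : ∀ (C : G.Circle) (T : Finset G.I), Disjoint C.supp T →
      motive T → motive (C.supp ∪ T)) : motive S := by
  induction S using Finset.strongInduction with
  | H S ih =>
    rcases S.eq_empty_or_nonempty with rfl | ⟨i, hi⟩
    · exact empty
    · obtain ⟨C, hiC, hCS⟩ := hS.exists_circle hi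
      rw [← Finset.union_sdiff_of_subset hCS]
      exact union C _ Finset.disjoint_sdiff
        (ih _ (Finset.sdiff_ssubset hCS ⟨i, hiC⟩) (hS.sdiff C.isEven_supp hCS))

-- A circle through `i` in `C ∆ D` works unless it misses `k`; then it leaves out the part of `C`
-- on a circle through `k` in the rest of `C ∆ D`.
theorem exists_circle_union_ssubset {C D : G.Circle} {i k : G.I} (hi : i ∈ C.supp)
    (hiD : i ∉ D.supp) (hk : k ∈ D.supp) (hkC : k ∉ C.supp) (hCD : (C.supp ∩ D.supp).Nonempty) :
    ∃ A : G.Circle, i ∈ A.supp ∧ A.supp ⊆ C.supp ∪ D.supp ∧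
      (k ∈ A.supp ∨ (A.supp ∩ D.supp).Nonempty ∧ A.supp ∪ D.supp ⊂ C.supp ∪ D.supp) := by
  obtain ⟨m, hm⟩ := hCD
  have hE : IsEven (C.supp ∆ D.supp) := C.isEven_supp.symmDiff D.isEven_supp
  obtain ⟨A, hiA, hAE⟩ := hE.exists_circle (Finset.mem_symmDiff.2 (Or.inl ⟨hi, hiD⟩))
  have hA : A.supp ⊆ C.supp ∪ D.supp := by grind [Finset.mem_symmDiff]
  refine ⟨A, hiA, hA, or_iff_not_imp_left.2 fun hkA => ?_⟩
  obtain ⟨B, -, hB⟩ := (hE.sdiff A.isEven_supp hAE).exists_circle (i := k)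
    (by grind [Finset.mem_symmDiff])
  obtain ⟨x, hxA, hxC⟩ : ∃ x ∈ A.supp, x ∉ C.supp := by
    by_contra! h
    have := A.supp_eq_of_subset C h
    grind [Finset.mem_symmDiff]
  obtain ⟨y, hyB, hyD⟩ : ∃ y ∈ B.supp, y ∉ D.supp := by
    by_contra! h
    have := B.supp_eq_of_subset D h
    grind [Finset.mem_symmDiff]
  refine ⟨⟨x, by grind [Finset.mem_symmDiff]⟩, Finset.ssubset_iff_of_subset
    (Finset.union_subset hA Finset.subset_union_right) |>.2 ⟨y, ?_, ?_⟩⟩ <;>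
  grind [Finset.mem_symmDiff]

theorem Circle.exists_mem_mem_of_inter_nonempty {C D : G.Circle} {i k : G.I} (hi : i ∈ C.supp)
    (hk : k ∈ D.supp) (hCD : (C.supp ∩ D.supp).Nonempty) :
    ∃ B : G.Circle, i ∈ B.supp ∧ k ∈ B.supp ∧ B.supp ⊆ C.supp ∪ D.supp := by
  induction hU : C.supp ∪ D.supp using Finset.strongInduction generalizing C with
  | H U ih =>
    subst hU
    by_cases hiD : i ∈ D.supp
    · exact ⟨D, hiD, hk, Finset.subset_union_right⟩
    by_cases hkC : k ∈ C.supp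
    · exact ⟨C, hi, hkC, Finset.subset_union_left⟩
    obtain ⟨A, hiA, hA, hkA | ⟨hAD, hlt⟩⟩ := exists_circle_union_ssubset hi hiD hk hkC hCD
    · exact ⟨A, hiA, hkA, hA⟩
    · obtain ⟨B, hiB, hkB, hB⟩ := ih _ hlt hiA hAD rfl
      exact ⟨B, hiB, hkB, hB.trans hlt.subset⟩

theorem Circle.exists_map {H : IncHypergraph.{u}} (C : G.Circle) (f : C.incs → H.I)
    (hf : Function.Injective f)
    (hV : ∀ i j, H.vert (f i) = H.vert (f j) ↔ G.vert i = G.vert j)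
    (hE : ∀ i j, H.edge (f i) = H.edge (f j) ↔ G.edge i = G.edge j) :
    ∃ D : H.Circle, D.incs = Set.range f := by
  let out (t : Fin (C.n + 1)) : C.incs := ⟨C.out t, Or.inl ⟨t, rfl⟩⟩
  let ret (t : Fin (C.n + 1)) : C.incs := ⟨C.ret t, Or.inr ⟨t, rfl⟩⟩
  refine ⟨⟨C.n, fun t => H.vert (f (out t)), fun t => H.edge (f (out t)), f ∘ out, f ∘ ret,
    fun _ => rfl, fun _ => rfl,
    fun t => (hE _ _).2 ((C.edge_ret t).trans (C.edge_out t).symm),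
    fun t => (hV _ _).2 ((C.vert_ret t).trans (C.vert_out _).symm),
    fun s t h => C.v_injective ((C.vert_out s).symm.trans (((hV _ _).1 h).trans (C.vert_out t))),
    fun s t h => C.e_injective ((C.edge_out s).symm.trans (((hE _ _).1 h).trans (C.edge_out t))),
    fun s t h => C.out_injective (Subtype.mk.inj (hf h)),
    fun s t h => C.ret_injective (Subtype.mk.inj (hf h)),
    fun s t h => C.out_ne_ret s t (Subtype.mk.inj (hf h))⟩, ?_⟩
  refine Set.Subset.antisymm ?_ ?_
  · rintro _ (⟨t, rfl⟩ | ⟨t, rfl⟩) <;> exact ⟨_, rfl⟩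
  · rintro _ ⟨⟨_, ⟨t, rfl⟩ | ⟨t, rfl⟩⟩, rfl⟩
    exacts [Or.inl ⟨t, rfl⟩, Or.inr ⟨t, rfl⟩]

theorem Sub.exists_circle (K : G.Sub) (C : G.Circle) (hC : C.incs ⊆ K.incs) :
    ∃ D : K.toHypergraph.Circle, ∀ i : K.toHypergraph.I, i ∈ D.incs ↔ i.1 ∈ C.incs := by
  obtain ⟨D, hD⟩ := C.exists_map (H := K.toHypergraph) (Set.inclusion hC)
    (Set.inclusion_injective hC) (fun _ _ => Subtype.ext_iff) (fun _ _ => Subtype.ext_iff)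
  refine ⟨D, fun i => ?_⟩
  rw [hD]
  exact ⟨fun ⟨j, hj⟩ => hj ▸ j.2, fun hi => ⟨⟨i.1, hi⟩, rfl⟩⟩

/-! ### Balance -/

theorem intCast_units_zmod_two (s : ℤˣ) : ((s : ℤ) : ZMod 2) = 1 := by
  rcases Int.units_eq_one_or s with rfl | rfl <;> decide

theorem even_sum_units_iff {α : Type*} {S : Finset α} {u : α → ℤˣ} :
    Even (∑ i ∈ S, (u i : ℤ)) ↔ Even S.card := by
  rw [← ZMod.intCast_eq_zero_iff_even, ← ZMod.natCast_eq_zero_iff_even, Int.cast_sum]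
  simp [intCast_units_zmod_two]

theorem prod_neg_mul_units_eq_one_iff {α : Type*} (S : Finset α) (a b : α → ℤˣ) :
    ∏ t ∈ S, -(a t * b t) = 1 ↔ (4 : ℤ) ∣ ∑ t ∈ S, ((a t : ℤ) + b t) := by
  classical
  have hmod : (∏ t ∈ S, -(a t * b t) = 1 ∧ (∑ t ∈ S, ((a t : ℤ) + b t)) % 4 = 0) ∨
      (∏ t ∈ S, -(a t * b t) = -1 ∧ (∑ t ∈ S, ((a t : ℤ) + b t)) % 4 = 2) := by
    induction S using Finset.induction_on with
    | empty => simp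
    | insert t S ht ih =>
      rw [Finset.prod_insert ht, Finset.sum_insert ht]
      rcases ih with ⟨h, _⟩ | ⟨h, _⟩ <;> rw [h] <;>
      rcases Int.units_eq_one_or (a t) with ha | ha <;>
      rcases Int.units_eq_one_or (b t) with hb | hb <;> rw [ha, hb] <;> simp <;> lia
  rcases hmod with ⟨hprod, _⟩ | ⟨hprod, _⟩
  · simp only [hprod, true_iff]
    lia
  · simp only [hprod, (by decide : (-1 : ℤˣ) ≠ 1), false_iff]
    lia

/-- The form of balance used throughout: the sum of the signs over every even set of incidences
is divisible by `4`. -/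
def EvenBalanced (σ : G.I → ℤˣ) : Prop :=
  ∀ S : Finset G.I, IsEven S → (4 : ℤ) ∣ ∑ i ∈ S, (σ i : ℤ)

theorem evenBalanced_of_circles {σ : G.I → ℤˣ}
    (h : ∀ C : G.Circle, (4 : ℤ) ∣ ∑ i ∈ C.supp, (σ i : ℤ)) : EvenBalanced σ := by
  intro S hS
  refine hS.induction_circle (by simp) fun C T hCT hT => ?_
  rw [Finset.sum_union hCT]
  exact dvd_add (h C) hT

-- Each of the three sums is odd, while any two of them add up to a multiple of `4`.
theorem EvenBalanced.not_three_disjoint_joins {σ : G.I → ℤˣ} (hσ : EvenBalanced σ) {e : G.E}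
    {w : G.V} {P Q R : Finset G.I} (hP : IsJoin P (Sum.inr e) (Sum.inl w))
    (hQ : IsJoin Q (Sum.inr e) (Sum.inl w)) (hR : IsJoin R (Sum.inr e) (Sum.inl w))
    (hPQ : Disjoint P Q) (hPR : Disjoint P R) (hQR : Disjoint Q R) : False := by
  have hdvd {S T : Finset G.I} (hS : IsJoin S (Sum.inr e) (Sum.inl w))
      (hT : IsJoin T (Sum.inr e) (Sum.inl w)) (hST : Disjoint S T) :
      (4 : ℤ) ∣ ∑ i ∈ S, (σ i : ℤ) + ∑ i ∈ T, (σ i : ℤ) :=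
    Finset.sum_union hST (f := fun i => (σ i : ℤ)) ▸ hσ _ (hS.isEven_union hT hST)
  have hodd {S : Finset G.I} (hS : IsJoin S (Sum.inr e) (Sum.inl w)) :
      ¬ Even (∑ i ∈ S, (σ i : ℤ)) :=
    even_sum_units_iff.not.2 (Nat.not_even_iff_odd.2 hS.odd_card)
  have := hdvd hP hQ hPQ
  have := hdvd hP hR hPR
  have := hdvd hQ hR hQR
  have := hodd hP
  grind

theorem four_dvd_sum_switch_iff {S : Finset G.I} (hS : IsEven S) (σ : G.I → ℤˣ) (f : G.E → ℤˣ) :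
    (4 : ℤ) ∣ ∑ i ∈ S, ((f (G.edge i) * σ i : ℤˣ) : ℤ) ↔ (4 : ℤ) ∣ ∑ i ∈ S, (σ i : ℤ) := by
  refine dvd_iff_dvd_of_dvd_sub ?_
  rw [← Finset.sum_sub_distrib, ← Finset.sum_fiberwise S G.edge]
  refine Finset.dvd_sum fun e _ => ?_
  have hedge : ∑ i ∈ S with G.edge i = e, (((f (G.edge i) * σ i : ℤˣ) : ℤ) - σ i) =
      ((f e : ℤ) - 1) * ∑ i ∈ S with G.edge i = e, (σ i : ℤ) := by
    rw [Finset.mul_sum]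
    refine Finset.sum_congr rfl fun i hi => ?_
    rw [(Finset.mem_filter.1 hi).2]
    push_cast
    ring
  have hf : (2 : ℤ) ∣ f e - 1 := by
    rcases Int.units_eq_one_or (f e) with h | h <;> rw [h] <;> decide
  rw [hedge]
  exact mul_dvd_mul hf (even_sum_units_iff.2 (hS.even_card_edge e)).two_dvd

/-! ### Vertices of degree one and two -/

/-- Exactly two incidences contain `v`. -/
def IsBivalent (G : IncHypergraph.{u}) (v : G.V) : Prop :=
  ∃ i j : G.I, i ≠ j ∧ ∀ k, G.vert k = v ↔ k = i ∨ k = j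

theorem degree_congr {H : IncHypergraph.{u}} {v : G.V} {w : H.V} (f : G.I ↪ H.I)
    (hf : ∀ i, H.vert (f i) = w ↔ G.vert i = v) (hw : ∀ k, H.vert k = w → k ∈ Set.range f) :
    H.degree w = G.degree v := by
  have himage : {k | H.vert k = w} = f '' {i | G.vert i = v} := by
    ext k
    refine ⟨fun hk => ?_, ?_⟩
    · obtain ⟨i, rfl⟩ := hw k hk
      exact ⟨i, (hf i).1 hk, rfl⟩
    · rintro ⟨i, hi, rfl⟩
      exact (hf i).2 hi
  change Set.ncard {k | H.vert k = w} = Set.ncard {i | G.vert i = v}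
  rw [himage, Set.ncard_image_of_injective _ f.injective]

theorem degree_eq_two_iff {v : G.V} : G.degree v = 2 ↔ G.IsBivalent v := by
  change Set.ncard {i | G.vert i = v} = 2 ↔ _
  simp [Set.ncard_eq_two, Set.ext_iff, IsBivalent]

theorem degree_eq_one_iff {v : G.V} : G.degree v = 1 ↔ ∃ i, ∀ k, G.vert k = v ↔ k = i := by
  change Set.ncard {i | G.vert i = v} = 1 ↔ _
  simp [Set.ncard_eq_one, Set.ext_iff]

theorem IsBivalent.exists_pair {v : G.V} (h : G.IsBivalent v) {i : G.I} (hi : G.vert i = v) :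
    ∃ j, i ≠ j ∧ ∀ k, G.vert k = v ↔ k = i ∨ k = j := by
  obtain ⟨a, b, hab, h⟩ := h
  rcases (h i).1 hi with rfl | rfl
  · exact ⟨b, hab, h⟩
  · exact ⟨a, hab.symm, fun k => (h k).trans or_comm⟩

theorem IsBivalent.exists_vert_eq {v : G.V} (h : G.IsBivalent v) : ∃ i, G.vert i = v := by
  obtain ⟨i, j, -, h⟩ := h
  exact ⟨i, (h i).2 (Or.inl rfl)⟩

theorem mem_iff_mem_of_even_card {S : Finset G.I} {v : G.V} {i j : G.I}
    (h : ∀ k, G.vert k = v ↔ k = i ∨ k = j) (hS : Even (S.filter fun k => G.vert k = v).card) :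
    i ∈ S ↔ j ∈ S := by
  constructor <;> intro hmem
  · obtain ⟨k, hk, hki, hkv⟩ := exists_ne_of_even_card_filter hS hmem ((h i).2 (Or.inl rfl))
    grind
  · obtain ⟨k, hk, hki, hkv⟩ := exists_ne_of_even_card_filter hS hmem ((h j).2 (Or.inr rfl))
    grind

end IncHypergraph

namespace OrientedHypergraph

open IncHypergraph

variable {G : OrientedHypergraph.{u}}

theorem circleSign_eq_one_iff (C : G.toIncHypergraph.Circle) :
    G.circleSign C = 1 ↔ (4 : ℤ) ∣ ∑ i ∈ C.supp, (G.σ i : ℤ) := by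
  rw [C.sum_supp, ← prod_neg_mul_units_eq_one_iff, circleSign, Finset.prod_neg]
  simp

theorem isBalanced_iff : G.IsBalanced ↔ EvenBalanced G.σ :=
  ⟨fun h => evenBalanced_of_circles fun C => (circleSign_eq_one_iff C).1 (h C),
    fun h C => (circleSign_eq_one_iff C).2 (h _ C.isEven_supp)⟩

end OrientedHypergraph

namespace IncHypergraph

open scoped symmDiff

variable {G : IncHypergraph.{u}}

/-! ### Kernel vectors of minimal support -/

/-- The entry at `v` of the incidence matrix with signs `σ` applied to the vector `x`. -/
noncomputable def rowSum (σ : G.I → ℤˣ) (x : G.E → ℝ) (v : G.V) : ℝ :=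
  ∑ i with G.vert i = v, x (G.edge i) * ((σ i : ℤ) : ℝ)

/-- A vector of minimal support among the non-zero vectors that are annihilated by all rows
with index in `S`. -/
structure IsMinKernel (σ : G.I → ℤˣ) (S : Finset G.V) (x : G.E → ℝ) : Prop where
  ne_zero : x ≠ 0
  ker : ∀ v ∈ S, rowSum σ x v = 0
  min : ∀ y : G.E → ℝ, (∀ v ∈ S, rowSum σ y v = 0) → (∀ e, x e = 0 → y e = 0) → ∃ c : ℝ, y = c • x

/-- At most two incidences at `v` lie in edges of the support of `x`. -/
def SupportLeTwo (x : G.E → ℝ) (v : G.V) : Prop :=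
  ∀ i j k, G.vert i = v → G.vert j = v → G.vert k = v →
    x (G.edge i) ≠ 0 → x (G.edge j) ≠ 0 → x (G.edge k) ≠ 0 → i = j ∨ i = k ∨ j = k

variable {σ : G.I → ℤˣ} {S : Finset G.V} {x y z : G.E → ℝ} {v w : G.V} {i j : G.I}

theorem rowSum_sub_smul (c : ℝ) (hx : rowSum σ x v = c * rowSum σ y v) :
    rowSum σ (x - c • y) v = 0 := by
  rw [← sub_eq_zero.2 hx]
  simp only [rowSum, Finset.mul_sum, ← Finset.sum_sub_distrib]
  exact Finset.sum_congr rfl fun i _ => by simp; ring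

theorem rowSum_eq_pair (hij : i ≠ j) (hi : G.vert i = v) (hj : G.vert j = v)
    (h : ∀ k, G.vert k = v → x (G.edge k) ≠ 0 → k = i ∨ k = j) :
    rowSum σ x v = x (G.edge i) * ((σ i : ℤ) : ℝ) + x (G.edge j) * ((σ j : ℤ) : ℝ) := by
  rw [← Finset.sum_pair hij (f := fun k => x (G.edge k) * ((σ k : ℤ) : ℝ))]
  refine (Finset.sum_subset (fun k hk => ?_) fun k hk hkij => ?_).symm
  · simpa using show G.vert k = v by grind
  · have hxk : x (G.edge k) = 0 := by
      by_contra hxk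
      exact hkij (by simpa using h k (by simpa using hk) hxk)
    rw [hxk, zero_mul]

theorem exists_of_rowSum_ne_zero (h : rowSum σ x v ≠ 0) : ∃ i, G.vert i = v ∧ x (G.edge i) ≠ 0 := by
  obtain ⟨i, hi, hne⟩ := Finset.exists_ne_zero_of_sum_ne_zero h
  exact ⟨i, by simpa using hi, left_ne_zero_of_mul hne⟩

theorem exists_ne_of_rowSum_eq_zero (h : rowSum σ x v = 0) (hi : G.vert i = v)
    (hx : x (G.edge i) ≠ 0) : ∃ j, j ≠ i ∧ G.vert j = v ∧ x (G.edge j) ≠ 0 := by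
  by_contra! hj
  rw [rowSum, Finset.sum_eq_single_of_mem i (by simpa using hi)] at h
  · exact mul_ne_zero hx (by simp) h
  · intro j hjv hji
    rw [hj j hji (by simpa using hjv), zero_mul]

theorem SupportLeTwo.pair_sum (h2 : SupportLeTwo x v) (h : rowSum σ x v = 0) (hij : i ≠ j)
    (hi : G.vert i = v) (hj : G.vert j = v) (hxi : x (G.edge i) ≠ 0) (hxj : x (G.edge j) ≠ 0) :
    x (G.edge i) * ((σ i : ℤ) : ℝ) + x (G.edge j) * ((σ j : ℤ) : ℝ) = 0 := by
  rw [← h, rowSum_eq_pair hij hi hj fun k hk hxk => ?_]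
  have := h2 i j k hi hj hk hxi hxj hxk
  tauto

theorem abs_eq_of_pair_sum {a b : ℝ} {s t : ℤˣ}
    (h : a * ((s : ℤ) : ℝ) + b * ((t : ℤ) : ℝ) = 0) : |a| = |b| := by
  have habs (u : ℤˣ) : |((u : ℤ) : ℝ)| = 1 := by
    rcases Int.units_eq_one_or u with rfl | rfl <;> simp
  have h' := congrArg abs (eq_neg_of_add_eq_zero_left h)
  rwa [abs_neg, abs_mul, abs_mul, habs, habs, mul_one, mul_one] at h'

-- Otherwise the restriction of the vector to one component is again annihilated by all rows.
theorem IsMinKernel.linked (hx : IsMinKernel σ S x) {e f : G.E} (he : x e ≠ 0) (hf : x f ≠ 0) :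
    Linked {i | G.vert i ∈ S ∧ x (G.edge i) ≠ 0} (Sum.inr e) (Sum.inr f) := by
  classical
  set L := Linked {i | G.vert i ∈ S ∧ x (G.edge i) ≠ 0} (Sum.inr e)
  by_contra hLf
  set y : G.E → ℝ := fun f => if L (Sum.inr f) then x f else 0 with hy
  have hterm {i} (hi : G.vert i ∈ S) :
      y (G.edge i) = if L (Sum.inl (G.vert i)) then x (G.edge i) else 0 := by
    by_cases hxi : x (G.edge i) = 0
    · simp [hy, hxi]
    · simp only [hy]
      exact (if_congr (linked_vert_iff_edge
        (T := {i | G.vert i ∈ S ∧ x (G.edge i) ≠ 0}) ⟨hi, hxi⟩) rfl rfl).symm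
  have hker : ∀ v ∈ S, rowSum σ y v = 0 := by
    intro v hv
    have hrow : rowSum σ y v = if L (Sum.inl v) then rowSum σ x v else 0 := by
      trans ∑ i with G.vert i = v, if L (Sum.inl v) then x (G.edge i) * ((σ i : ℤ) : ℝ) else 0
      · refine Finset.sum_congr rfl fun i hi => ?_
        obtain rfl : G.vert i = v := by simpa using hi
        rw [hterm hv, ite_mul, zero_mul]
      · split_ifs <;> simp [rowSum]
    simp [hrow, hx.ker v hv]
  obtain ⟨c, hc⟩ := hx.min y hker fun e h => by simp [hy, h]
  have hce : x e = c * x e := by simpa [hy, L, Linked.refl] using congrFun hc e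
  have hcf : 0 = c * x f := by simpa [hy, hLf] using congrFun hc f
  rcases mul_eq_zero.1 hcf.symm with rfl | h
  · exact he (by simpa using hce)
  · exact hf h

theorem IsMinKernel.abs_eq (hx : IsMinKernel σ S x) (h2 : ∀ v ∈ S, SupportLeTwo x v)
    {e f : G.E} (he : x e ≠ 0) (hf : x f ≠ 0) : |x e| = |x f| := by
  have habs {i j} (hi : G.vert i ∈ S) (hj : G.vert j = G.vert i) (hxi : x (G.edge i) ≠ 0)
      (hxj : x (G.edge j) ≠ 0) : |x (G.edge i)| = |x (G.edge j)| := by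
    by_cases hij : i = j
    · rw [hij]
    · exact abs_eq_of_pair_sum ((h2 _ hi).pair_sum (hx.ker _ hi) hij rfl hj hxi hxj)
  refine (hx.linked he hf).of_invariant (p := Sum.elim
    (fun v => ∃ i, G.vert i = v ∧ x (G.edge i) ≠ 0 ∧ |x e| = |x (G.edge i)|)
    (fun f => |x e| = |x f|)) (fun i hi => ⟨?_, fun h => ⟨i, rfl, hi.2, h⟩⟩) rfl
  rintro ⟨j, hj, hxj, h⟩
  exact h.trans (habs (hj ▸ hi.1) hj.symm hxj hi.2)

theorem sum_eq_zero_of_even_card_vert (hx : ∀ v ∈ S, rowSum σ x v = 0)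
    (h2 : ∀ v ∈ S, SupportLeTwo x v) {P : Finset G.I}
    (hPx : ∀ i ∈ P, G.vert i ∈ S ∧ x (G.edge i) ≠ 0)
    (hP : ∀ v, Even (P.filter fun i => G.vert i = v).card) :
    ∑ i ∈ P, x (G.edge i) * ((σ i : ℤ) : ℝ) = 0 := by
  rw [← Finset.sum_fiberwise P G.vert]
  refine Finset.sum_eq_zero fun v _ => ?_
  rcases (P.filter fun i => G.vert i = v).eq_empty_or_nonempty with hempty | ⟨i, hi⟩
  · rw [hempty, Finset.sum_empty]
  obtain ⟨hiP, rfl⟩ := Finset.mem_filter.1 hi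
  obtain ⟨j, hjP, hji, hjv⟩ := exists_ne_of_even_card_filter (hP _) hiP rfl
  have hvS := (hPx i hiP).1
  have hfiber : (P.filter fun k => G.vert k = G.vert i) = {i, j} := by
    ext k
    have := h2 _ hvS i j k rfl hjv
    grind
  rw [hfiber, Finset.sum_pair hji.symm]
  exact (h2 _ hvS).pair_sum (hx _ hvS) hji.symm rfl hjv (hPx i hiP).2 (hPx j hjP).2

theorem exists_eq_abs_mul_unit (x : G.E → ℝ) : ∃ f : G.E → ℤˣ, ∀ e, x e = |x e| * ((f e : ℤ) : ℝ) :=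
  ⟨fun e => if x e < 0 then -1 else 1, fun e => by
    dsimp only
    split_ifs with h
    · simp [abs_of_neg h]
    · simp [abs_of_nonneg (not_lt.1 h)]⟩

-- After switching, the entries of `x` are constant on its support, and the two incidences close
-- up to an even set along a walk on which the signs cancel.
theorem IsMinKernel.pair_sum (hσ : EvenBalanced σ) (hx : IsMinKernel σ S x)
    (h2 : ∀ v ∈ S, SupportLeTwo x v) (hw : w ∉ S) (hij : i ≠ j) (hi : G.vert i = w)
    (hj : G.vert j = w) (hxi : x (G.edge i) ≠ 0) (hxj : x (G.edge j) ≠ 0) :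
    x (G.edge i) * ((σ i : ℤ) : ℝ) + x (G.edge j) * ((σ j : ℤ) : ℝ) = 0 := by
  obtain ⟨f, hf⟩ := exists_eq_abs_mul_unit x
  have hswitch {k} (hk : x (G.edge k) ≠ 0) : x (G.edge k) * ((σ k : ℤ) : ℝ) =
      |x (G.edge i)| * (((f (G.edge k) * σ k : ℤˣ) : ℤ) : ℝ) := by
    rw [hx.abs_eq h2 hxi hk]
    conv_lhs => rw [hf (G.edge k)]
    push_cast
    ring
  obtain ⟨P, hPT, hP⟩ := (hx.linked hxi hxj).exists_isJoin
  have hiP : i ∉ P := fun h => hw (hi ▸ (hPT h).1)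
  have hjP : j ∉ P := fun h => hw (hj ▸ (hPT h).1)
  have hPsum : ∑ k ∈ P, ((f (G.edge k) * σ k : ℤˣ) : ℤ) = 0 := by
    have h0 := sum_eq_zero_of_even_card_vert hx.ker h2 (fun k hk => hPT hk) hP.even_card_vert
    rw [Finset.sum_congr rfl fun k hk => hswitch (hPT hk).2, ← Finset.mul_sum] at h0
    exact_mod_cast (mul_eq_zero.1 h0).resolve_left (abs_ne_zero.2 hxi)
  have heven := hP.isEven_insert_insert hij (hi.trans hj.symm) hiP hjP
  have hdvd := (four_dvd_sum_switch_iff heven σ f).2 (hσ _ heven)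
  rw [Finset.sum_insert (by simp [hij, hiP]), Finset.sum_insert hjP, hPsum, add_zero] at hdvd
  have hzero : ((f (G.edge i) * σ i : ℤˣ) : ℤ) + ((f (G.edge j) * σ j : ℤˣ) : ℤ) = 0 := by
    revert hdvd
    rcases Int.units_eq_one_or (f (G.edge i) * σ i) with h | h <;>
    rcases Int.units_eq_one_or (f (G.edge j) * σ j) with h' | h' <;> rw [h, h'] <;> decide
  rw [hswitch hxi, hswitch hxj, ← mul_add, ← Int.cast_add, hzero, Int.cast_zero, mul_zero]

theorem IsMinKernel.supportLeTwo_of_notMem (hσ : EvenBalanced σ) (hx : IsMinKernel σ S x)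
    (h2 : ∀ v ∈ S, SupportLeTwo x v) (hw : w ∉ S) : SupportLeTwo x w := by
  intro i j k hi hj hk hxi hxj hxk
  by_contra! h
  have hpij := hx.pair_sum hσ h2 hw h.1 hi hj hxi hxj
  have hpik := hx.pair_sum hσ h2 hw h.2.1 hi hk hxi hxk
  have hpjk := hx.pair_sum hσ h2 hw h.2.2 hj hk hxj hxk
  have hzero : x (G.edge i) * ((σ i : ℤ) : ℝ) = 0 := by linarith
  exact mul_ne_zero hxi (by simp) hzero

theorem IsMinKernel.eq_of_rowSum_ne_zero (hσ : EvenBalanced σ) (hx : IsMinKernel σ S x)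
    (h2 : ∀ v ∈ S, SupportLeTwo x v) (hw : w ∉ S) (hr : rowSum σ x w ≠ 0) (hi : G.vert i = w)
    (hj : G.vert j = w) (hxi : x (G.edge i) ≠ 0) (hxj : x (G.edge j) ≠ 0) : i = j := by
  by_contra hij
  refine hr ?_
  rw [rowSum_eq_pair hij hi hj fun k hk hxk => ?_, hx.pair_sum hσ h2 hw hij hi hj hxi hxj]
  have := hx.supportLeTwo_of_notMem hσ h2 hw i j k hi hj hk hxi hxj hxk
  tauto

theorem IsMinKernel.eq_zero (hx : IsMinKernel σ S x) (hy : ∀ v ∈ S, rowSum σ y v = 0)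
    (hyx : ∀ e, x e = 0 → y e = 0) {e : G.E} (hxe : x e ≠ 0) (hye : y e = 0) : y = 0 := by
  obtain ⟨c, rfl⟩ := hx.min y hy hyx
  rw [(mul_eq_zero.1 hye).resolve_right hxe, zero_smul]

theorem IsMinKernel.erase_of_ssubset_support (hx : IsMinKernel σ S x)
    (hz : z ≠ 0) (hker : ∀ v ∈ S.erase w, rowSum σ z v = 0) (hzx : ∀ e, x e = 0 → z e = 0)
    {e : G.E} (hxe : x e ≠ 0) (hze : z e = 0) :
    IsMinKernel σ (S.erase w) z ∧ rowSum σ z w ≠ 0 := by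
  have hr : rowSum σ z w ≠ 0 := fun h0 => hz <| hx.eq_zero (fun v hv => by
    by_cases hvw : v = w
    exacts [hvw ▸ h0, hker v (Finset.mem_erase.2 ⟨hvw, hv⟩)]) hzx hxe hze
  refine ⟨⟨hz, hker, fun y hy hyz => ⟨rowSum σ y w / rowSum σ z w, ?_⟩⟩, hr⟩
  refine sub_eq_zero.1 (hx.eq_zero (fun v hv => rowSum_sub_smul _ ?_) (fun e he => ?_) hxe ?_)
  · by_cases hvw : v = w
    · rw [hvw, div_mul_cancel₀ _ hr]
    · have hv' := Finset.mem_erase.2 ⟨hvw, hv⟩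
      rw [hy v hv', hker v hv', mul_zero]
  · simp [hzx e he, hyz e (hzx e he)]
  · simp [hze, hyz e hze]

theorem IsMinKernel.erase (hx : IsMinKernel σ S x) (w : G.V) :
    IsMinKernel σ (S.erase w) x ∨
      ∃ y z : G.E → ℝ, (IsMinKernel σ (S.erase w) y ∧ rowSum σ y w ≠ 0) ∧
        (IsMinKernel σ (S.erase w) z ∧ rowSum σ z w ≠ 0) ∧ ∀ e, x e ≠ 0 → y e ≠ 0 ∨ z e ≠ 0 := by
  have hker : ∀ v ∈ S.erase w, rowSum σ x v = 0 := fun v hv =>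
    hx.ker v (Finset.mem_of_mem_erase hv)
  by_cases hz : ∃ z : G.E → ℝ, z ≠ 0 ∧ (∀ v ∈ S.erase w, rowSum σ z v = 0) ∧
      (∀ e, x e = 0 → z e = 0) ∧ ∃ e, x e ≠ 0 ∧ z e = 0
  · obtain ⟨z, hz0, hzk, hzx, e, hxe, hze⟩ := hz
    have hzmin := hx.erase_of_ssubset_support hz0 hzk hzx hxe hze
    obtain ⟨a, -, hza⟩ := exists_of_rowSum_ne_zero hzmin.2
    set c := x (G.edge a) / z (G.edge a)
    have hye : (x - c • z) e ≠ 0 := by simpa [hze] using hxe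
    refine Or.inr ⟨x - c • z, z, hx.erase_of_ssubset_support (fun h => hye (by rw [h]; rfl))
      (fun v hv => rowSum_sub_smul c ?_) (fun e he => ?_) (mt (hzx _) hza) ?_, hzmin,
      fun e he => ?_⟩
    · rw [hker v hv, hzk v hv, mul_zero]
    · simp [he, hzx e he]
    · simp [c, hza]
    · by_cases hze : z e = 0
      · exact Or.inl (by simpa [hze] using he)
      · exact Or.inr hze
  · push Not at hz
    refine Or.inl ⟨hx.ne_zero, hker, fun y hy hyx => ?_⟩
    obtain ⟨e, he⟩ := Function.ne_iff.1 hx.ne_zero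
    have hxe : x e ≠ 0 := he
    refine ⟨y e / x e, ?_⟩
    by_contra hne
    refine hz (y - (y e / x e) • x) (sub_ne_zero.2 hne) (fun v hv => rowSum_sub_smul _ ?_)
      (fun f hf => by simp [hf, hyx f hf]) e he (by simp [hxe])
    rw [hy v hv, hker v hv, mul_zero]

theorem IsMinKernel.supportLeTwo (hσ : EvenBalanced σ) (hx : IsMinKernel σ S x) :
    ∀ v ∈ S, SupportLeTwo x v := by
  induction S using Finset.strongInduction generalizing x with
  | H S ih =>
    intro w hw
    have ih_erase {z} := ih _ (Finset.erase_ssubset hw) (x := z)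
    have hwS := Finset.notMem_erase w S
    rcases hx.erase w with hx' | ⟨y, z, ⟨hy, hyw⟩, ⟨hz, hzw⟩, hyz⟩
    · exact hx'.supportLeTwo_of_notMem hσ (ih_erase hx') hwS
    · have huy {i j} := hy.eq_of_rowSum_ne_zero hσ (ih_erase hy) hwS hyw (i := i) (j := j)
      have huz {i j} := hz.eq_of_rowSum_ne_zero hσ (ih_erase hz) hwS hzw (i := i) (j := j)
      intro i j k hi hj hk hxi hxj hxk
      rcases hyz _ hxi with hi' | hi' <;> rcases hyz _ hxj with hj' | hj' <;>
      rcases hyz _ hxk with hk' | hk' <;> grind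

/-! ### Connected hypergraphs of degree two -/

/-- A connected hypergraph with an edge, all of whose vertices have degree two. Balanced minimal
dependencies without isolated vertices, and balanced subdivisions of balanced hypercircles, are
the balanced hypergraphs of this kind. -/
structure IsConnectedBivalent (G : IncHypergraph.{u}) : Prop where
  nonempty : Nonempty G.E
  linked : ∀ a b, Linked (Set.univ : Set G.I) a b
  bivalent : ∀ v, G.IsBivalent v

@[to_additive]
theorem prod_eq_prod_image_vert {M : Type*} [CommMonoid M] {a b : G.V → G.I}
    (hne : ∀ v, a v ≠ b v) (hab : ∀ v k, G.vert k = v ↔ k = a v ∨ k = b v) {P : Finset G.I}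
    (hP : ∀ v, Even (P.filter fun i => G.vert i = v).card) (g : G.I → M) :
    ∏ i ∈ P, g i = ∏ v ∈ P.image G.vert, g (a v) * g (b v) := by
  rw [← Finset.prod_fiberwise_of_maps_to (fun i => Finset.mem_image_of_mem G.vert)]
  refine Finset.prod_congr rfl fun v hv => ?_
  have hmem := mem_iff_mem_of_even_card (hab v) (by convert hP v)
  have hfiber : (P.filter fun i => G.vert i = v) = {a v, b v} := by
    ext k
    grind
  rw [hfiber, Finset.prod_pair (hne v)]

-- Negating one of the two signs at every vertex turns balance into a product condition.
theorem EvenBalanced.prod_eq_one (hσ : EvenBalanced σ) {a b : G.V → G.I}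
    (hne : ∀ v, a v ≠ b v) (hab : ∀ v k, G.vert k = v ↔ k = a v ∨ k = b v) {τ : G.I → ℤˣ}
    (hτ : ∀ v, τ (a v) * τ (b v) = -(σ (a v) * σ (b v))) {P : Finset G.I} (hP : IsEven P) :
    ∏ i ∈ P, τ i = 1 := by
  rw [prod_eq_prod_image_vert hne hab hP.even_card_vert, Finset.prod_congr rfl fun v _ => hτ v,
    prod_neg_mul_units_eq_one_iff, ← sum_eq_sum_image_vert hne hab hP.even_card_vert
    fun i => (σ i : ℤ)]
  exact hσ P hP

theorem prod_symmDiff_units {α : Type*} [DecidableEq α] (S T : Finset α) (f : α → ℤˣ) :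
    ∏ i ∈ S ∆ T, f i = (∏ i ∈ S, f i) * ∏ i ∈ T, f i :=
  sum_symmDiff_of_module_zmod_two (M := Additive ℤˣ) S T fun i => Additive.ofMul (f i)

theorem IsConnectedBivalent.exists_switch (hG : G.IsConnectedBivalent) (hσ : EvenBalanced σ) :
    ∃ f : G.E → ℤˣ, ∀ i j, i ≠ j → G.vert i = G.vert j →
      f (G.edge i) * σ i = -(f (G.edge j) * σ j) := by
  choose a b hne hab using hG.bivalent
  set τ : G.I → ℤˣ := fun i => if i = a (G.vert i) then -σ i else σ i
  have hτ (v) : τ (a v) * τ (b v) = -(σ (a v) * σ (b v)) := by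
    simp [τ, (hab v _).2 (Or.inl rfl), (hab v _).2 (Or.inr rfl), (hne v).symm]
  obtain ⟨e₀⟩ := hG.nonempty
  choose P _ hP using fun e => (hG.linked (Sum.inr e₀) (Sum.inr e)).exists_isJoin
  refine ⟨fun e => ∏ k ∈ P e, τ k, fun i j hij hv => ?_⟩
  have heven : IsEven ((P (G.edge i) ∆ P (G.edge j)) ∆ ({j} ∆ {i})) :=
    (((hP _).symm.symmDiff (hP _)).symmDiff
      ((isJoin_singleton j).symm.symmDiff (hv ▸ isJoin_singleton i))).isEven
  have hprod := hσ.prod_eq_one hne hab hτ heven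
  simp only [prod_symmDiff_units, Finset.prod_singleton] at hprod
  have hpair : τ j * τ i = -(σ i * σ j) := by
    have hi := (hab _ i).1 rfl
    have hj := (hab _ j).1 hv.symm
    have hτi := hτ (G.vert i)
    grind
  rw [hpair] at hprod
  beta_reduce
  generalize ∏ k ∈ P (G.edge i), τ k = p at *
  generalize ∏ k ∈ P (G.edge j), τ k = q at *
  revert hprod
  generalize σ i = s, σ j = t
  revert p q s t
  decide

-- A zero coordinate propagates along the hypergraph, since every row has two entries.
theorem IsConnectedBivalent.eq_zero (hG : G.IsConnectedBivalent) (hx : ∀ v, rowSum σ x v = 0)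
    {e : G.E} (he : x e = 0) : x = 0 := by
  have hpair {i j : G.I} (hij : i ≠ j) (hv : G.vert j = G.vert i) (hi : x (G.edge i) = 0) :
      x (G.edge j) = 0 := by
    by_contra hj
    obtain ⟨k, hkj, hk, hxk⟩ := exists_ne_of_rowSum_eq_zero (hx _) hv hj
    obtain ⟨j', -, h⟩ := (hG.bivalent (G.vert i)).exists_pair rfl
    grind
  funext f
  refine (hG.linked (Sum.inr e) (Sum.inr f)).of_invariant
    (p := Sum.elim (fun v => ∀ i, G.vert i = v → x (G.edge i) = 0) (fun e => x e = 0))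
    (fun i _ => ⟨fun h => h i rfl, fun h j hj => ?_⟩) he
  by_cases hij : i = j
  · exact hij ▸ h
  · exact hpair hij hj h

end IncHypergraph

namespace OrientedHypergraph

open IncHypergraph

variable {G : OrientedHypergraph.{u}}

/-! ### Minimal dependencies -/

theorem sum_mul_incidenceMatrix (x : G.E → ℝ) (v : G.V) :
    ∑ e, x e * G.incidenceMatrix v e = rowSum G.σ x v := by
  rw [rowSum, ← Finset.sum_fiberwise _ G.edge]
  refine Finset.sum_congr rfl fun e _ => ?_
  have hentry : G.incidenceMatrix v e =
      ∑ i with G.vert i = v ∧ G.edge i = e, ((G.σ i : ℤ) : ℝ) := by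
    rw [incidenceMatrix, finsum_eq_sum_of_fintype]
    exact (Finset.sum_subtype _ (by simp) (fun i => ((G.σ i : ℤ) : ℝ))).symm
  rw [hentry, Finset.mul_sum, Finset.filter_filter]
  refine Finset.sum_congr rfl fun i hi => ?_
  rw [(Finset.mem_filter.1 hi).2.2]

theorem sum_smul_col_eq_zero_iff (x : G.E → ℝ) :
    ∑ e, x e • G.incidenceMatrix.col e = 0 ↔ ∀ v, rowSum G.σ x v = 0 := by
  simp [funext_iff, ← sum_mul_incidenceMatrix, Finset.sum_apply, Matrix.col]

theorem linearIndepOn_col_iff (F : Set G.E) :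
    LinearIndepOn ℝ G.incidenceMatrix.col F ↔
      ∀ x : G.E → ℝ, (∀ e ∉ F, x e = 0) → (∀ v, rowSum G.σ x v = 0) → x = 0 := by
  rw [linearIndepOn_iff]
  refine Finsupp.equivFunOnFinite.forall_congr fun {l} => ?_
  rw [Finsupp.mem_supported', ← sum_smul_col_eq_zero_iff, Finsupp.linearCombination_apply,
    Finsupp.sum_fintype _ _ (by simp)]
  simp [DFunLike.ext_iff, funext_iff]

theorem isMinimallyDependent_iff : G.IsMinimallyDependent ↔
    (∃ x : G.E → ℝ, x ≠ 0 ∧ ∀ v, rowSum G.σ x v = 0) ∧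
      ∀ x : G.E → ℝ, (∀ v, rowSum G.σ x v = 0) → ∀ e, x e = 0 → x = 0 := by
  rw [IsMinimallyDependent, ← linearIndepOn_univ_iff]
  simp only [linearIndepOn_col_iff]
  refine and_congr ?_ ⟨fun h x hx e he => ?_, fun h F hF x hxF hx => ?_⟩
  · simp only [Set.mem_univ, not_true_eq_false, false_implies, implies_true, true_implies]
    push Not
    exact exists_congr fun x => and_comm
  · exact h {e}ᶜ (by simp) x (by simpa using he) hx
  · obtain ⟨e, he⟩ := (Set.ne_univ_iff_exists_notMem F).1 hF
    exact h x hx e (hxF e he)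

theorem IsMinimallyDependent.exists_isMinKernel (h : G.IsMinimallyDependent) :
    ∃ x, IsMinKernel G.σ Finset.univ x ∧ ∀ e, x e ≠ 0 := by
  obtain ⟨⟨x, hx0, hx⟩, hmin⟩ := isMinimallyDependent_iff.1 h
  have hxe : ∀ e, x e ≠ 0 := fun e he => hx0 (hmin x hx e he)
  obtain ⟨e, -⟩ := Function.ne_iff.1 hx0
  refine ⟨x, ⟨hx0, fun v _ => hx v, fun y hy _ => ⟨y e / x e, ?_⟩⟩, hxe⟩
  refine sub_eq_zero.1 (hmin _ (fun v => rowSum_sub_smul _ ?_) e (by simp [hxe]))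
  rw [hy v (Finset.mem_univ v), hx, mul_zero]

theorem IsMinimallyDependent.isConnectedBivalent (h : G.IsMinimallyDependent) (hb : G.IsBalanced)
    (hG : ∀ v, G.degree v ≠ 0) : G.toIncHypergraph.IsConnectedBivalent := by
  obtain ⟨x, hx, hxe⟩ := h.exists_isMinKernel
  have hle := hx.supportLeTwo (isBalanced_iff.1 hb)
  have hinc (v) : ∃ i, G.vert i = v := by
    obtain ⟨⟨i, hi⟩⟩ := (Nat.card_ne_zero.1 (hG v)).1
    exact ⟨i, hi⟩
  obtain ⟨e₀, -⟩ := Function.ne_iff.1 hx.ne_zero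
  have hlinked : ∀ a, Linked (Set.univ : Set G.I) (Sum.inr e₀) a := by
    have hedge (e) : Linked (Set.univ : Set G.I) (Sum.inr e₀) (Sum.inr e) :=
      (hx.linked (hxe e₀) (hxe e)).mono (Set.subset_univ _)
    rintro (v | e)
    · obtain ⟨i, rfl⟩ := hinc v
      exact (hedge (G.edge i)).trans (linked_vert_edge (Set.mem_univ i)).symm
    · exact hedge e
  refine ⟨⟨e₀⟩, fun a b => (hlinked a).symm.trans (hlinked b), fun v => ?_⟩
  obtain ⟨i, hi⟩ := hinc v
  obtain ⟨j, hji, hj, -⟩ := exists_ne_of_rowSum_eq_zero (hx.ker v (Finset.mem_univ v)) hi (hxe _)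
  refine ⟨i, j, hji.symm, fun k => ⟨fun hk => ?_, by rintro (rfl | rfl) <;> assumption⟩⟩
  have := hle v (Finset.mem_univ v) i j k hi hj hk (hxe _) (hxe _) (hxe _)
  grind

theorem IsBalanced.isMinimallyDependent (hb : G.IsBalanced)
    (hG : G.toIncHypergraph.IsConnectedBivalent) : G.IsMinimallyDependent := by
  obtain ⟨f, hf⟩ := hG.exists_switch (isBalanced_iff.1 hb)
  refine isMinimallyDependent_iff.2 ⟨⟨fun e => ((f e : ℤ) : ℝ), ?_, fun v => ?_⟩,
    fun x hx e he => hG.eq_zero hx he⟩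
  · obtain ⟨e⟩ := hG.nonempty
    exact fun h => by simpa using congrFun h e
  · obtain ⟨i, j, hij, h⟩ := hG.bivalent v
    have hi := (h i).2 (Or.inl rfl)
    have hj := (h j).2 (Or.inr rfl)
    have hfR : ((f (G.edge i) : ℤ) : ℝ) * (G.σ i : ℤ) = -((f (G.edge j) : ℤ) * (G.σ j : ℤ)) := by
      exact_mod_cast congrArg (Units.val) (hf i j hij (hi.trans hj.symm))
    rw [rowSum_eq_pair hij hi hj fun k hk _ => (h k).1 hk, hfR, neg_add_cancel]

end OrientedHypergraph

namespace IncHypergraph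

variable {G : IncHypergraph.{u}}

/-! ### Flowers -/

theorem IsZeroEdge.isConnectedBivalent (hG : G.IsZeroEdge) : G.IsConnectedBivalent := by
  obtain ⟨hV, e, -, he⟩ := hG
  refine ⟨⟨e⟩, ?_, fun v => hV.elim v⟩
  rintro (v | a) (w | b)
  · exact hV.elim v
  · exact hV.elim v
  · exact hV.elim w
  · rw [he a trivial, he b trivial]
    exact Linked.refl _ _

theorem edgeInduced_isCircleCovered {F : Set G.E} (hF : ∃ i, G.edge i ∈ F)
    (h : ∀ i j, G.edge i ∈ F → G.edge j ∈ F →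
      ∃ C : G.Circle, i ∈ C.supp ∧ j ∈ C.supp ∧ ∀ k ∈ C.supp, G.edge k ∈ F) :
    (G.edgeInduced F).toHypergraph.IsCircleCovered := by
  have hcirc (i j : (G.edgeInduced F).toHypergraph.I) :
      ∃ D : (G.edgeInduced F).toHypergraph.Circle, i ∈ D.incs ∧ j ∈ D.incs := by
    obtain ⟨C, hi, hj, hCF⟩ := h i.1 j.1 i.2 j.2
    obtain ⟨D, hD⟩ := (G.edgeInduced F).exists_circle C fun k hk => hCF k (Circle.mem_supp.2 hk)
    exact ⟨D, (hD i).2 (Circle.mem_supp.1 hi), (hD j).2 (Circle.mem_supp.1 hj)⟩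
  obtain ⟨i, hi⟩ := hF
  exact ⟨fun i j _ => hcirc i j, Or.inl ⟨(hcirc ⟨i, hi⟩ ⟨i, hi⟩).choose⟩⟩

theorem IsInseparable.exists_circle (h : G.IsInseparable) (C : G.Circle) (i j : G.I) :
    ∃ D : G.Circle, i ∈ D.supp ∧ j ∈ D.supp := by
  obtain ⟨k, hk⟩ : ∃ k, k ≠ i := by
    by_cases hi : C.out 0 = i
    · exact ⟨C.ret 0, fun h' => C.out_ne_ret 0 0 (hi.trans h'.symm)⟩
    · exact ⟨C.out 0, hi⟩
  by_cases hij : i = j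
  · obtain ⟨D, hi, -⟩ := h i k hk.symm
    exact ⟨D, Circle.mem_supp.2 hi, Circle.mem_supp.2 (hij ▸ hi)⟩
  · obtain ⟨D, hi, hj⟩ := h i j hij
    exact ⟨D, Circle.mem_supp.2 hi, Circle.mem_supp.2 hj⟩

theorem IsFlower.edgeInduced_range_edge (hG : G.IsFlower) (C : G.Circle) :
    G.edgeInduced (Set.range G.edge) = Sub.whole G :=
  hG.2 _ <| edgeInduced_isCircleCovered ⟨C.out 0, Set.mem_range_self _⟩ fun i j _ _ =>
    let ⟨D, hi, hj⟩ := hG.1.1.exists_circle C i j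
    ⟨D, hi, hj, fun k _ => Set.mem_range_self k⟩

theorem IsFlower.edge_surjective (hG : G.IsFlower) (C : G.Circle) : Function.Surjective G.edge :=
  fun e => (congrArg (e ∈ Sub.edges ·) (hG.edgeInduced_range_edge C)).mpr trivial

theorem IsFlower.vert_surjective (hG : G.IsFlower) (C : G.Circle) : Function.Surjective G.vert :=
  fun v =>
    let ⟨i, hi, _⟩ := (congrArg (v ∈ Sub.verts ·) (hG.edgeInduced_range_edge C)).mpr trivial
    ⟨i, hi⟩

theorem IsInseparable.linked (h : G.IsInseparable) (C : G.Circle)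
    (hV : Function.Surjective G.vert) (hE : Function.Surjective G.edge) (a b : G.V ⊕ G.E) :
    Linked (Set.univ : Set G.I) a b := by
  have hvert (i j : G.I) :
      Linked (Set.univ : Set G.I) (Sum.inl (G.vert i)) (Sum.inl (G.vert j)) := by
    obtain ⟨D, hi, hj⟩ := h.exists_circle C i j
    exact D.linked (Set.subset_univ _) hi hj
  have hinc : ∀ a, ∃ i, Linked (Set.univ : Set G.I) a (Sum.inl (G.vert i)) := by
    rintro (v | e)
    · obtain ⟨i, rfl⟩ := hV v
      exact ⟨i, Linked.refl _ _⟩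
    · obtain ⟨i, rfl⟩ := hE e
      exact ⟨i, (linked_vert_edge (Set.mem_univ i)).symm⟩
  obtain ⟨i, hi⟩ := hinc a
  obtain ⟨j, hj⟩ := hinc b
  exact (hi.trans (hvert i j)).trans hj.symm

/-- A non-empty set of incidences, any two of which lie in a common circle of the set, that
meets every vertex in at most two incidences. A maximal such set in a balanced flower is the whole
flower. -/
structure IsThinCore (K : Finset G.I) : Prop where
  nonempty : K.Nonempty
  circle : ∀ i ∈ K, ∀ j ∈ K, ∃ C : G.Circle, i ∈ C.supp ∧ j ∈ C.supp ∧ C.supp ⊆ K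
  eq_or_eq_or_eq : ∀ i ∈ K, ∀ j ∈ K, ∀ k ∈ K, G.vert i = G.vert j → G.vert i = G.vert k →
    i = j ∨ i = k ∨ j = k

section ThinCore

variable {σ : G.I → ℤˣ} {K : Finset G.I} {B D : G.Circle} {i k a : G.I}

theorem Circle.isThinCore (C : G.Circle) : IsThinCore C.supp :=
  ⟨C.supp_nonempty, fun _ hi _ hj => ⟨C, hi, hj, subset_rfl⟩,
    fun _ hi _ hj _ hk => C.eq_or_eq_or_eq_of_vert_eq hi hj hk⟩

theorem Circle.linked_edge_vert (C : G.Circle) {T : Set G.I} (hT : ↑C.supp ⊆ T) {i j : G.I}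
    (hi : i ∈ C.supp) (hj : j ∈ C.supp) :
    Linked T (Sum.inr (G.edge i)) (Sum.inl (G.vert j)) :=
  (linked_vert_edge (hT hi)).symm.trans (C.linked hT hi hj)

theorem IsThinCore.linked_edge_vert (hK : IsThinCore K) {T : Set G.I} (hT : ↑K ⊆ T) (hk : k ∈ K)
    (ha : a ∈ K) : Linked T (Sum.inr (G.edge k)) (Sum.inl (G.vert a)) := by
  obtain ⟨C, hkC, haC, hCK⟩ := hK.circle k hk a ha
  exact C.linked_edge_vert ((Finset.coe_subset.2 hCK).trans hT) hkC haC

-- A circle of `K` through `k` and `a` would provide two more disjoint joins.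
theorem IsThinCore.not_linked_sdiff (hσ : EvenBalanced σ) (hK : IsThinCore K) {R : Finset G.I}
    (hRK : Disjoint R K) (hk : k ∈ K) (ha : a ∈ K) :
    ¬ Linked (R : Set G.I) (Sum.inr (G.edge k)) (Sum.inl (G.vert a)) := by
  intro h
  obtain ⟨C, hkC, haC, hCK⟩ := hK.circle k hk a ha
  obtain ⟨P, hPC, hP⟩ := (C.linked_edge_vert subset_rfl hkC haC).exists_isJoin
  obtain ⟨Q, hQR, hQ⟩ := h.exists_isJoin
  rw [Finset.coe_subset] at hPC hQR
  exact hσ.not_three_disjoint_joins hP (C.isEven_supp.sdiff_isJoin hP hPC) hQ Finset.disjoint_sdiff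
    (hRK.mono hQR (hPC.trans hCK)).symm (hRK.mono hQR (Finset.sdiff_subset.trans hCK)).symm

-- Follow `D` from `i` until it first returns to an edge of `K`, and close up inside `K`.
theorem IsThinCore.linked_union_sdiff (hσ : EvenBalanced σ) (hK : IsThinCore K)
    (hk : k ∈ K) (hiD : i ∈ D.supp) (hik : G.edge i = G.edge k) {T : Set G.I}
    (hKT : ↑K ⊆ T) (hT : ∀ q ∈ D.supp, q ∉ K → q ≠ i →
      Linked (↑(D.supp \ K) : Set G.I) (Sum.inr (G.edge k)) (Sum.inr (G.edge q)) → q ∈ T)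
    (hiK : i ∉ K) : Linked T (Sum.inl (G.vert i)) (Sum.inr (G.edge i)) := by
  by_contra hvi
  have hiR : i ∈ D.supp \ K := Finset.mem_sdiff.2 ⟨hiD, hiK⟩
  have hDi : Linked (↑(D.supp \ {i}) : Set G.I) (Sum.inl (G.vert i)) (Sum.inr (G.edge i)) :=
    (D.isEven_supp.sdiff_isJoin (isJoin_singleton i)
      (Finset.singleton_subset_iff.2 hiD)).linked (Set.Subset.refl _)
  refine hvi (hDi.of_invariant (p := fun x => Linked T (Sum.inl (G.vert i)) x ∧
    Linked (↑(D.supp \ K) : Set G.I) (Sum.inr (G.edge k)) x) (fun q hq => ?_)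
    ⟨Linked.refl _ _, hik ▸ (linked_vert_edge (Finset.mem_coe.2 hiR)).symm⟩).1
  obtain ⟨hqD, hqi⟩ := Finset.mem_sdiff.1 hq
  by_cases hqK : q ∈ K
  · refine iff_of_false (fun h => hK.not_linked_sdiff hσ Finset.sdiff_disjoint hk hqK h.2)
      fun h => hvi ?_
    have hkq := (hK.linked_edge_vert hKT hk hqK).trans (linked_vert_edge (hKT hqK))
    exact hik ▸ h.1.trans hkq.symm
  · have hqR := linked_vert_iff_edge (a := Sum.inr (G.edge k))
      (Finset.mem_coe.2 (Finset.mem_sdiff.2 ⟨hqD, hqK⟩))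
    rw [hqR]
    refine and_congr_left fun h => linked_vert_iff_edge (hT q hqD hqK (by simpa using hqi) h)

theorem IsThinCore.exists_circle_mem (hσ : EvenBalanced σ) (hK : IsThinCore K) (hk : k ∈ K)
    (hkD : k ∈ D.supp) (hiD : i ∈ D.supp) (hiK : i ∉ K) (hik : G.edge i = G.edge k) :
    ∃ B : G.Circle, i ∈ B.supp ∧ (∃ m ∈ B.supp, m ∈ K) ∧
      ∀ b ∈ B.supp, b ∉ K → ∀ a ∈ K, G.vert b ≠ G.vert a := by
  set A : Set G.I := {q | q ∈ D.supp ∧ q ∉ K ∧ q ≠ i ∧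
    Linked (↑(D.supp \ K) : Set G.I) (Sum.inr (G.edge k)) (Sum.inr (G.edge q))}
  have hlinked : Linked (A ∪ ↑K) (Sum.inl (G.vert i)) (Sum.inr (G.edge i)) :=
    hK.linked_union_sdiff hσ hk hiD hik Set.subset_union_right
      (fun q hqD hqK hqi hq => Or.inl ⟨hqD, hqK, hqi, hq⟩) hiK
  obtain ⟨B, hiB, hB⟩ := hlinked.exists_circle (by simp [A, hiK])
  have hBsub {b} (hb : b ∈ B.supp) (hbK : b ∉ K) : b ∈ D.supp ∧
      Linked (↑(D.supp \ K) : Set G.I) (Sum.inr (G.edge k)) (Sum.inr (G.edge b)) := by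
    rcases hB (Circle.mem_supp.1 hb) with rfl | hbA | hbK'
    · exact ⟨hiD, hik ▸ Linked.refl _ _⟩
    · exact ⟨hbA.1, hbA.2.2.2⟩
    · exact absurd hbK' hbK
  refine ⟨B, Circle.mem_supp.2 hiB, ?_, fun b hb hbK a ha hba => ?_⟩
  · by_contra! h
    exact h k (B.supp_eq_of_subset D (fun b hb => (hBsub hb (h b hb)).1) ▸ hkD) hk
  · refine hK.not_linked_sdiff hσ (Finset.sdiff_disjoint (s := K) (t := D.supp)) hk ha ?_
    exact hba ▸ (linked_vert_iff_edge (Finset.mem_coe.2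
      (Finset.mem_sdiff.2 ⟨(hBsub hb hbK).1, hbK⟩))).2 (hBsub hb hbK).2

theorem IsThinCore.union_supp (hK : IsThinCore K) (hBK : ∃ m ∈ B.supp, m ∈ K)
    (hvert : ∀ b ∈ B.supp, b ∉ K → ∀ a ∈ K, G.vert b ≠ G.vert a) :
    IsThinCore (K ∪ B.supp) := by
  obtain ⟨m, hmB, hmK⟩ := hBK
  have hcross {a b} (ha : a ∈ K) (hb : b ∈ B.supp) : ∃ C : G.Circle, a ∈ C.supp ∧ b ∈ C.supp ∧
      C.supp ⊆ K ∪ B.supp := by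
    obtain ⟨C, haC, hmC, hCK⟩ := hK.circle a ha m hmK
    obtain ⟨F, haF, hbF, hF⟩ := Circle.exists_mem_mem_of_inter_nonempty haC hb
      ⟨m, Finset.mem_inter.2 ⟨hmC, hmB⟩⟩
    exact ⟨F, haF, hbF, hF.trans (Finset.union_subset_union_left hCK)⟩
  refine ⟨⟨m, Finset.mem_union_left _ hmK⟩, fun a ha b hb => ?_, fun a ha b hb c hc hab hac => ?_⟩
  · rcases Finset.mem_union.1 ha with ha | ha <;> rcases Finset.mem_union.1 hb with hb | hb
    · obtain ⟨C, haC, hbC, hC⟩ := hK.circle a ha b hb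
      exact ⟨C, haC, hbC, hC.trans Finset.subset_union_left⟩
    · exact hcross ha hb
    · obtain ⟨C, hbC, haC, hC⟩ := hcross hb ha
      exact ⟨C, haC, hbC, hC⟩
    · exact ⟨B, ha, hb, Finset.subset_union_right⟩
  · have hsame {x y} (hx : x ∈ K ∪ B.supp) (hy : y ∈ K) (hxy : G.vert x = G.vert y) : x ∈ K := by
      by_contra hxK
      exact hvert x ((Finset.mem_union.1 hx).resolve_left hxK) hxK y hy hxy
    by_cases haK : a ∈ K
    · exact hK.eq_or_eq_or_eq a haK b (hsame hb haK hab.symm) c (hsame hc haK hac.symm) hab hac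
    · have hbK : b ∉ K := fun h => haK (hsame ha h hab)
      have hcK : c ∉ K := fun h => haK (hsame ha h hac)
      rw [Finset.mem_union] at ha hb hc
      exact B.eq_or_eq_or_eq_of_vert_eq (ha.resolve_left haK) (hb.resolve_left hbK)
        (hc.resolve_left hcK) hab hac

theorem mem_of_maximal_isThinCore (hσ : EvenBalanced σ) (hG : G.IsInseparable)
    (hK : Maximal IsThinCore K) (hk : k ∈ K) (hik : G.edge i = G.edge k) : i ∈ K := by
  by_contra hiK
  obtain ⟨D, hiD, hkD⟩ := hG i k fun h => hiK (h ▸ hk)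
  obtain ⟨B, hiB, hBK, hvert⟩ := hK.prop.exists_circle_mem hσ hk (Circle.mem_supp.2 hkD)
    (Circle.mem_supp.2 hiD) hiK hik
  have hle := hK.2 (hK.prop.union_supp hBK hvert) Finset.subset_union_left
  exact hiK (hle (Finset.mem_union_right _ hiB))

theorem IsFlower.isThinCore_univ (hG : G.IsFlower) (hσ : EvenBalanced σ) (C : G.Circle) :
    IsThinCore (Finset.univ : Finset G.I) := by
  obtain ⟨K, hK⟩ := (Set.toFinite {K : Finset G.I | IsThinCore K}).exists_maximal ⟨_, C.isThinCore⟩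
  have hmem {i} : G.edge i ∈ G.edge '' K → i ∈ K := by
    rintro ⟨k, hk, hki⟩
    exact mem_of_maximal_isThinCore hσ hG.1.1 hK hk hki.symm
  have hwhole : G.edgeInduced (G.edge '' K) = Sub.whole G := by
    refine hG.2 _ (edgeInduced_isCircleCovered ?_ fun i j hi hj => ?_)
    · obtain ⟨k, hk⟩ := hK.prop.nonempty
      exact ⟨k, k, hk, rfl⟩
    · obtain ⟨D, hiD, hjD, hD⟩ := hK.prop.circle i (hmem hi) j (hmem hj)
      exact ⟨D, hiD, hjD, fun k hk => ⟨k, hD hk, rfl⟩⟩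
  have huniv : K = Finset.univ := Finset.eq_univ_iff_forall.2 fun i =>
    hmem ((congrArg (i ∈ Sub.incs ·) hwhole).mpr trivial)
  exact huniv ▸ hK.prop

theorem IsFlower.isConnectedBivalent (hG : G.IsFlower) (hσ : EvenBalanced σ) :
    G.IsConnectedBivalent := by
  obtain ⟨⟨C⟩⟩ | hzero := hG.1.2
  · refine ⟨⟨C.e 0⟩, hG.1.1.linked C (hG.vert_surjective C) (hG.edge_surjective C), fun v => ?_⟩
    obtain ⟨i, rfl⟩ := hG.vert_surjective C v
    obtain ⟨D, hiD, -⟩ := hG.1.1.exists_circle C i i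
    obtain ⟨j, -, hji, hj⟩ := D.isEven_supp.exists_ne_vert_eq hiD
    refine ⟨i, j, hji.symm, fun k => ⟨fun hk => ?_, by rintro (rfl | rfl) <;> tauto⟩⟩
    have := (hG.isThinCore_univ hσ C).eq_or_eq_or_eq i (Finset.mem_univ i) j (Finset.mem_univ j)
      k (Finset.mem_univ k) hj.symm hk.symm
    grind
  · exact hzero.isConnectedBivalent

end ThinCore

theorem Linked.map {H : IncHypergraph.{u}} {T : Set G.I} {U : Set H.I} {a b : G.V ⊕ G.E}
    (h : Linked T a b) (f : G.V ⊕ G.E → H.V ⊕ H.E)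
    (hf : ∀ i ∈ T, Linked U (f (Sum.inl (G.vert i))) (f (Sum.inr (G.edge i)))) :
    Linked U (f a) (f b) :=
  h.of_invariant (p := fun x => Linked U (f a) (f x))
    (fun i hi => ⟨fun h => h.trans (hf i hi), fun h => h.trans (hf i hi).symm⟩) (Linked.refl _ _)

theorem IsBivalent.map {H : IncHypergraph.{u}} {v : G.V} {w : H.V} (hv : G.IsBivalent v)
    (f : G.I ↪ H.I) (hf : ∀ i, H.vert (f i) = w ↔ G.vert i = v)
    (hw : ∀ k, H.vert k = w → k ∈ Set.range f) : H.IsBivalent w :=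
  degree_eq_two_iff.1 ((degree_congr f hf hw).trans (degree_eq_two_iff.2 hv))

theorem IsConnectedBivalent.of_iso {H : IncHypergraph.{u}} (hG : G.IsConnectedBivalent)
    (φ : Iso G H) : H.IsConnectedBivalent := by
  refine ⟨hG.nonempty.map φ.onE, fun a b => ?_, fun v => ?_⟩
  · have hsurj : Function.Surjective (Sum.map φ.onV φ.onE) :=
      φ.onV.surjective.sumMap φ.onE.surjective
    obtain ⟨a, rfl⟩ := hsurj a
    obtain ⟨b, rfl⟩ := hsurj b
    refine (hG.linked a b).map _ fun i _ => ?_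
    rw [Sum.map_inl, Sum.map_inr, ← φ.vert_onI, ← φ.edge_onI]
    exact linked_vert_edge (Set.mem_univ _)
  · refine (hG.bivalent (φ.onV.symm v)).map φ.onI.toEmbedding (fun i => ?_) fun k _ =>
      φ.onI.surjective k
    rw [Equiv.coe_toEmbedding, φ.vert_onI, Equiv.eq_symm_apply]

theorem Sub.degree_eq (K : G.Sub) (v : K.toHypergraph.V)
    (hK : ∀ i, G.vert i = v.1 → i ∈ K.incs) : K.toHypergraph.degree v = G.degree v.1 :=
  (degree_congr ⟨Subtype.val, Subtype.val_injective⟩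
    (fun i => (Subtype.ext_iff (a1 := K.toHypergraph.vert i) (a2 := v)).symm)
    fun k hk => ⟨⟨k, hK k hk⟩, rfl⟩).symm

theorem EvenBalanced.comp {H : IncHypergraph.{u}} {σ : H.I → ℤˣ} (hσ : EvenBalanced σ)
    (fV : G.V → H.V) (fE : G.E → H.E) (fI : G.I ↪ H.I) (hV : ∀ i, H.vert (fI i) = fV (G.vert i))
    (hE : ∀ i, H.edge (fI i) = fE (G.edge i)) : EvenBalanced fun i => σ (fI i) := by
  intro S hS
  have := hσ _ (hS.map fV fE fI hV hE)
  rwa [Finset.sum_map] at this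

theorem contractVerts_linked (hG : ∀ a b, Linked (Set.univ : Set G.I) a b) (S : Set G.V)
    (a b : (G.contractVerts S).V ⊕ (G.contractVerts S).E) :
    Linked (Set.univ : Set (G.contractVerts S).I) a b := by
  classical
  let f : G.V ⊕ G.E → (G.contractVerts S).V ⊕ (G.contractVerts S).E := Sum.elim
    (fun v => if hv : v ∈ S then
      if hi : ∃ i, G.vert i = v then Sum.inr (Quot.mk _ (G.edge hi.choose)) else a
      else Sum.inl ⟨v, hv⟩)
    (fun e => Sum.inr (Quot.mk _ e))
  have hsurj : Function.Surjective f := by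
    rintro (⟨v, hv⟩ | e)
    · exact ⟨Sum.inl v, dif_neg hv⟩
    · exact (Quot.exists_rep e).imp' Sum.inr fun e he => congrArg Sum.inr he
  obtain ⟨x, hx⟩ := hsurj a
  obtain ⟨y, hy⟩ := hsurj b
  rw [← hx, ← hy]
  refine (hG x y).map f fun i _ => ?_
  by_cases hi : G.vert i ∈ S
  · have hex : ∃ j, G.vert j = G.vert i := ⟨i, rfl⟩
    have : f (Sum.inl (G.vert i)) = f (Sum.inr (G.edge i)) := by
      simp only [f, Sum.elim_inl, Sum.elim_inr, dif_pos hi, dif_pos hex]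
      exact congrArg Sum.inr
        (Quot.sound ⟨_, i, hex.choose_spec.symm ▸ hi, hex.choose_spec, rfl, rfl⟩)
    exact this ▸ Linked.refl _ _
  · have : f (Sum.inl (G.vert i)) = Sum.inl ((G.contractVerts S).vert ⟨i, hi⟩) := dif_neg hi
    exact this ▸ linked_vert_edge (Set.mem_univ (⟨i, hi⟩ : (G.contractVerts S).I))

/-! ### Thorn-connections -/

theorem Sub.eq_of_inter_eq_single {H K : G.Sub} {w v : G.V} (h : H.inter K = Sub.single w)
    (hH : v ∈ H.verts) (hK : v ∈ K.verts) : v = w :=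
  (congrArg (v ∈ Sub.verts ·) h).mp ⟨hH, hK⟩

theorem Sub.inter_ne_empty {H K : G.Sub} {v : G.V} (hH : v ∈ H.verts) (hK : v ∈ K.verts) :
    H.inter K ≠ Sub.empty G :=
  fun h => (congrArg (v ∈ Sub.verts ·) h).mp ⟨hH, hK⟩

namespace IsThornConnection

variable {Ps As : Set G.Sub} {P : G.Sub}

theorem mem_incs (hG : G.IsThornConnection Ps As) (hP : P ∈ Ps) {i : G.I}
    (hiP : G.vert i ∈ P.verts) (hiA : ¬ ∃ A ∈ As, G.vert i ∈ A.verts) : i ∈ P.incs := by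
  obtain ⟨K, hK | hK, hiK⟩ := hG.arterial.cover_I i
  · by_contra hi
    have hne : P ≠ K := fun h => hi (h ▸ hiK)
    have hiK' := K.vert_mem i hiK
    obtain ⟨w, hw, hwA⟩ := hG.arterial.meet_in_artery P hP K hK hne (Sub.inter_ne_empty hiP hiK')
    exact hiA ⟨_, hwA, Sub.eq_of_inter_eq_single hw hiP hiK'⟩
  · exact absurd ⟨K, hK, K.vert_mem i hiK⟩ hiA

theorem isThorn (hG : G.IsThornConnection Ps As) (hP : P ∈ Ps) {v : P.toHypergraph.V}
    (hv : ∃ A ∈ As, v.1 ∈ A.verts) : P.toHypergraph.IsThorn v := by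
  obtain ⟨A, hA, hvA⟩ := hv
  obtain ⟨t, ht, hthorn⟩ := hG.meet_thorn P hP A hA (Sub.inter_ne_empty v.2 hvA)
  have : v = t := Subtype.ext (Sub.eq_of_inter_eq_single ht v.2 hvA)
  rwa [this]

theorem isThorn_iff (hG : G.IsThornConnection Ps As) (hfloral : G.IsFloral) (hP : P ∈ Ps)
    {v : P.toHypergraph.V} : P.toHypergraph.IsThorn v ↔ ∃ A ∈ As, v.1 ∈ A.verts := by
  refine ⟨fun hv => ?_, hG.isThorn hP⟩
  by_contra hvA
  refine hfloral v.1 ((P.degree_eq v fun k hk => ?_).symm.trans hv.1)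
  exact hG.mem_incs hP (hk ▸ v.2) (hk ▸ hvA)

theorem isConnectedBivalent_contractVerts (hG : G.IsThornConnection Ps As)
    (hfloral : G.IsFloral) {σ : (G.contractVerts {v | ∃ A ∈ As, v ∈ A.verts}).I → ℤˣ}
    (hσ : EvenBalanced σ) :
    (G.contractVerts {v | ∃ A ∈ As, v ∈ A.verts}).IsConnectedBivalent := by
  refine ⟨?_, contractVerts_linked (isConnected_iff_linked.1 hG.arterial.connected) _, ?_⟩
  · obtain ⟨P, hP⟩ := hG.nonempty
    obtain ⟨⟨v, -, i, -⟩, -⟩ := hG.pseudoFlower P hP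
    exact ⟨Quot.mk _ (G.edge i.1)⟩
  rintro ⟨v, hv⟩
  obtain ⟨P, hP, hvP⟩ : ∃ P ∈ Ps, v ∈ P.verts := by
    obtain ⟨P, hP | hP, hvP⟩ := hG.arterial.cover_V v
    · exact ⟨P, hP, hvP⟩
    · exact absurd ⟨P, hP, hvP⟩ hv
  have hthorn (w : P.toHypergraph.V) := (hG.isThorn_iff hfloral hP (v := w)).not
  let F := (P.toHypergraph.deleteVerts {v | P.toHypergraph.IsThorn v}).toHypergraph
  let fI : F.I ↪ (G.contractVerts {v | ∃ A ∈ As, v ∈ A.verts}).I :=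
    ⟨fun i => ⟨i.1.1, (hthorn _).1 i.2⟩,
      fun i j h => Subtype.ext (Subtype.ext (Subtype.mk.inj h))⟩
  have hF : F.IsConnectedBivalent := (hG.pseudoFlower P hP).2.isConnectedBivalent <|
    hσ.comp (G := F) (fun v => ⟨v.1.1, (hthorn _).1 v.2⟩) (fun e => Quot.mk _ e.1.1) fI
      (fun _ => rfl) (fun _ => rfl)
  refine (hF.bivalent ⟨⟨v, hvP⟩, (hthorn _).2 hv⟩).map fI (fun i => ?_) fun k hk => ?_
  · exact ⟨fun h => Subtype.ext (Subtype.ext (Subtype.mk.inj h)),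
      fun h => Subtype.ext (congrArg (fun x : F.V => x.1.1) h)⟩
  · have hkv : G.vert k.1 = v := congrArg Subtype.val hk
    exact ⟨⟨⟨k.1, hG.mem_incs hP (hkv ▸ hvP) k.2⟩, (hthorn _).2 k.2⟩, rfl⟩

end IsThornConnection

theorem IsHypercircle.isConnectedBivalent (hG : G.IsHypercircle) {σ : G.I → ℤˣ}
    (hσ : EvenBalanced σ) : G.IsConnectedBivalent := by
  obtain h | h | ⟨T, Ps, As, hT, hfloral, ⟨φ⟩⟩ := hG
  · exact h.isConnectedBivalent
  · exact h.isConnectedBivalent hσ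
  · exact (hT.isConnectedBivalent_contractVerts hfloral
      (hσ.comp φ.onV φ.onE φ.onI.toEmbedding φ.vert_onI φ.edge_onI)).of_iso φ

end IncHypergraph

namespace OrientedHypergraph

open IncHypergraph

variable {G : OrientedHypergraph.{u}}

/-! ### Subdivisions -/

section Subdivide

variable (e : G.E) (B : Set G.I) (s t : ℤˣ)

theorem subdivide_vert_eq_none_iff (k : (G.subdivide e B s t).I) :
    (G.subdivide e B s t).vert k = none ↔ k = Sum.inr false ∨ k = Sum.inr true := by
  rcases k with k | (_ | _) <;> simp [subdivide]

theorem subdivide_linked (hG : ∀ a b, Linked (Set.univ : Set G.I) a b)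
    (a b : (G.subdivide e B s t).V ⊕ (G.subdivide e B s t).E) :
    Linked (Set.univ : Set (G.subdivide e B s t).I) a b := by
  let D := G.subdivide e B s t
  let vert : Option G.V → D.V ⊕ D.E := Sum.inl
  let edge : Option G.E → D.V ⊕ D.E := Sum.inr
  have hinc (k : D.I) : Linked (Set.univ : Set D.I) (vert (D.vert k)) (edge (D.edge k)) :=
    linked_vert_edge (Set.mem_univ k)
  have hnew : Linked (Set.univ : Set D.I) (vert none) (edge (some e)) := hinc (Sum.inr false)
  have hedge : Linked (Set.univ : Set D.I) (edge (some e)) (edge none) :=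
    hnew.symm.trans (hinc (Sum.inr true))
  let f : G.V ⊕ G.E → D.V ⊕ D.E := Sum.map some some
  have hsurj (x : D.V ⊕ D.E) : ∃ y, Linked (Set.univ : Set D.I) (f y) x := by
    rcases x with (_ | v) | (_ | g)
    · exact ⟨Sum.inr e, hnew.symm⟩
    · exact ⟨Sum.inl v, Linked.refl _ _⟩
    · exact ⟨Sum.inr e, hedge⟩
    · exact ⟨Sum.inr g, Linked.refl _ _⟩
  obtain ⟨x, hx⟩ := hsurj a
  obtain ⟨y, hy⟩ := hsurj b
  refine (hx.symm.trans ((hG x y).map f fun i _ => ?_)).trans hy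
  have hi : Linked (Set.univ : Set D.I) (vert (some (G.vert i))) (edge (D.edge (Sum.inl i))) :=
    hinc (Sum.inl i)
  by_cases h : G.edge i = e ∧ i ∈ B
  · have : D.edge (Sum.inl i) = none := if_pos h
    rw [this] at hi
    exact hi.trans (h.1 ▸ hedge.symm)
  · have : D.edge (Sum.inl i) = some (G.edge i) := if_neg h
    rw [this] at hi
    exact hi

theorem subdivide_isConnectedBivalent (hG : G.toIncHypergraph.IsConnectedBivalent) :
    (G.subdivide e B s t).toIncHypergraph.IsConnectedBivalent := by
  refine ⟨⟨(none : Option G.E)⟩, subdivide_linked e B s t hG.linked, ?_⟩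
  rintro (_ | v)
  · exact ⟨Sum.inr false, Sum.inr true, Sum.inr_injective.ne Bool.false_ne_true,
      subdivide_vert_eq_none_iff e B s t⟩
  · refine (hG.bivalent v).map ⟨Sum.inl, Sum.inl_injective⟩ (fun i => Option.some_inj) ?_
    rintro (k | k) hk
    · exact ⟨k, rfl⟩
    · exact absurd hk nofun

-- Merging the two parts of the split edge with the new vertex turns the new incidences into loops.
theorem isEven_toLeft_of_subdivide {S : Finset (G.I ⊕ Bool)}
    (hS : IsEven (G := (G.subdivide e B s t).toIncHypergraph) S) :
    IsEven (G := G.toIncHypergraph) S.toLeft := by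
  let D := G.subdivide e B s t
  let f : D.V ⊕ D.E → G.V ⊕ G.E :=
    Sum.elim (fun v : Option G.V => v.elim (Sum.inr e) Sum.inl)
      fun g : Option G.E => Sum.inr (g.getD e)
  have hedge (i : G.I) : f (Sum.inr (D.edge (Sum.inl i))) = Sum.inr (G.edge i) := by
    by_cases h : G.edge i = e ∧ i ∈ B <;> simp [f, D, subdivide, h]
  have hnew (b : Bool) :
      f (Sum.inl (D.vert (Sum.inr b))) = f (Sum.inr (D.edge (Sum.inr b))) := by
    cases b <;> rfl
  have hpre := hS.preimage (G := G.toIncHypergraph) f ⟨Sum.inl, Sum.inl_injective⟩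
    (fun _ => rfl) hedge (by rintro (i | b) hk; exacts [absurd ⟨i, rfl⟩ hk, hnew b])
  convert hpre
  ext i
  exact Finset.mem_toLeft.trans Finset.mem_preimage.symm

theorem sum_sign_subdivide (S : Finset (G.I ⊕ Bool)) :
    ∑ k ∈ S, ((G.subdivide e B s t).σ k : ℤ) =
      ∑ i ∈ S.toLeft, (G.σ i : ℤ) + ∑ b ∈ S.toRight, ((if b then t else s : ℤˣ) : ℤ) := by
  conv_lhs => rw [← Finset.toLeft_disjSum_toRight (u := S), Finset.sum_disjSum]
  rfl

theorem toRight_eq_empty_or_univ_of_subdivide {S : Finset (G.I ⊕ Bool)}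
    (hS : IsEven (G := (G.subdivide e B s t).toIncHypergraph) S) :
    S.toRight = ∅ ∨ S.toRight = Finset.univ := by
  have h : (Sum.inr false : G.I ⊕ Bool) ∈ S ↔ Sum.inr true ∈ S :=
    mem_iff_mem_of_even_card (G := (G.subdivide e B s t).toIncHypergraph)
      (subdivide_vert_eq_none_iff e B s t) (hS.even_card_vert _)
  rw [← Finset.mem_toRight, ← Finset.mem_toRight] at h
  by_cases hf : false ∈ S.toRight
  · exact Or.inr (Finset.eq_univ_iff_forall.2 fun b => b.casesOn hf (h.1 hf))
  · exact Or.inl (Finset.eq_empty_iff_forall_notMem.2 fun b => b.casesOn hf (mt h.2 hf))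

variable {e B s t}

theorem IsBalanced.subdivide (hG : G.IsBalanced)
    (hst : s * t = -1 ∨ (s * t = 1 ∧
      ∀ C : (G.subdivide e B s t).toIncHypergraph.Circle, (none : Option G.V) ∉ C.verts)) :
    (G.subdivide e B s t).IsBalanced := by
  rw [isBalanced_iff] at hG ⊢
  refine evenBalanced_of_circles fun C => ?_
  let S : Finset (G.I ⊕ Bool) := C.supp
  have hright : ∑ b ∈ S.toRight, ((if b then t else s : ℤˣ) : ℤ) = 0 := by
    rcases toRight_eq_empty_or_univ_of_subdivide e B s t C.isEven_supp with hS | hS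
    · simp [S, hS]
    · rcases hst with hst | ⟨-, hst⟩
      · have hts : t = -s := by
          rw [← neg_eq_iff_eq_neg, ← mul_right_inj s, mul_neg, hst, neg_neg, Int.units_mul_self]
        simp [S, hS, hts]
      · refine absurd (C.mem_verts_iff.2 ⟨Sum.inr false, ?_, rfl⟩) (hst C)
        exact Finset.mem_toRight.1 (hS ▸ Finset.mem_univ false)
  have hsum := sum_sign_subdivide e B s t S
  rw [hright, add_zero] at hsum
  exact hsum ▸ hG _ (isEven_toLeft_of_subdivide e B s t C.isEven_supp)

end Subdivide

theorem IsBalanced.of_iso {H : OrientedHypergraph.{u}} (hG : G.IsBalanced) (φ : Iso G H) :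
    H.IsBalanced := by
  rw [isBalanced_iff] at hG ⊢
  have hV (i) : G.vert (φ.onI.symm i) = φ.onV.symm (H.vert i) := by
    rw [Equiv.eq_symm_apply, ← φ.vert_onI, Equiv.apply_symm_apply]
  have hE (i) : G.edge (φ.onI.symm i) = φ.onE.symm (H.edge i) := by
    rw [Equiv.eq_symm_apply, ← φ.edge_onI, Equiv.apply_symm_apply]
  have hσ (i) : G.σ (φ.onI.symm i) = H.σ i := by
    rw [← φ.σ_onI, Equiv.apply_symm_apply]
  have := hG.comp φ.onV.symm φ.onE.symm φ.onI.symm.toEmbedding hV hE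
  simpa only [Equiv.coe_toEmbedding, hσ] using this

theorem IsBalancedSubdivision.isConnectedBivalent_and_isBalanced {H : OrientedHypergraph.{u}}
    (h : G.IsBalancedSubdivision H) (hG : G.toIncHypergraph.IsConnectedBivalent)
    (hb : G.IsBalanced) : H.toIncHypergraph.IsConnectedBivalent ∧ H.IsBalanced := by
  induction h with
  | refl => exact ⟨hG, hb⟩
  | tail _ hstep ih =>
    obtain ⟨e, B, s, t, ⟨φ⟩, hst⟩ := hstep
    exact ⟨(subdivide_isConnectedBivalent e B s t ih.1).of_iso φ.toIso,
      (ih.2.subdivide hst).of_iso φ⟩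

end OrientedHypergraph

namespace IncHypergraph

variable {G : IncHypergraph.{u}}

/-! ### Blocks of a bivalent hypergraph -/

theorem IsCircleCovered.exists_circle (hG : G.IsCircleCovered) (i : G.I) :
    ∃ C : G.Circle, i ∈ C.supp := by
  obtain ⟨h, ⟨⟨C⟩⟩ | ⟨hV, -⟩⟩ := hG
  · obtain ⟨D, hD, -⟩ := h.exists_circle C i i
    exact ⟨D, hD⟩
  · exact hV.elim (G.vert i)

theorem IsConnectedBivalent.isFlower (hG : G.IsConnectedBivalent) (h : G.IsInseparable)
    (C : G.Circle) : G.IsFlower := by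
  refine ⟨⟨h, Or.inl ⟨C⟩⟩, fun F hF => ?_⟩
  have hvert {i j : G.I} (hij : G.vert i = G.vert j) (hj : G.edge j ∈ F) : G.edge i ∈ F := by
    obtain ⟨D, hD⟩ := hF.exists_circle ⟨j, hj⟩
    obtain ⟨k, -, hkj, hk⟩ := D.isEven_supp.exists_ne_vert_eq hD
    obtain ⟨l, -, hl⟩ := (hG.bivalent (G.vert j)).exists_pair rfl
    obtain rfl : k.1 = l :=
      ((hl k.1).1 (congrArg Subtype.val hk)).resolve_left fun h => hkj (Subtype.ext h)
    rcases (hl i).1 hij with rfl | rfl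
    exacts [hj, k.2]
  obtain ⟨f, hf⟩ : ∃ f, f ∈ F := by
    obtain ⟨⟨D⟩⟩ | ⟨-, e, -⟩ := hF.2
    · exact ⟨_, (D.e 0).2⟩
    · exact ⟨_, e.2⟩
  have hall (e : G.E) : e ∈ F :=
    (hG.linked (Sum.inr f) (Sum.inr e)).of_invariant
      (p := Sum.elim (fun v => ∃ i, G.vert i = v ∧ G.edge i ∈ F) (· ∈ F))
      (fun i _ => ⟨fun ⟨_, hj, hjF⟩ => hvert hj.symm hjF, fun h => ⟨i, rfl, h⟩⟩) hf
  refine Sub.ext (Set.eq_univ_of_forall fun v => ?_) (Set.eq_univ_of_forall hall)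
    (Set.eq_univ_of_forall fun i => hall _)
  obtain ⟨i, hi⟩ := (hG.bivalent v).exists_vert_eq
  exact ⟨i, hi, hall _⟩

theorem Circle.mem_supp_of_vert (C : G.Circle) {i : G.I} (hv : G.IsBivalent (G.vert i))
    (hC : G.vert i ∈ C.verts) : i ∈ C.supp := by
  obtain ⟨j, hj, hji⟩ := C.mem_verts_iff.1 hC
  obtain ⟨k, -, h⟩ := hv.exists_pair rfl
  rcases (h j).1 hji with rfl | rfl
  · exact hj
  · exact (mem_iff_mem_of_even_card h (C.isEven_supp.even_card_vert _)).2 hj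

theorem edge_surjective_of_linked (hG : ∀ a b, Linked (Set.univ : Set G.I) a b) (v : G.V) :
    Function.Surjective G.edge := by
  intro e
  by_contra! h
  have := (hG (Sum.inr e) (Sum.inl v)).of_invariant (p := (· = Sum.inr e))
    (fun i _ => by simp [h i]) rfl
  exact Sum.inl_ne_inr this

section Explode

variable {β : Type u} {c : G.V → β}

/-- The fibres of `c` are the blocks of `G`: two vertices have the same image if and only if they
lie in a common circle. -/
def IsBlockMap (c : G.V → β) : Prop :=
  ∀ v w, c v = c w ↔ ∃ C : G.Circle, v ∈ C.verts ∧ w ∈ C.verts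

theorem exists_isBlockMap (hG : ∀ v, G.IsBivalent v) (hC : ∀ v, ∃ C : G.Circle, v ∈ C.verts) :
    ∃ (β : Type u) (c : G.V → β), IsBlockMap c := by
  let r : Setoid G.V :=
    { r := fun v w => ∃ C : G.Circle, v ∈ C.verts ∧ w ∈ C.verts
      iseqv :=
        { refl := fun v => (hC v).imp fun _ h => ⟨h, h⟩
          symm := fun ⟨C, hv, hw⟩ => ⟨C, hw, hv⟩
          trans := by
            rintro u v w ⟨C, hu, hv⟩ ⟨D, hvD, hw⟩
            obtain ⟨i, hi, rfl⟩ := C.mem_verts_iff.1 hu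
            obtain ⟨j, hj, rfl⟩ := C.mem_verts_iff.1 hv
            obtain ⟨k, hk, rfl⟩ := D.mem_verts_iff.1 hw
            obtain ⟨B, hiB, hkB, -⟩ := Circle.exists_mem_mem_of_inter_nonempty hi hk
              ⟨j, Finset.mem_inter.2 ⟨hj, D.mem_supp_of_vert (hG _) hvD⟩⟩
            exact ⟨B, B.mem_verts_iff.2 ⟨i, hiB, rfl⟩, B.mem_verts_iff.2 ⟨k, hkB, rfl⟩⟩ } }
  exact ⟨Quotient r, Quotient.mk r, fun v w => Quotient.eq⟩

theorem IsBlockMap.eq_of_mem_supp (hc : IsBlockMap c) {C : G.Circle} {i j : G.I}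
    (hi : i ∈ C.supp) (hj : j ∈ C.supp) : c (G.vert i) = c (G.vert j) :=
  (hc _ _).2 ⟨C, C.mem_verts_iff.2 ⟨i, hi, rfl⟩, C.mem_verts_iff.2 ⟨j, hj, rfl⟩⟩

theorem IsBlockMap.exists_circle (hc : IsBlockMap c) (hG : ∀ v, G.IsBivalent v) {i j : G.I}
    (hij : c (G.vert i) = c (G.vert j)) : ∃ C : G.Circle, i ∈ C.supp ∧ j ∈ C.supp := by
  obtain ⟨C, hi, hj⟩ := (hc _ _).1 hij
  exact ⟨C, C.mem_supp_of_vert (hG _) hi, C.mem_supp_of_vert (hG _) hj⟩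

/-! ### Exploding the edges between blocks -/

/-- The pairs of an edge and a block that meets it. -/
abbrev Attachment (c : G.V → β) : Type u := Set.range fun i => (G.edge i, c (G.vert i))

/-- The attachment to which an incidence belongs. -/
def attach (c : G.V → β) (i : G.I) : Attachment c := ⟨(G.edge i, c (G.vert i)), i, rfl⟩

theorem attach_eq_iff {i j : G.I} :
    attach c i = attach c j ↔ G.edge i = G.edge j ∧ c (G.vert i) = c (G.vert j) :=
  Subtype.ext_iff.trans Prod.ext_iff

theorem attach_surjective : Function.Surjective (attach c) := by
  rintro ⟨_, i, rfl⟩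
  exact ⟨i, rfl⟩

/-- The edge `e` meets at least two blocks. -/
def IsCutEdge (c : G.V → β) (e : G.E) : Prop :=
  ∃ i j, G.edge i = e ∧ G.edge j = e ∧ c (G.vert i) ≠ c (G.vert j)

/-- The edges that meet at least two blocks. -/
abbrev CutEdge (c : G.V → β) : Type u := {e // IsCutEdge c e}

/-- The attachments at edges that meet at least two blocks. -/
abbrev CutAttachment (c : G.V → β) : Type u := {q : Attachment c // IsCutEdge c q.1.1}

/-- The edge of an attachment. -/
abbrev CutAttachment.center (q : CutAttachment c) : CutEdge c := ⟨q.1.1.1, q.2⟩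

/-- Every edge is split into its attachments; if there are at least two of them, they are joined to
a new edge, each through a new vertex of degree two. The incidence `Sum.inr (Sum.inl q)` joins the
new vertex of `q` to its attachment, and `Sum.inr (Sum.inr q)` joins it to the new edge. -/
def explode (c : G.V → β) : IncHypergraph.{u} where
  V := G.V ⊕ CutAttachment c
  E := Attachment c ⊕ CutEdge c
  I := G.I ⊕ (CutAttachment c ⊕ CutAttachment c)
  vert := Sum.map G.vert (Sum.elim id id)
  edge := Sum.elim (fun i => Sum.inl (attach c i))
    (Sum.elim (fun q => Sum.inl q.1) fun q => Sum.inr q.center)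
  finite_V := inferInstance
  finite_E := inferInstance
  finite_I := inferInstance

theorem explode_isBivalent (hG : ∀ v, G.IsBivalent v) (x : (explode c).V) :
    (explode c).IsBivalent x := by
  rcases x with v | q
  · refine (hG v).map (H := explode c) ⟨Sum.inl, Sum.inl_injective⟩
      (fun i => Sum.inl_injective.eq_iff) ?_
    rintro (i | p | p) hp
    · exact ⟨i, rfl⟩
    all_goals exact absurd hp Sum.inr_ne_inl
  · refine ⟨Sum.inr (Sum.inl q), Sum.inr (Sum.inr q),
      fun h => Sum.inl_ne_inr (Sum.inr_injective h), ?_⟩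
    rintro (i | p | p) <;> simp [explode]

theorem isCutEdge_of_ne {p q : Attachment c} (hpq : p.1.1 = q.1.1) (hne : p ≠ q) :
    IsCutEdge c p.1.1 := by
  obtain ⟨i, rfl⟩ := attach_surjective p
  obtain ⟨j, rfl⟩ := attach_surjective q
  exact ⟨i, j, rfl, hpq.symm, fun h => hne (attach_eq_iff.2 ⟨hpq, h⟩)⟩

theorem explode_linked_center (q : CutAttachment c) :
    Linked (G := explode c) Set.univ (Sum.inr (Sum.inl q.1)) (Sum.inr (Sum.inr q.center)) :=
  (linked_vert_edge (G := explode c) (Set.mem_univ (Sum.inr (Sum.inl q)))).symm.trans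
    (linked_vert_edge (G := explode c) (Set.mem_univ (Sum.inr (Sum.inr q))))

theorem explode_linked_attachment {p q : Attachment c} (hpq : p.1.1 = q.1.1) :
    Linked (G := explode c) Set.univ (Sum.inr (Sum.inl p)) (Sum.inr (Sum.inl q)) := by
  by_cases hne : p = q
  · exact hne ▸ Linked.refl _ _
  · have hp := isCutEdge_of_ne hpq hne
    have hcenter : CutAttachment.center ⟨p, hp⟩ = CutAttachment.center ⟨q, hpq ▸ hp⟩ :=
      Subtype.ext hpq
    exact (hcenter ▸ explode_linked_center ⟨p, hp⟩).trans (explode_linked_center ⟨q, _⟩).symm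

theorem explode_isConnected (hG : ∀ a b, Linked (Set.univ : Set G.I) a b)
    (hE : Function.Surjective G.edge) : (explode c).IsConnected := by
  choose s hs using hE
  let f : G.V ⊕ G.E → (explode c).V ⊕ (explode c).E :=
    Sum.map Sum.inl fun e => Sum.inl (attach c (s e))
  have hf (x) : ∃ y, Linked (G := explode c) Set.univ x (f y) := by
    rcases x with (v | q) | (p | ⟨_, i, j, rfl, hj, hij⟩)
    · exact ⟨Sum.inl v, Linked.refl _ _⟩
    · exact ⟨Sum.inr q.1.1.1, (linked_vert_edge (G := explode c)
        (Set.mem_univ (Sum.inr (Sum.inl q)))).trans (explode_linked_attachment (hs _).symm)⟩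
    · exact ⟨Sum.inr p.1.1, explode_linked_attachment (hs _).symm⟩
    · exact ⟨Sum.inr (G.edge i), (explode_linked_center ⟨attach c i, i, j, rfl, hj, hij⟩).symm.trans
        (explode_linked_attachment (hs _).symm)⟩
  refine isConnected_iff_linked.2 fun a b => ?_
  obtain ⟨x, hx⟩ := hf a
  obtain ⟨y, hy⟩ := hf b
  refine (hx.trans ((hG x y).map f fun i _ => ?_)).trans hy.symm
  exact (linked_vert_edge (G := explode c) (Set.mem_univ (Sum.inl i))).trans
    (explode_linked_attachment (hs _).symm)

/-! ### Incidences of the new edges are bridges -/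

open Classical in
theorem IsBlockMap.even_card_attach (hc : IsBlockMap c) {S : Finset G.I} (hS : IsEven S)
    (q : Attachment c) : Even (S.filter fun i => attach c i = q).card := by
  refine hS.induction_circle (by simp) fun C T hCT hT => ?_
  rw [Finset.filter_union, Finset.card_union_of_disjoint (Finset.disjoint_filter_filter hCT)]
  refine Even.add ?_ hT
  by_cases hq : ∃ i ∈ C.supp, attach c i = q
  · obtain ⟨i, hi, rfl⟩ := hq
    rw [Finset.filter_congr fun j hj => attach_eq_iff.trans
      (and_iff_left (hc.eq_of_mem_supp hj hi))]
    exact C.isEven_supp.even_card_edge _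
  · rw [Finset.filter_eq_empty_iff.2 fun i hi h => hq ⟨i, hi, h⟩]
    exact Even.zero

theorem isEven_toLeft_of_explode {S : Finset (G.I ⊕ (CutAttachment c ⊕ CutAttachment c))}
    (hS : IsEven (G := explode c) S) : IsEven (G := G) S.toLeft := by
  have hpre := hS.preimage (G := G)
    (Sum.elim (Sum.elim Sum.inl fun q : CutAttachment c => Sum.inr q.1.1.1)
      (Sum.elim (fun p : Attachment c => Sum.inr p.1.1) fun e : CutEdge c => Sum.inr e.1))
    ⟨Sum.inl, Sum.inl_injective⟩ (fun _ => rfl) (fun _ => rfl)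
    (by rintro (i | p | p) hk; exacts [absurd ⟨i, rfl⟩ hk, rfl, rfl])
  convert hpre
  ext i
  exact Finset.mem_toLeft.trans Finset.mem_preimage.symm

theorem card_filter_toLeft_add_card_filter_toRight {α γ : Type*} (S : Finset (α ⊕ γ))
    (p : α ⊕ γ → Prop) [DecidablePred p] :
    (S.toLeft.filter fun a => p (Sum.inl a)).card + (S.toRight.filter fun b => p (Sum.inr b)).card =
      (S.filter p).card := by
  rw [← (S.filter p).card_toLeft_add_card_toRight]
  congr 2 <;> ext <;> simp

theorem IsBlockMap.notMem_of_isEven_explode (hc : IsBlockMap c)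
    {S : Finset (G.I ⊕ (CutAttachment c ⊕ CutAttachment c))}
    (hS : IsEven (G := explode c) S) (q : CutAttachment c) : Sum.inr (Sum.inr q) ∉ S := by
  classical
  intro hq
  have hmem : Sum.inr (Sum.inl q) ∈ S := by
    obtain ⟨i | p | p, hk, hkq, hkv⟩ := hS.exists_ne_vert_eq hq
    · exact absurd hkv Sum.inl_ne_inr
    · obtain rfl : p = q := Sum.inr_injective hkv
      exact hk
    · obtain rfl : p = q := Sum.inr_injective hkv
      exact absurd rfl hkq
  have hleft := hc.even_card_attach (isEven_toLeft_of_explode hS) q.1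
  have hright : Even (S.toRight.filter fun x =>
      (explode c).edge (Sum.inr x) = Sum.inl q.1).card := by
    have hcard := card_filter_toLeft_add_card_filter_toRight S
      fun k => (explode c).edge k = Sum.inl q.1
    have heven := (congrArg Even hcard).mpr (hS.even_card_edge (Sum.inl q.1))
    refine (Nat.even_add.1 heven).1 ?_
    convert hleft
    exact Sum.inl_injective.eq_iff
  obtain ⟨p | p, -, hpq, hp⟩ :=
    exists_ne_of_even_card_filter hright (Finset.mem_toRight.2 hmem) rfl
  · exact hpq (congrArg _ (Subtype.ext (Sum.inl_injective hp)))
  · exact Sum.inr_ne_inl hp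

theorem IsBlockMap.not_linked_center (hc : IsBlockMap c) (q : CutAttachment c) :
    ¬ Linked (G := explode c) {Sum.inr (Sum.inr q)}ᶜ
      (Sum.inl (Sum.inr q)) (Sum.inr (Sum.inr q.center)) := by
  intro h
  obtain ⟨C, hC, -⟩ := Linked.exists_circle (G := explode c) (i := Sum.inr (Sum.inr q))
    (not_not.2 rfl) h
  exact hc.notMem_of_isEven_explode C.isEven_supp q (Circle.mem_supp.2 hC)

end Explode

/-! ### Petals and stars -/

theorem isArtery_of_subsingleton_edge [Subsingleton G.E] (hG : Function.Bijective G.vert)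
    {i j : G.I} (hij : i ≠ j) : G.IsArtery := by
  refine Or.inl ⟨isConnected_iff_linked.2 ?_, ⟨fun C => ?_⟩, fun e he => ?_, fun v => Or.inl ?_⟩
  · have hto (a) : Linked (Set.univ : Set G.I) a (Sum.inr (G.edge i)) := by
      rcases a with v | e
      · obtain ⟨k, rfl⟩ := hG.2 v
        exact Subsingleton.elim (G.edge k) (G.edge i) ▸ linked_vert_edge (Set.mem_univ k)
      · exact Subsingleton.elim (G.edge i) e ▸ Linked.refl _ _
    exact fun a b => (hto a).trans (hto b).symm
  · obtain ⟨k, -, hk, hkv⟩ := C.isEven_supp.exists_ne_vert_eq (C.out_mem_supp 0)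
    exact hk (hG.1 hkv)
  · have := (Nat.card_eq_one_iff_unique.1 he).1
    exact hij (Subtype.mk.inj (Subsingleton.elim (α := {k // G.edge k = e})
      ⟨i, Subsingleton.elim _ _⟩ ⟨j, Subsingleton.elim _ _⟩))
  · obtain ⟨k, rfl⟩ := hG.2 v
    exact degree_eq_one_iff.2 ⟨k, fun l => hG.1.eq_iff⟩

section Explode

variable {β : Type u} {c : G.V → β} {B : β}

/-- The block `B` in `explode c`, together with the new vertices next to it. -/
def petal (c : G.V → β) (B : β) : (explode c).Sub where
  verts := {x | Sum.elim (fun v => c v = B) (fun q : CutAttachment c => q.1.1.2 = B) x}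
  edges := {x | Sum.elim (fun q : Attachment c => q.1.2 = B) (fun _ : CutEdge c => False) x}
  incs := {x | Sum.elim (fun i => c (G.vert i) = B)
    (Sum.elim (fun q : CutAttachment c => q.1.1.2 = B) fun _ : CutAttachment c => False) x}
  vert_mem := by rintro (i | q | q) h; exacts [h, h, h.elim]
  edge_mem := by rintro (i | q | q) h; exacts [h, h, h.elim]

/-- The new edge of `explode c` at the edge `e`, together with its vertices. -/
def star (c : G.V → β) (e : CutEdge c) : (explode c).Sub where
  verts := {x | Sum.elim (fun _ : G.V => False) (fun q : CutAttachment c => q.center = e) x}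
  edges := {x | Sum.elim (fun _ : Attachment c => False) (fun f : CutEdge c => f = e) x}
  incs := {x | Sum.elim (fun _ : G.I => False)
    (Sum.elim (fun _ : CutAttachment c => False) fun q : CutAttachment c => q.center = e) x}
  vert_mem := by rintro (i | q | q) h; exacts [h.elim, h.elim, h]
  edge_mem := by rintro (i | q | q) h; exacts [h.elim, h.elim, h]

theorem star_vert_bijective (e : CutEdge c) :
    Function.Bijective (star c e).toHypergraph.vert := by
  refine ⟨?_, ?_⟩
  · rintro ⟨i | p | p, hp⟩ ⟨j | q | q, hq⟩ hpq
    iterate 6 exact hp.elim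
    iterate 2 exact hq.elim
    obtain rfl : p = q := Sum.inr_injective (Subtype.mk.inj hpq)
    rfl
  · rintro ⟨v | q, hq⟩
    · exact hq.elim
    · exact ⟨⟨Sum.inr (Sum.inr q), hq⟩, rfl⟩

theorem star_isArtery (e : CutEdge c) : (star c e).toHypergraph.IsArtery := by
  have : Subsingleton (star c e).toHypergraph.E := by
    refine ⟨?_⟩
    rintro ⟨p | f, hf⟩ ⟨q | g, hg⟩
    · exact hf.elim
    · exact hf.elim
    · exact hg.elim
    · obtain rfl : f = g := Eq.trans hf (Eq.symm hg)
      rfl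
  obtain ⟨_, i, j, rfl, hj, hij⟩ := e
  refine isArtery_of_subsingleton_edge (star_vert_bijective _)
    (i := ⟨Sum.inr (Sum.inr ⟨attach c i, i, j, rfl, hj, hij⟩), rfl⟩)
    (j := ⟨Sum.inr (Sum.inr ⟨attach c j, i, j, hj.symm, rfl, hij⟩), Subtype.ext hj⟩) fun h => ?_
  have := Subtype.mk.inj (Sum.inr_injective (Sum.inr_injective (Subtype.mk.inj h)))
  exact hij (attach_eq_iff.1 this).2

theorem star_degree (e : CutEdge c) (v : (star c e).toHypergraph.V) :
    (star c e).toHypergraph.degree v = 1 := by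
  obtain ⟨i, rfl⟩ := (star_vert_bijective e).2 v
  exact degree_eq_one_iff.2 ⟨i, fun k => (star_vert_bijective e).1.eq_iff⟩

theorem petal_degree (hG : ∀ v, G.IsBivalent v) {v : G.V} (hv : c v = B) :
    (petal c B).toHypergraph.degree ⟨Sum.inl v, hv⟩ = 2 := by
  refine ((petal c B).degree_eq _ ?_).trans
    (degree_eq_two_iff.2 (explode_isBivalent hG (Sum.inl v)))
  rintro (i | q | q) hi
  · exact (congrArg c (Sum.inl_injective hi)).trans hv
  all_goals exact absurd hi Sum.inr_ne_inl

namespace IsBlockMap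

theorem exists_circle_petal (hc : IsBlockMap c) (hG : ∀ v, G.IsBivalent v) {i j : G.I}
    (hi : c (G.vert i) = B) (hj : c (G.vert j) = B) :
    ∃ D : (petal c B).toHypergraph.Circle, ⟨Sum.inl i, hi⟩ ∈ D.incs ∧ ⟨Sum.inl j, hj⟩ ∈ D.incs ∧
      ∀ x ∈ D.incs, ∃ k, x.1 = Sum.inl k := by
  obtain ⟨C, hiC, hjC⟩ := hc.exists_circle hG (hi.trans hj.symm)
  have hC (k : C.incs) : c (G.vert k) = B :=
    (hc.eq_of_mem_supp (Circle.mem_supp.2 k.2) hiC).trans hi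
  obtain ⟨D, hD⟩ := C.exists_map (H := (petal c B).toHypergraph)
    (fun k => ⟨Sum.inl k.1, hC k⟩)
    (fun k l h => Subtype.ext (Sum.inl_injective (Subtype.mk.inj h)))
    (fun k l => Subtype.ext_iff.trans Sum.inl_injective.eq_iff)
    (fun k l => (Subtype.ext_iff.trans Sum.inl_injective.eq_iff).trans
      (attach_eq_iff.trans (and_iff_left ((hC k).trans (hC l).symm))))
  refine ⟨D, ?_, ?_, fun x hx => ?_⟩
  · exact hD ▸ ⟨⟨i, Circle.mem_supp.1 hiC⟩, rfl⟩
  · exact hD ▸ ⟨⟨j, Circle.mem_supp.1 hjC⟩, rfl⟩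
  · obtain ⟨k, rfl⟩ := hD ▸ hx
    exact ⟨k.1, rfl⟩

theorem petal_isThorn (hc : IsBlockMap c) (hG : ∀ v, G.IsBivalent v) {q : CutAttachment c}
    (hq : q.1.1.2 = B) : (petal c B).toHypergraph.IsThorn ⟨Sum.inr q, hq⟩ := by
  obtain ⟨⟨_, i, rfl⟩, hcut⟩ := q
  let p : CutAttachment c := ⟨attach c i, hcut⟩
  refine ⟨degree_eq_one_iff.2 ⟨⟨Sum.inr (Sum.inl p), hq⟩, ?_⟩,
    ⟨Sum.inr (Sum.inl p), hq⟩, rfl, Or.inl ?_⟩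
  · rintro ⟨j | r | r, hr⟩
    · exact iff_of_false (fun h => Sum.inl_ne_inr (Subtype.mk.inj h))
        (fun h => Sum.inl_ne_inr (Subtype.mk.inj h))
    · refine ⟨fun h => ?_, fun h => ?_⟩
      · obtain rfl : r = p := Sum.inr_injective (Subtype.mk.inj h)
        rfl
      · obtain rfl : r = p := Sum.inl_injective (Sum.inr_injective (Subtype.mk.inj h))
        rfl
    · exact hr.elim
  · obtain ⟨D, hD, -⟩ := hc.exists_circle_petal hG (i := i) (j := i) hq hq
    exact ⟨D, D.edge_mem_edges (i := ⟨Sum.inl i, hq⟩) (Circle.mem_supp.2 hD)⟩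

theorem petal_isThorn_iff (hc : IsBlockMap c) (hG : ∀ v, G.IsBivalent v)
    {x : (petal c B).toHypergraph.V} :
    (petal c B).toHypergraph.IsThorn x ↔ ∃ q, x.1 = Sum.inr q := by
  obtain ⟨v | q, hx⟩ := x
  · refine iff_of_false (fun h => ?_) fun ⟨q, h⟩ => Sum.inl_ne_inr h
    have := h.1.symm.trans (petal_degree hG hx)
    lia
  · exact iff_of_true (hc.petal_isThorn hG hx) ⟨q, rfl⟩

theorem petal_deleteVerts_isFlower (hc : IsBlockMap c) (hG : ∀ v, G.IsBivalent v)
    (hB : ∃ v, c v = B) : ((petal c B).toHypergraph.deleteVerts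
      {x | ∃ q, x.1 = Sum.inr q}).toHypergraph.IsFlower := by
  set K := (petal c B).toHypergraph.deleteVerts {x | ∃ q, x.1 = Sum.inr q} with hK
  have hmem {i : G.I} (hi : c (G.vert i) = B) :
      (⟨Sum.inl i, hi⟩ : (petal c B).toHypergraph.I) ∈ K.incs := fun ⟨q, hq⟩ => Sum.inl_ne_inr hq
  have hcircle (x y : K.toHypergraph.I) :
      ∃ C : K.toHypergraph.Circle, x ∈ C.incs ∧ y ∈ C.incs := by
    obtain ⟨⟨i | p | p, hi⟩, hx⟩ := x
    · obtain ⟨⟨j | q | q, hj⟩, hy⟩ := y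
      · obtain ⟨D, hiD, hjD, hD⟩ := hc.exists_circle_petal hG hi hj
        obtain ⟨C, hC⟩ := K.exists_circle D fun z hz => by
          obtain ⟨k, hk⟩ := hD z hz
          obtain ⟨z, hzB⟩ := z
          obtain rfl : z = Sum.inl k := hk
          exact hmem hzB
        exact ⟨C, (hC _).2 hiD, (hC _).2 hjD⟩
      · exact absurd ⟨q, rfl⟩ hy
      · exact hj.elim
    · exact absurd ⟨p, rfl⟩ hx
    · exact hi.elim
  have hbivalent (x : K.toHypergraph.V) : K.toHypergraph.IsBivalent x := by
    obtain ⟨⟨v | q, hv⟩, hx⟩ := x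
    · refine degree_eq_two_iff.1 ((K.degree_eq _ fun i hi => ?_).trans (petal_degree hG hv))
      exact fun ⟨q, hq⟩ => Sum.inl_ne_inr ((Subtype.mk.inj hi).symm.trans hq)
    · exact absurd ⟨q, rfl⟩ hx
  have hedge : Function.Surjective K.toHypergraph.edge := by
    rintro ⟨⟨q | f, hq⟩, -⟩
    · obtain ⟨i, rfl⟩ := attach_surjective q
      exact ⟨⟨⟨Sum.inl i, hq⟩, hmem hq⟩, rfl⟩
    · exact hq.elim
  obtain ⟨v, rfl⟩ := hB
  obtain ⟨i, rfl⟩ := (hG v).exists_vert_eq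
  obtain ⟨C, -⟩ := hcircle ⟨⟨Sum.inl i, rfl⟩, hmem rfl⟩ ⟨⟨Sum.inl i, rfl⟩, hmem rfl⟩
  have hK : K.toHypergraph.IsInseparable := fun x y _ => hcircle x y
  refine IsConnectedBivalent.isFlower ⟨⟨C.e 0⟩, ?_, hbivalent⟩ hK C
  exact hK.linked C (fun x => (hbivalent x).exists_vert_eq) hedge

theorem petal_isPseudoFlower (hc : IsBlockMap c) (hG : ∀ v, G.IsBivalent v)
    {q : CutAttachment c} (hq : q.1.1.2 = B) : (petal c B).toHypergraph.IsPseudoFlower := by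
  refine ⟨⟨_, hc.petal_isThorn hG hq⟩, ?_⟩
  simp only [hc.petal_isThorn_iff hG]
  obtain ⟨⟨_, i, rfl⟩, _⟩ := q
  exact hc.petal_deleteVerts_isFlower hG ⟨G.vert i, hq⟩

end IsBlockMap

end Explode

theorem Sub.linked {K : G.Sub} (hK : K.toHypergraph.IsConnected)
    (a b : K.toHypergraph.V ⊕ K.toHypergraph.E) :
    Linked K.incs (a.map Subtype.val Subtype.val) (b.map Subtype.val Subtype.val) :=
  (isConnected_iff_linked.1 hK a b).map _ fun i _ => linked_vert_edge i.2

/-- The inverse of an isomorphism of hypergraphs. -/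
def Iso.symm {H : IncHypergraph.{u}} (φ : Iso G H) : Iso H G where
  onV := φ.onV.symm
  onE := φ.onE.symm
  onI := φ.onI.symm
  vert_onI i := by rw [Equiv.eq_symm_apply, ← φ.vert_onI, Equiv.apply_symm_apply]
  edge_onI i := by rw [Equiv.eq_symm_apply, ← φ.edge_onI, Equiv.apply_symm_apply]

theorem exists_iso_of_edge_surjective {H : IncHypergraph.{u}} (fV : G.V ≃ H.V) (fI : G.I ≃ H.I)
    (hV : ∀ i, H.vert (fI i) = fV (G.vert i))
    (hE : ∀ i j, H.edge (fI i) = H.edge (fI j) ↔ G.edge i = G.edge j)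
    (hG : Function.Surjective G.edge) (hH : Function.Surjective H.edge) :
    Nonempty (Iso G H) := by
  let fE : G.E → H.E := fun e => H.edge (fI (hG e).choose)
  have hfE (i : G.I) : fE (G.edge i) = H.edge (fI i) := (hE _ _).2 (hG _).choose_spec
  have hbij : Function.Bijective fE := by
    refine ⟨fun e f h => ?_, fun e => ?_⟩
    · rw [← (hG e).choose_spec, ← (hG f).choose_spec]
      exact (hE _ _).1 h
    · obtain ⟨i, rfl⟩ := hH e
      obtain ⟨i, rfl⟩ := fI.surjective i
      exact ⟨_, hfE i⟩
  exact ⟨fV, Equiv.ofBijective fE hbij, fI, hV, fun i => (hfE i).symm⟩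

section Explode

variable {β : Type u} {c : G.V → β}

/-! ### The exploded hypergraph is a thorn-connection -/

theorem petal_inter_petal {B B' : β} (h : B ≠ B') :
    (petal c B).inter (petal c B') = Sub.empty _ := by
  refine Sub.ext ?_ ?_ ?_ <;> refine Set.eq_empty_of_forall_notMem ?_
  · rintro (v | q) ⟨hB, hB'⟩ <;> exact h (Eq.trans (Eq.symm hB) hB')
  · rintro (q | f) ⟨hB, hB'⟩
    exacts [h (Eq.trans (Eq.symm hB) hB'), hB]
  · rintro (i | q | q) ⟨hB, hB'⟩
    exacts [h (Eq.trans (Eq.symm hB) hB'), h (Eq.trans (Eq.symm hB) hB'), hB]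

theorem star_inter_star {e e' : CutEdge c} (h : e ≠ e') :
    (star c e).inter (star c e') = Sub.empty _ := by
  refine Sub.ext ?_ ?_ ?_ <;> refine Set.eq_empty_of_forall_notMem ?_
  · rintro (v | q) ⟨he, he'⟩
    exacts [he, h (Eq.trans (Eq.symm he) he')]
  · rintro (q | f) ⟨he, he'⟩
    exacts [he, h (Eq.trans (Eq.symm he) he')]
  · rintro (i | q | q) ⟨he, he'⟩
    exacts [he, he, h (Eq.trans (Eq.symm he) he')]

theorem petal_inter_star {B : β} {q : CutAttachment c} (hq : q.1.1.2 = B) :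
    (petal c B).inter (star c q.center) = Sub.single (Sum.inr q) := by
  subst hq
  refine Sub.ext (Set.ext ?_) (Set.eq_empty_of_forall_notMem ?_)
    (Set.eq_empty_of_forall_notMem ?_)
  · rintro (v | p)
    · exact iff_of_false (fun h => h.2) Sum.inl_ne_inr
    · refine ⟨fun ⟨h, h'⟩ => congrArg Sum.inr ?_, fun h => ?_⟩
      · exact Subtype.ext (Subtype.ext (Prod.ext (Subtype.mk.inj h') h))
      · obtain rfl : p = q := Sum.inr_injective h
        exact ⟨rfl, rfl⟩
  · rintro (p | f) ⟨h, h'⟩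
    exacts [h', h]
  · rintro (i | p | p) ⟨h, h'⟩
    exacts [h', h', h]

theorem petal_inter_star_eq_empty_or (B : β) (e : CutEdge c) :
    (petal c B).inter (star c e) = Sub.empty _ ∨
      ∃ q : CutAttachment c, q.1.1.2 = B ∧ q.center = e := by
  by_cases h : ∃ x, x ∈ ((petal c B).inter (star c e)).verts
  · obtain ⟨v | q, hB, he⟩ := h
    · exact he.elim
    · exact Or.inr ⟨q, hB, he⟩
  · refine Or.inl (Sub.ext (Set.eq_empty_of_forall_notMem fun x hx => h ⟨x, hx⟩)
      (Set.eq_empty_of_forall_notMem ?_) (Set.eq_empty_of_forall_notMem fun i hi => ?_))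
    · rintro (q | f) ⟨hB, he⟩
      exacts [he, hB]
    · exact h ⟨_, ((petal c B).inter (star c e)).vert_mem i hi⟩

theorem exists_cutAttachment (hG : ∀ a b, Linked (Set.univ : Set G.I) a b) {v w : G.V}
    (hvw : c v ≠ c w) : ∃ q : CutAttachment c, q.1.1.2 = c v := by
  by_contra! h
  refine hvw (Eq.symm ?_)
  refine (hG (Sum.inl v) (Sum.inl w)).of_invariant
    (p := Sum.elim (c · = c v) fun e => ∃ i, G.edge i = e ∧ c (G.vert i) = c v)
    (fun i _ => ⟨fun hi => ⟨i, rfl, hi⟩, fun ⟨j, hj, hjv⟩ => ?_⟩) rfl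
  by_contra hi
  exact h ⟨attach c j, i, j, hj.symm, rfl, fun hij => hi (hij.trans hjv)⟩ hjv

theorem IsBlockMap.not_isConnected_deleteEdge (hc : IsBlockMap c) (e : CutEdge c) :
    ¬ ((explode c).deleteEdge (Sum.inr e)).toHypergraph.IsConnected := by
  intro h
  obtain ⟨_, i, j, rfl, hj, hij⟩ := e
  let p : CutAttachment c := ⟨attach c i, i, j, rfl, hj, hij⟩
  let q : CutAttachment c := ⟨attach c j, i, j, hj.symm, rfl, hij⟩
  have hpq : q ≠ p := fun h => hij (attach_eq_iff.1 (Subtype.mk.inj h)).2.symm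
  have hcenter : q.center = p.center := Subtype.ext hj
  have hlinked := Sub.linked h (Sum.inl ⟨Sum.inr p, trivial⟩) (Sum.inl ⟨Sum.inr q, trivial⟩)
  refine hc.not_linked_center p ((hlinked.mono fun x hx => ?_).trans (hcenter ▸ linked_vert_edge
    (G := explode c) (i := Sum.inr (Sum.inr q)) fun h => ?_))
  · rintro rfl
    exact hx rfl
  · exact hpq (Sum.inr_injective (Sum.inr_injective h))

theorem IsBlockMap.not_isConnected_deleteVerts (hc : IsBlockMap c) (q : CutAttachment c) :
    ¬ ((explode c).deleteVerts {Sum.inr q}).toHypergraph.IsConnected := by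
  intro h
  have hlinked := Sub.linked h (Sum.inr ⟨Sum.inl q.1, trivial⟩)
    (Sum.inr ⟨Sum.inr q.center, trivial⟩)
  refine hc.not_linked_center q ((linked_vert_edge (G := explode c) (i := Sum.inr (Sum.inl q))
    fun h => ?_).trans (hlinked.mono fun x hx => ?_))
  · exact Sum.inl_ne_inr (Sum.inr_injective h)
  · rintro rfl
    exact hx rfl

theorem IsBlockMap.isArterialConnection_explode (hc : IsBlockMap c) (hG : G.IsConnectedBivalent)
    (v : G.V) : (explode c).IsArterialConnection (Set.range fun v => petal c (c v))
      (Set.range (star c)) where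
  cover_V := by
    rintro (v | ⟨⟨_, i, rfl⟩, hq⟩)
    exacts [⟨_, Or.inl ⟨v, rfl⟩, rfl⟩, ⟨_, Or.inl ⟨G.vert i, rfl⟩, rfl⟩]
  cover_E := by
    rintro (⟨_, i, rfl⟩ | e)
    exacts [⟨_, Or.inl ⟨G.vert i, rfl⟩, rfl⟩, ⟨_, Or.inr ⟨e, rfl⟩, rfl⟩]
  cover_I := by
    rintro (i | ⟨⟨_, i, rfl⟩, hq⟩ | q)
    exacts [⟨_, Or.inl ⟨G.vert i, rfl⟩, rfl⟩, ⟨_, Or.inl ⟨G.vert i, rfl⟩, rfl⟩,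
      ⟨_, Or.inr ⟨q.center, rfl⟩, rfl⟩]
  artery := Set.forall_mem_range.2 star_isArtery
  arteries_disjoint := by
    rintro _ ⟨e, rfl⟩ _ ⟨f, rfl⟩ hef
    exact star_inter_star (ne_of_apply_ne _ hef)
  nearly_disjoint := by
    rintro _ ⟨v, rfl⟩ _ ⟨w, rfl⟩ hvw
    exact Or.inl (petal_inter_petal (ne_of_apply_ne _ hvw))
  connected := explode_isConnected hG.linked (edge_surjective_of_linked hG.linked v)
  meet_artery := by
    rintro _ ⟨v, rfl⟩ _ ⟨e, rfl⟩ h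
    obtain ⟨q, hq, rfl⟩ := (petal_inter_star_eq_empty_or _ _).resolve_left h
    exact ⟨⟨Sum.inr q, rfl⟩, petal_inter_star hq,
      fun h => absurd ((star_degree _ _).symm.trans h) (by decide)⟩
  meet_in_artery := by
    rintro _ ⟨v, rfl⟩ _ ⟨w, rfl⟩ hvw h
    exact absurd (petal_inter_petal (ne_of_apply_ne _ hvw)) h
  only_two := by
    rintro _ ⟨v, rfl⟩ _ ⟨w, rfl⟩ hvw x hx
    have : x ∈ (Sub.empty (explode c)).verts :=
      petal_inter_petal (ne_of_apply_ne (petal c) hvw) ▸ hx ▸ rfl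
    exact this.elim
  edge_disconnects := by
    rintro _ ⟨e, rfl⟩ (p | f) hf
    exacts [hf.elim, hc.not_isConnected_deleteEdge f]
  vert_disconnects := by
    rintro _ ⟨e, rfl⟩ (v | q) hq
    exacts [hq.elim, hc.not_isConnected_deleteVerts q]

theorem IsBlockMap.isThornConnection_explode (hc : IsBlockMap c) (hG : G.IsConnectedBivalent)
    {v₁ v₂ : G.V} (hv : c v₁ ≠ c v₂) :
    (explode c).IsThornConnection (Set.range fun v => petal c (c v)) (Set.range (star c)) where
  nonempty := ⟨_, v₁, rfl⟩
  pseudoFlower := by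
    rintro _ ⟨v, rfl⟩
    obtain ⟨w, hw⟩ : ∃ w, c v ≠ c w := by
      by_contra! h
      exact hv ((h v₁).symm.trans (h v₂))
    obtain ⟨q, hq⟩ := exists_cutAttachment hG.linked hw
    exact hc.petal_isPseudoFlower hG.bivalent hq
  arterial := hc.isArterialConnection_explode hG v₁
  meet_thorn := by
    rintro _ ⟨v, rfl⟩ _ ⟨e, rfl⟩ h
    obtain ⟨q, hq, rfl⟩ := (petal_inter_star_eq_empty_or _ _).resolve_left h
    exact ⟨⟨Sum.inr q, hq⟩, petal_inter_star hq, hc.petal_isThorn hG.bivalent hq⟩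

theorem mem_star_verts_iff {x : (explode c).V} :
    (∃ A ∈ Set.range (star c), x ∈ A.verts) ↔ ∃ q, x = Sum.inr q := by
  rcases x with v | q
  · refine iff_of_false ?_ fun ⟨q, hq⟩ => Sum.inl_ne_inr hq
    rintro ⟨_, ⟨e, rfl⟩, h⟩
    exact h.elim
  · exact iff_of_true ⟨_, ⟨q.center, rfl⟩, rfl⟩ ⟨q, rfl⟩

/-! ### Contracting the new vertices -/

theorem contractVerts_mk_attachment (q : CutAttachment c) :
    (Quot.mk _ (Sum.inl q.1) : ((explode c).contractVerts {x | ∃ q, x = Sum.inr q}).E) =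
      Quot.mk _ (Sum.inr q.center) :=
  Quot.sound ⟨Sum.inr (Sum.inl q), Sum.inr (Sum.inr q), ⟨q, rfl⟩, rfl, rfl, rfl⟩

theorem contractVerts_mk_attach_eq_iff {i j : G.I} :
    (Quot.mk _ (Sum.inl (attach c i)) :
      ((explode c).contractVerts {x | ∃ q, x = Sum.inr q}).E) = Quot.mk _ (Sum.inl (attach c j)) ↔
        G.edge i = G.edge j := by
  refine ⟨fun h => ?_, fun h => ?_⟩
  · let f : Attachment c ⊕ CutEdge c → G.E := Sum.elim (fun p => p.1.1) fun e => e.1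
    have hf : ∀ (x : G.I ⊕ (CutAttachment c ⊕ CutAttachment c)) (q : CutAttachment c),
        (explode c).vert x = Sum.inr q → f ((explode c).edge x) = q.1.1.1 := by
      rintro (i | p | p) q hq
      · exact absurd hq Sum.inl_ne_inr
      · exact congrArg (fun q : CutAttachment c => q.1.1.1) (Sum.inr_injective hq)
      · exact congrArg (fun q : CutAttachment c => q.1.1.1) (Sum.inr_injective hq)
    refine congrArg (Quot.lift f ?_) h
    rintro _ _ ⟨x, y, ⟨q, hq⟩, hxy, rfl, rfl⟩
    exact (hf x q hq).trans (hf y q (hxy.symm.trans hq)).symm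
  · by_cases hij : attach c i = attach c j
    · exact congrArg (fun p => Quot.mk _ (Sum.inl p)) hij
    · have hi : IsCutEdge c (attach c i).1.1 := isCutEdge_of_ne (q := attach c j) h hij
      have hj : IsCutEdge c (attach c j).1.1 :=
        isCutEdge_of_ne (q := attach c i) h.symm (Ne.symm hij)
      have hcenter : CutAttachment.center ⟨attach c i, hi⟩ =
          CutAttachment.center ⟨attach c j, hj⟩ := Subtype.ext h
      exact (contractVerts_mk_attachment ⟨attach c i, hi⟩).trans <|
        (congrArg (fun e => Quot.mk _ (Sum.inr e)) hcenter).trans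
          (contractVerts_mk_attachment ⟨attach c j, hj⟩).symm

theorem contractVerts_explode_edge_surjective :
    Function.Surjective ((explode c).contractVerts {x | ∃ q, x = Sum.inr q}).edge := by
  have hinl (p : Attachment c) : ∃ i, ((explode c).contractVerts {x | ∃ q, x = Sum.inr q}).edge i =
      Quot.mk _ (Sum.inl p) := by
    obtain ⟨i, rfl⟩ := attach_surjective p
    exact ⟨⟨Sum.inl i, fun ⟨_, h⟩ => Sum.inl_ne_inr h⟩, rfl⟩
  rintro ⟨p | ⟨_, i, j, rfl, hj, hij⟩⟩
  · exact hinl p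
  · exact (hinl (attach c i)).imp fun _ h =>
      h.trans (contractVerts_mk_attachment ⟨attach c i, i, j, rfl, hj, hij⟩)

theorem exists_iso_contractVerts_explode (hG : Function.Surjective G.edge) :
    Nonempty (Iso ((explode c).contractVerts {x | ∃ q, x = Sum.inr q}) G) := by
  let fV (v : G.V) : ((explode c).contractVerts {x | ∃ q, x = Sum.inr q}).V :=
    ⟨Sum.inl v, fun ⟨_, h⟩ => Sum.inl_ne_inr h⟩
  let fI (i : G.I) : ((explode c).contractVerts {x | ∃ q, x = Sum.inr q}).I :=
    ⟨Sum.inl i, fun ⟨_, h⟩ => Sum.inl_ne_inr h⟩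
  have hfV : Function.Bijective fV := by
    refine ⟨fun v w h => Sum.inl_injective (Subtype.mk.inj h), ?_⟩
    rintro ⟨v | q, h⟩
    exacts [⟨v, rfl⟩, absurd ⟨q, rfl⟩ h]
  have hfI : Function.Bijective fI := by
    refine ⟨fun v w h => Sum.inl_injective (Subtype.mk.inj h), ?_⟩
    rintro ⟨i | q | q, h⟩
    exacts [⟨i, rfl⟩, absurd ⟨q, rfl⟩ h, absurd ⟨q, rfl⟩ h]
  obtain ⟨φ⟩ := exists_iso_of_edge_surjective (Equiv.ofBijective fV hfV)
    (Equiv.ofBijective fI hfI) (fun _ => rfl)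
    (fun _ _ => contractVerts_mk_attach_eq_iff) hG contractVerts_explode_edge_surjective
  exact ⟨φ.symm⟩

end Explode

theorem IsConnectedBivalent.isHypercircle (hG : G.IsConnectedBivalent)
    (hC : ∀ v, ∃ C : G.Circle, v ∈ C.verts) : G.IsHypercircle := by
  rcases isEmpty_or_nonempty G.V with hV | ⟨⟨v⟩⟩
  · obtain ⟨e⟩ := hG.nonempty
    refine Or.inl ⟨hV, e, trivial, fun f _ => Sum.inr_injective (α := G.V) ?_⟩
    exact (hG.linked (Sum.inr e) (Sum.inr f)).of_invariant (p := (· = Sum.inr e))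
      (fun i _ => hV.elim (G.vert i)) rfl
  obtain ⟨β, c, hc⟩ := exists_isBlockMap hG.bivalent hC
  by_cases hone : ∀ v w, c v = c w
  · obtain ⟨C, -⟩ := hC v
    refine Or.inr (Or.inl (hG.isFlower (fun i j _ => ?_) C))
    obtain ⟨D, hi, hj⟩ := hc.exists_circle hG.bivalent (hone (G.vert i) (G.vert j))
    exact ⟨D, Circle.mem_supp.1 hi, Circle.mem_supp.1 hj⟩
  · push Not at hone
    obtain ⟨v₁, v₂, hv⟩ := hone
    refine Or.inr (Or.inr ⟨_, _, _, hc.isThornConnection_explode hG hv, fun x hx => ?_, ?_⟩)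
    · have := hx.symm.trans (degree_eq_two_iff.2 (explode_isBivalent hG.bivalent x))
      lia
    · simp only [mem_star_verts_iff]
      exact exists_iso_contractVerts_explode (edge_surjective_of_linked hG.linked v)

/-! ### Contracting a vertex in no circle -/

theorem add_mapDomain_update_id {α : Type*} [DecidableEq α] (a b : α) (f : α →₀ ZMod 2) :
    f + f.mapDomain (Function.update id b a) =
      f b • (Finsupp.single a 1 + Finsupp.single b 1) := by
  induction f using Finsupp.induction_linear with
  | zero => simp
  | add f g hf hg =>
    rw [Finsupp.mapDomain_add, add_add_add_comm, hf, hg, Finsupp.add_apply, add_smul]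
  | single x r =>
    rw [Finsupp.mapDomain_single]
    by_cases hx : x = b
    · subst hx
      simp [add_comm]
    · simp [hx, ZModModule.add_self]

theorem Iso.exists_mem_verts {H : IncHypergraph.{u}} (φ : Iso G H) {C : G.Circle} {v : G.V}
    (hv : v ∈ C.verts) : ∃ D : H.Circle, φ.onV v ∈ D.verts := by
  obtain ⟨i, hi, rfl⟩ := C.mem_verts_iff.1 hv
  obtain ⟨D, hD⟩ := C.exists_map (fun i => φ.onI i)
    (φ.onI.injective.comp Subtype.val_injective)
    (fun i j => by rw [φ.vert_onI, φ.vert_onI, φ.onV.apply_eq_iff_eq])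
    (fun i j => by rw [φ.edge_onI, φ.edge_onI, φ.onE.apply_eq_iff_eq])
  refine ⟨D, D.mem_verts_iff.2 ⟨φ.onI i, ?_, φ.vert_onI i⟩⟩
  rw [Circle.mem_supp, hD]
  exact ⟨⟨i, Circle.mem_supp.1 hi⟩, rfl⟩

section Contraction

variable {u : G.V} {i j : G.I}

theorem not_linked_edge_edge (hij : i ≠ j) (hi : G.vert i = u) (hj : G.vert j = u)
    (hC : ∀ C : G.Circle, u ∉ C.verts) :
    ¬ Linked {k | G.vert k ≠ u} (Sum.inr (G.edge i)) (Sum.inr (G.edge j)) := by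
  intro h
  have hlinked : Linked (insert j {k | G.vert k ≠ u}) (Sum.inl (G.vert i)) (Sum.inr (G.edge i)) :=
    hi.trans hj.symm ▸ (linked_vert_edge (Set.mem_insert j _)).trans
      (h.mono (Set.subset_insert _ _)).symm
  obtain ⟨C, hiC, -⟩ := hlinked.exists_circle (by simp [hij, hi])
  exact hC C (hi ▸ C.vert_mem_verts (Circle.mem_supp.2 hiC))

theorem contractVerts_mk_eq (hi : G.vert i = u) (hj : G.vert j = u) (e : G.E) :
    (Quot.mk _ (Function.update id (G.edge j) (G.edge i) e) : (G.contractVerts {u}).E) =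
      Quot.mk _ e := by
  by_cases he : e = G.edge j
  · subst he
    rw [Function.update_self]
    exact Quot.sound ⟨i, j, hi, hi.trans hj.symm, rfl, rfl⟩
  · rw [Function.update_of_ne he, id]

theorem exists_contractVerts_edge_lift (hu : ∀ k, G.vert k = u ↔ k = i ∨ k = j) :
    ∃ r : (G.contractVerts {u}).E → G.E,
      ∀ e, r (Quot.mk _ e) = Function.update id (G.edge j) (G.edge i) e := by
  have hr (k : G.I) (hk : G.vert k = u) :
      Function.update id (G.edge j) (G.edge i) (G.edge k) = G.edge i := by
    rcases (hu k).1 hk with rfl | rfl <;> simp [Function.update_apply]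
  refine ⟨Quot.lift _ ?_, fun _ => rfl⟩
  rintro _ _ ⟨k, l, hk, hkl, rfl, rfl⟩
  exact (hr k hk).trans (hr l (hkl.symm.trans hk)).symm

theorem exists_contractVerts_edge_equiv (hu : ∀ k, G.vert k = u ↔ k = i ∨ k = j)
    (hij : G.edge i ≠ G.edge j) : ∃ φ : Option (G.contractVerts {u}).E ≃ G.E,
      φ none = G.edge j ∧ ∀ e ≠ G.edge j, φ (some (Quot.mk _ e)) = e := by
  obtain ⟨r, hr⟩ := exists_contractVerts_edge_lift hu
  have hleft : Function.LeftInverse (Quot.mk _) r := by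
    rintro ⟨e⟩
    exact (congrArg _ (hr e)).trans
      (contractVerts_mk_eq ((hu i).2 (Or.inl rfl)) ((hu j).2 (Or.inr rfl)) e)
  have hne (x) : r x ≠ G.edge j := by
    obtain ⟨e⟩ := x
    rw [hr, Function.update_apply]
    split_ifs with he
    exacts [hij, he]
  have hsome {e : G.E} (he : e ≠ G.edge j) : r (Quot.mk _ e) = e :=
    (hr e).trans (Function.update_of_ne he _ _)
  let f (o : Option (G.contractVerts {u}).E) : G.E := o.elim (G.edge j) r
  have hf : Function.Bijective f := by
    refine ⟨?_, fun e => ?_⟩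
    · rintro (_ | x) (_ | y) h
      exacts [rfl, absurd h.symm (hne y), absurd h (hne x), congrArg some (hleft.injective h)]
    · by_cases he : e = G.edge j
      exacts [⟨none, he.symm⟩, ⟨some (Quot.mk _ e), hsome he⟩]
  exact ⟨Equiv.ofBijective f hf, rfl, fun e he => hsome he⟩

theorem exists_incidence_equiv (hij : i ≠ j) (hu : ∀ k, G.vert k = u ↔ k = i ∨ k = j) :
    ∃ φ : {k : G.I // G.vert k ∉ ({u} : Set G.V)} ⊕ Bool ≃ G.I,
      (∀ k, φ (Sum.inl k) = k) ∧ φ (Sum.inr false) = i ∧ φ (Sum.inr true) = j := by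
  have hi : G.vert i = u := (hu i).2 (Or.inl rfl)
  have hj : G.vert j = u := (hu j).2 (Or.inr rfl)
  let f : {k : G.I // G.vert k ∉ ({u} : Set G.V)} ⊕ Bool → G.I :=
    Sum.elim Subtype.val fun b => if b then j else i
  have hf : Function.Bijective f := by
    refine ⟨Subtype.val_injective.sumElim ?_ ?_, fun k => ?_⟩
    · rintro (_ | _) (_ | _) h
      exacts [rfl, absurd h hij, absurd h.symm hij, rfl]
    · rintro k (_ | _) h
      exacts [k.2 (h ▸ hi), k.2 (h ▸ hj)]
    · by_cases hk : G.vert k = u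
      · rcases (hu k).1 hk with rfl | rfl
        exacts [⟨Sum.inr false, rfl⟩, ⟨Sum.inr true, rfl⟩]
      · exact ⟨Sum.inl ⟨k, hk⟩, rfl⟩
  exact ⟨Equiv.ofBijective f hf, fun _ => rfl, rfl, rfl⟩

theorem IsConnectedBivalent.contractVerts (hG : G.IsConnectedBivalent) (u : G.V) :
    (G.contractVerts {u}).IsConnectedBivalent := by
  refine ⟨hG.nonempty.map (Quot.mk _), contractVerts_linked hG.linked _, fun v => ?_⟩
  refine degree_eq_two_iff.1 ((degree_congr (Function.Embedding.subtype _) ?_ ?_).symm.trans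
    (degree_eq_two_iff.2 (hG.bivalent v.1)))
  · exact fun k => (Subtype.ext_iff (a1 := (G.contractVerts {u}).vert k) (a2 := v)).symm
  · exact fun k hk => ⟨⟨k, fun hu => v.2 (hk ▸ hu)⟩, rfl⟩

theorem isEven_map_val_of_contractVerts (hij : i ≠ j)
    (hu : ∀ k, G.vert k = u ↔ k = i ∨ k = j) (hC : ∀ C : G.Circle, u ∉ C.verts)
    {S : Finset {k : G.I // G.vert k ∉ ({u} : Set G.V)}}
    (hS : IsEven (G := G.contractVerts {u}) S) :
    IsEven (S.map (Function.Embedding.subtype _)) := by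
  obtain ⟨r, hr⟩ := exists_contractVerts_edge_lift hu
  let T := S.map (Function.Embedding.subtype _)
  have hzero : (boundary T).mapDomain
      (Function.update id (Sum.inr (G.edge j)) (Sum.inr (G.edge i))) = 0 := by
    have hmap := mapDomain_boundary (G := G.contractVerts {u}) (Sum.map Subtype.val r) S
    rw [hS, Finsupp.mapDomain_zero] at hmap
    rw [mapDomain_boundary, Finset.sum_map, hmap]
    refine Finset.sum_congr rfl fun k _ => ?_
    refine congrArg₂ (· + ·) (congrArg (Finsupp.single · 1) ?_) (congrArg (Finsupp.single · 1) ?_)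
    · exact Function.update_of_ne Sum.inl_ne_inr _ _
    · refine Eq.trans ?_ (congrArg Sum.inr (hr (G.edge k)).symm)
      by_cases hk : G.edge k = G.edge j <;> simp [hk]
  have hT := add_mapDomain_update_id (Sum.inr (G.edge i)) (Sum.inr (G.edge j)) (boundary T)
  rw [hzero, add_zero] at hT
  by_cases hj : boundary T (Sum.inr (G.edge j)) = 0
  · rwa [hj, zero_smul] at hT
  · have hone : boundary T (Sum.inr (G.edge j)) = 1 := Fin.eq_one_of_ne_zero _ hj
    rw [hone, one_smul] at hT
    refine absurd (IsJoin.linked hT fun k hk => ?_)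
      (not_linked_edge_edge hij ((hu i).2 (Or.inl rfl)) ((hu j).2 (Or.inr rfl)) hC)
    obtain ⟨k, -, rfl⟩ := Finset.mem_map.1 hk
    exact k.2

end Contraction

end IncHypergraph

namespace OrientedHypergraph

open IncHypergraph

variable {G : OrientedHypergraph.{u}}

/-- Contraction of the vertex `u`, keeping the signs of all other incidences. -/
def contractVert (G : OrientedHypergraph.{u}) (u : G.V) : OrientedHypergraph.{u} where
  toIncHypergraph := G.contractVerts {u}
  σ k := G.σ k.1

section Contraction

variable {u : G.V} {i j : G.I}

theorem IsBalanced.contractVert (hb : G.IsBalanced) (hij : i ≠ j)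
    (hu : ∀ k, G.vert k = u ↔ k = i ∨ k = j)
    (hC : ∀ C : G.toIncHypergraph.Circle, u ∉ C.verts) : (G.contractVert u).IsBalanced := by
  rw [isBalanced_iff] at hb ⊢
  intro S hS
  exact (congrArg ((4 : ℤ) ∣ ·) (Finset.sum_map S _ fun k => (G.σ k : ℤ))).mp
    (hb _ (isEven_map_val_of_contractVerts hij hu hC hS))

theorem ParallelAgree.contractVert (hp : G.ParallelAgree) (hij : i ≠ j)
    (hu : ∀ k, G.vert k = u ↔ k = i ∨ k = j)
    (hC : ∀ C : G.toIncHypergraph.Circle, u ∉ C.verts) : (G.contractVert u).ParallelAgree := by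
  obtain ⟨r, hr⟩ := exists_contractVerts_edge_lift hu
  have hne {k l : G.I} (hk : G.vert k ≠ u) (hkl : G.vert k = G.vert l) (hki : G.edge k = G.edge i) :
      G.edge l ≠ G.edge j := by
    intro hlj
    refine not_linked_edge_edge hij ((hu i).2 (Or.inl rfl)) ((hu j).2 (Or.inr rfl)) hC ?_
    rw [← hki, ← hlj]
    exact (linked_vert_edge hk).symm.trans (hkl ▸ linked_vert_edge fun hl => hk (hkl.trans hl))
  rintro ⟨k, hk⟩ ⟨l, hl⟩ hv he
  have hv : G.vert k = G.vert l := Subtype.mk.inj hv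
  have hr : Function.update id (G.edge j) (G.edge i) (G.edge k) =
      Function.update id (G.edge j) (G.edge i) (G.edge l) :=
    (hr _).symm.trans ((congrArg r he).trans (hr _))
  refine hp k l hv ?_
  rw [Function.update_apply, Function.update_apply] at hr
  split_ifs at hr with hkj hlj hlj
  · exact hkj.trans hlj.symm
  · exact absurd hkj (hne hl hv.symm hr.symm)
  · exact absurd hlj (hne hk hv hr)
  · exact hr

theorem exists_iso_subdivide_contractVert (hij : i ≠ j)
    (hu : ∀ k, G.vert k = u ↔ k = i ∨ k = j) (he : G.edge i ≠ G.edge j) :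
    ∃ φ : Iso ((G.contractVert u).subdivide (Quot.mk _ (G.edge i))
      {k : {k : G.I // G.vert k ∉ ({u} : Set G.V)} | G.edge k.1 = G.edge j} (G.σ i) (G.σ j)) G,
      φ.onV (none : Option (({u}ᶜ : Set G.V))) = u := by
  obtain ⟨fE, hnone, hsome⟩ := exists_contractVerts_edge_equiv hu he
  obtain ⟨fI, hinl, hfalse, htrue⟩ := exists_incidence_equiv hij hu
  refine ⟨⟨⟨Equiv.optionSubtypeNe u, fE, fI, ?_, ?_⟩, ?_⟩, Equiv.optionSubtypeNe_none u⟩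
  · rintro (k | _ | _)
    · exact congrArg G.vert (hinl k)
    · exact (congrArg G.vert hfalse).trans ((hu i).2 (Or.inl rfl))
    · exact (congrArg G.vert htrue).trans ((hu j).2 (Or.inr rfl))
  · rintro (k | _ | _)
    · refine (congrArg G.edge (hinl k)).trans ?_
      by_cases hk : G.edge k.1 = G.edge j
      · have hmk : (Quot.mk _ (G.edge k.1) : (G.contractVert u).E) = Quot.mk _ (G.edge i) :=
          hk ▸ Quot.sound ⟨j, i, (hu j).2 (Or.inr rfl),
            ((hu j).2 (Or.inr rfl)).trans ((hu i).2 (Or.inl rfl)).symm, rfl, rfl⟩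
        exact hk.trans (hnone.symm.trans (congrArg fE (if_pos ⟨hmk, hk⟩).symm))
      · exact (hsome _ hk).symm.trans (congrArg fE (if_neg fun h => hk h.2).symm)
    · exact (congrArg G.edge hfalse).trans (hsome _ he).symm
    · exact (congrArg G.edge htrue).trans hnone.symm
  · rintro (k | _ | _)
    exacts [congrArg G.σ (hinl k), congrArg G.σ hfalse, congrArg G.σ htrue]

end Contraction

theorem exists_isBalancedSubdivision (G : OrientedHypergraph.{u})
    (hG : G.toIncHypergraph.IsConnectedBivalent) (hb : G.IsBalanced) :
    ∃ H : OrientedHypergraph.{u}, H.IsBalancedHypercircle ∧ H.IsBalancedSubdivision G ∧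
      (G.ParallelAgree → H.ParallelAgree) := by
  induction hn : Nat.card G.V using Nat.strong_induction_on generalizing G with
  | _ n ih =>
    by_cases hC : ∀ v, ∃ C : G.toIncHypergraph.Circle, v ∈ C.verts
    · exact ⟨G, ⟨hG.isHypercircle hC, hb⟩, Relation.ReflTransGen.refl, id⟩
    push Not at hC
    obtain ⟨u, hC⟩ := hC
    obtain ⟨i, j, hij, hu⟩ := hG.bivalent u
    have he : G.edge i ≠ G.edge j := fun h =>
      not_linked_edge_edge hij ((hu i).2 (Or.inl rfl)) ((hu j).2 (Or.inr rfl)) hC (h ▸ .refl _ _)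
    obtain ⟨H, hH, hsub, hpar⟩ := ih (Nat.card ({u}ᶜ : Set G.V))
      (hn ▸ Finite.card_subtype_lt (x := u) (by simp)) (G.contractVert u)
      (hG.contractVerts u) (hb.contractVert hij hu hC) rfl
    obtain ⟨φ, hφ⟩ := exists_iso_subdivide_contractVert hij hu he
    refine ⟨H, hH, hsub.tail ⟨_, _, _, _, ⟨φ⟩, ?_⟩,
      fun hp => hpar (hp.contractVert hij hu hC)⟩
    rcases Int.units_eq_one_or (G.σ i * G.σ j) with hs | hs
    · refine Or.inr ⟨hs, fun C hnone => ?_⟩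
      obtain ⟨D, hD⟩ := φ.toIso.exists_mem_verts hnone
      exact hC D (hφ ▸ hD)
    · exact Or.inl hs

end OrientedHypergraph

theorem theorem7 (G : OrientedHypergraph.{u}) (hG : ∀ v, G.degree v ≠ 0) :
    ((G.IsBalanced ∧ G.IsMinimallyDependent) ↔
      ∃ H : OrientedHypergraph.{u}, H.IsBalancedHypercircle ∧ H.IsBalancedSubdivision G) ∧
    (G.ParallelAgree →
      ((G.IsBalanced ∧ G.IsMinimallyDependent) ↔
        ∃ H : OrientedHypergraph.{u}, H.ParallelAgree ∧ H.IsBalancedHypercircle ∧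
          H.IsBalancedSubdivision G)) := by
  have hmp (h : G.IsBalanced ∧ G.IsMinimallyDependent) :=
    G.exists_isBalancedSubdivision (h.2.isConnectedBivalent h.1 hG) h.1
  have hmpr {H : OrientedHypergraph.{u}} (hH : H.IsBalancedHypercircle)
      (hHG : H.IsBalancedSubdivision G) : G.IsBalanced ∧ G.IsMinimallyDependent := by
    obtain ⟨hGc, hGb⟩ := hHG.isConnectedBivalent_and_isBalanced
      (hH.1.isConnectedBivalent (OrientedHypergraph.isBalanced_iff.1 hH.2)) hH.2
    exact ⟨hGb, hGb.isMinimallyDependent hGc⟩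
  refine ⟨⟨fun h => ?_, fun ⟨H, hH, hHG⟩ => hmpr hH hHG⟩,
    fun hp => ⟨fun h => ?_, fun ⟨H, _, hH, hHG⟩ => hmpr hH hHG⟩⟩
  · obtain ⟨H, hH, hHG, -⟩ := hmp h
    exact ⟨H, hH, hHG⟩
  · obtain ⟨H, hH, hHG, hHp⟩ := hmp h
    exact ⟨H, hHp hp, hH, hHG⟩
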